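/- **Setting.** A Boltzmann machine has $n_v$ visible and $n_h$ hidden binary units $z=(v,h)\in\{0,1\}^{n_v+n_h}$ on a connected simple graph with $E\ge 1$ edges, real biases $b_i$ and real weights $w_{ij}$ (on arbitrary edges: visible–hidden, visible–visible or hidden–hidden), and energy $\mathcal E(z)=-\sum_i b_iz_i-\sum_{\{i,j\}}w_{ij}z_iz_j$. Its Gibbs distribution is $P(z)=e^{-\mathcal E(z)}/Z$; for a visible vector $x$, the clamped Gibbs distribution is $P_x(h)=e^{-\mathcal E(x,h)}/Z_x$. For training vectors $x_1,\dots,x_{N}$, $N=N_{\rm train}\ge1$, and $\lambda\in\mathbb R$, $$O_{\rm ML}=\frac1{N}\sum_{k}\log\Big(\sum_hP(x_k,h)\Big)-\frac\lambda2\,w^Tw .$$ A mean-field approximation $Q$ of $P$ is a product distribution that minimizes $\mathrm{KL}(Q\|P)$ among all product distributions; put $\log Z_Q=\sum_zQ(z)\log\big(e^{-\mathcal E(z)}/Q(z)\big)$, and let $\kappa>0$ satisfy $e^{-\mathcal E(z)}/Z_Q\le\kappa\,Q(z)$ for all $z$. For each training vector $v$ let $Q_v$, $Z_{v,Q}$ and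 $\kappa_v$ be the corresponding objects for the hidden units with the visible units clamped to $v$. **Computational model.** Circuits over the gates $X$, $H$, $T$, CNOT and Toffoli are generated computably from the graph and a size parameter $\ell$ only. A sampling run proceeds in rounds $0,1,2,\dots$: in each round the classical input is loaded into a fresh register, the circuit for that round is applied, and a flag qubit and the output qubits are measured; the run returns the output in the first round in which the flag is $1$. Every loaded input bit, every gate and every measured qubit counts as one quantum operation. The classical input consists of $O(\ell)$-bit fixed-point representations of the biases, the weights, $\log\mu_i$ and $\log(1-\mu_i)$ for the marginals $\mu_i$ of the mean-field distribution, the logarithm of its partition function ($\log Z_Q$ or $\log Z_{v,Q}$), and $\log\kappa$ (or $\log\kappa_v$), together with the training vector in a clamped run. The operations for computing these input data classically, and for the final averaging below, are not counted. **Theorem (GEQS).** There are a quantum algorithm of this kind and constants $C,a$ such that the following holds for every Boltzmann machine and training set as above, and every integer $\ell\ge1$ such that $N$, $E$, $\kappa$, all $\kappa_v$, and the absolute values of all weights and biases are at most $2^\ell$. The algorithm draws, by independent runs, $N$ samples $s_1,\dots,s_N$ of all the units and, for every $k$, one sample $t_k$ of the hidden units for the training vector $x_k$, and estimates the gradient of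 $O_{\rm ML}$ with respect to all weights and biases by $$g_{w_{ij}}=\frac1N\sum_k\big((x_k,t_k)_i(x_k,t_k)_j-(s_k)_i(s_k)_j\big)-\lambda w_{ij},\qquad g_{b_i}=\frac1N\sum_k\big((x_k,t_k)_i-(s_k)_i\big).$$ 1. The expected total number of quantum operations is at most $$C\,N_{\rm train}\,E\,\Big(\sqrt\kappa+\sqrt{\max_v\kappa_v}\Big)\,\ell^{\,a},$$ the maximum being over the training vectors; that is, it is $\tilde O\big(N_{\rm train}E(\sqrt\kappa+\sqrt{\max_v\kappa_v})\big)$, with factors polylogarithmic in $N$, $E$, $\kappa$, the $\kappa_v$, the size of the parameters and the inverse of the numerical error. 2. The joint law of all the samples differs in $\ell^1$ distance by at most $2^{-\ell}$ from that of independent exact samples $s_k\sim P$ and $t_k\sim P_{x_k}$. 3. $O_{\rm ML}$ is differentiable, and every component $g_c$ of the estimate satisfies $$\big|\mathbb E[g_c]-\partial_cO_{\rm ML}\big|\le2^{-\ell},\qquad \mathbb E\big[(g_c-\partial_cO_{\rm ML})^2\big]\le\frac1{2N}+2^{-\ell}.$$ -/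

import Mathlib

noncomputable section

/-! ## Gibbs distributions of binary units and their mean-field approximations -/

/-- The partition function of the energy function `H` on configurations of `m` binary units. -/
def partitionFn {m : ℕ} (H : (Fin m → Bool) → ℝ) : ℝ :=
  ∑ z, Real.exp (-H z)

/-- The Gibbs distribution (inverse temperature 1) of the energy function `H`. -/
def gibbs {m : ℕ} (H : (Fin m → Bool) → ℝ) (z : Fin m → Bool) : ℝ :=
  Real.exp (-H z) / partitionFn H

/-- The product distribution under which unit `i` takes the value 1 with probability `μ i`. -/
def productDist {m : ℕ} (μ : Fin m → ℝ) (z : Fin m → Bool) : ℝ :=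
  ∏ i, if z i then μ i else 1 - μ i

/-- The Kullback–Leibler divergence `KL(Q ‖ P)` (with `0 log 0 = 0`). -/
def klDivergence {m : ℕ} (Q P : (Fin m → Bool) → ℝ) : ℝ :=
  ∑ z, Q z * Real.log (Q z / P z)

/-- `μ` are mean-field parameters for `H`: the product distribution with marginals `μ` minimizes
`KL(Q ‖ P)` among all product distributions `Q`, where `P` is the Gibbs distribution of `H`. -/
def IsMeanField {m : ℕ} (H : (Fin m → Bool) → ℝ) (μ : Fin m → ℝ) : Prop :=
  (∀ i, μ i ∈ Set.Icc (0 : ℝ) 1) ∧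
    ∀ μ' : Fin m → ℝ, (∀ i, μ' i ∈ Set.Icc (0 : ℝ) 1) →
      klDivergence (productDist μ) (gibbs H) ≤ klDivergence (productDist μ') (gibbs H)

/-- The logarithm of the variational partition function `Z_Q` of the product distribution `Q` with
marginals `μ`: `log Z_Q = ∑ Q log (e^{-H} / Q)`. -/
def logZQ {m : ℕ} (H : (Fin m → Bool) → ℝ) (μ : Fin m → ℝ) : ℝ :=
  ∑ z, productDist μ z * Real.log (Real.exp (-H z) / productDist μ z)

/-- The promise on `κ`: `e^{-H(z)} / Z_Q ≤ κ Q(z)` for all configurations `z`. -/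
def IsKappa {m : ℕ} (H : (Fin m → Bool) → ℝ) (μ : Fin m → ℝ) (κ : ℝ) : Prop :=
  0 < κ ∧ ∀ z, Real.exp (-H z) / Real.exp (logZQ H μ) ≤ κ * productDist μ z

/-! ## Boltzmann machines -/

/-- The interaction graph of a Boltzmann machine. The units are `Fin (nv + nh)`, the first `nv` of
them visible and the other `nh` hidden; the edges are enumerated without repetition, each written
with its smaller endpoint first. -/
structure BMGraph where
  nv : ℕ
  nh : ℕ
  numEdges : ℕ
  ends : Fin numEdges → Fin (nv + nh) × Fin (nv + nh)
  ends_lt : ∀ e, (ends e).1 < (ends e).2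
  ends_injective : Function.Injective ends

namespace BMGraph

/-- The underlying simple graph. -/
def graph (G : BMGraph) : SimpleGraph (Fin (G.nv + G.nh)) :=
  SimpleGraph.fromRel fun i j => ∃ e, G.ends e = (i, j)

/-- Configurations of all units. -/
abbrev Config (G : BMGraph) := Fin (G.nv + G.nh) → Bool

/-- Configurations of the visible units. -/
abbrev Visible (G : BMGraph) := Fin G.nv → Bool

/-- Configurations of the hidden units. -/
abbrev Hidden (G : BMGraph) := Fin G.nh → Bool

/-- Parameters of the machine: a bias for every unit and a weight for every edge. -/
abbrev Params (G : BMGraph) := EuclideanSpace ℝ (Fin (G.nv + G.nh) ⊕ Fin G.numEdges)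

/-- The joint configuration `(v, h)`. -/
def join (G : BMGraph) (v : G.Visible) (h : G.Hidden) : G.Config := Fin.append v h

/-- The statistic paired with each parameter in the energy: `z_i` for the bias of the unit `i`, and
`z_i z_j` for the weight of the edge `{i, j}`. -/
def statistic (G : BMGraph) (z : G.Config) : Fin (G.nv + G.nh) ⊕ Fin G.numEdges → ℝ
  | Sum.inl i => if z i then 1 else 0
  | Sum.inr e => (if z (G.ends e).1 then 1 else 0) * (if z (G.ends e).2 then 1 else 0)

/-- The energy `-∑ (bias_i z_i) - ∑ (w_{ij} z_i z_j)`. -/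
def energy (G : BMGraph) (θ : G.Params) (z : G.Config) : ℝ :=
  -∑ i, θ (Sum.inl i) * G.statistic z (Sum.inl i)
    - ∑ e, θ (Sum.inr e) * G.statistic z (Sum.inr e)

/-- The energy of the hidden units when the visible units are clamped to `x`. -/
def clampedEnergy (G : BMGraph) (θ : G.Params) (x : G.Visible) (h : G.Hidden) : ℝ :=
  G.energy θ (G.join x h)

/-- The regularized maximum-likelihood objective
`(1/N) ∑_k log (∑_h P(x_k, h)) - (lam/2) wᵀ w` (only the weights are regularized). -/
def objective (G : BMGraph) {N : ℕ} (x : Fin N → G.Visible) (lam : ℝ) (θ : G.Params) : ℝ :=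
  (1 / (N : ℝ)) * ∑ k, Real.log (∑ h, gibbs (G.energy θ) (G.join (x k) h))
    - lam / 2 * ∑ e, θ (Sum.inr e) ^ 2

/-- The coefficient of the regularization in the derivative for each parameter. -/
def regularized (G : BMGraph) (θ : G.Params) : Fin (G.nv + G.nh) ⊕ Fin G.numEdges → ℝ
  | Sum.inl _ => 0
  | Sum.inr e => θ (Sum.inr e)

/-- The gradient estimate computed from `N` samples `s` of the model and one sample `t k` of the
hidden units for every training vector `x k`: the empirical data average minus the empirical model
average of each statistic, minus `lam * w` for the weights. -/
def estimate (G : BMGraph) {N : ℕ} (x : Fin N → G.Visible) (lam : ℝ) (θ : G.Params)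
    (s : Fin N → G.Config) (t : Fin N → G.Hidden) (c : Fin (G.nv + G.nh) ⊕ Fin G.numEdges) : ℝ :=
  (1 / (N : ℝ)) * ∑ k, (G.statistic (G.join (x k) (t k)) c - G.statistic (s k) c)
    - lam * G.regularized θ c

end BMGraph

/-! ## Quantum circuits -/

/-- Elementary gates on qubits numbered by `ℕ`: Pauli X, Hadamard, the `T` gate, controlled-NOT
(control, target) and Toffoli (control, control, target). -/
inductive Gate where
  | X (i : ℕ)
  | H (i : ℕ)
  | T (i : ℕ)
  | CX (c t : ℕ)
  | CCX (c d t : ℕ)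

namespace Gate

/-- Gates as a sum type, used only to encode them. -/
def equivSum : Gate ≃ ℕ ⊕ ℕ ⊕ ℕ ⊕ (ℕ × ℕ) ⊕ (ℕ × ℕ × ℕ) where
  toFun
    | X i => Sum.inl i
    | H i => Sum.inr (Sum.inl i)
    | T i => Sum.inr (Sum.inr (Sum.inl i))
    | CX c t => Sum.inr (Sum.inr (Sum.inr (Sum.inl (c, t))))
    | CCX c d t => Sum.inr (Sum.inr (Sum.inr (Sum.inr (c, d, t))))
  invFun
    | Sum.inl i => X i
    | Sum.inr (Sum.inl i) => H i
    | Sum.inr (Sum.inr (Sum.inl i)) => T i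
    | Sum.inr (Sum.inr (Sum.inr (Sum.inl (c, t)))) => CX c t
    | Sum.inr (Sum.inr (Sum.inr (Sum.inr (c, d, t)))) => CCX c d t
  left_inv g := by cases g <;> rfl
  right_inv s := by rcases s with _ | _ | _ | ⟨_, _⟩ | ⟨_, _, _⟩ <;> rfl

instance : Primcodable Gate := Primcodable.ofEquiv _ equivSum

end Gate

/-- A state of the register. Qubits are numbered by `ℕ` and all but finitely many are 0; the
computational basis state in which exactly the qubits of the finite set `S` are 1 is
`Finsupp.single S 1`. -/
abbrev QState := Finset ℕ →₀ ℂ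

/-- Flip the qubit `i` of a basis state. -/
def flipQubit (i : ℕ) (S : Finset ℕ) : Finset ℕ := symmDiff S {i}

namespace Gate

/-- The action of a gate on basis states. A controlled gate whose target is one of its controls is
not a legitimate gate, and acts as the identity. -/
def onBasis : Gate → Finset ℕ → QState
  | X i, S => Finsupp.single (flipQubit i S) 1
  | H i, S => ((1 / Real.sqrt 2 : ℝ) : ℂ) •
      (Finsupp.single (S.erase i) 1 + Finsupp.single (insert i S) (if i ∈ S then -1 else 1))
  | T i, S => Finsupp.single S (if i ∈ S then Complex.exp (Complex.I * (Real.pi / 4)) else 1)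
  | CX c t, S => Finsupp.single (if c ∈ S ∧ c ≠ t then flipQubit t S else S) 1
  | CCX c d t, S =>
      Finsupp.single (if c ∈ S ∧ d ∈ S ∧ c ≠ t ∧ d ≠ t then flipQubit t S else S) 1

/-- The linear operator of a gate. -/
def apply (g : Gate) : QState →ₗ[ℂ] QState := Finsupp.linearCombination ℂ g.onBasis

end Gate

/-- Run the gates of a circuit, the head of the list first. -/
def runCircuit (gates : List Gate) (ψ : QState) : QState :=
  gates.foldl (fun φ g => g.apply φ) ψ

/-- The basis state in which the qubits `0, 1, …` hold the bits of `input` and all others are 0. -/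
def loadInput (input : List Bool) : QState :=
  Finsupp.single ((Finset.range input.length).filter fun i => input.getD i false = true) 1

/-! ## Repeat-until-success sampling

Round `τ = 0, 1, 2, …` loads the input into a fresh register, runs the circuit `C τ`, and measures,
in the computational basis, the flag qubit (the first one after the input) and the `m` output qubits
that follow it. If the flag is 1 the output bits are returned; otherwise the next round starts. -/

open Classical in
/-- The probability that the round with circuit `gates` ends with flag 1 and output `y`. -/
def acceptProb (gates : List Gate) (input : List Bool) (m : ℕ) (y : Fin m → Bool) : ℝ :=
  let ψ := runCircuit gates (loadInput input)
  ∑ S ∈ ψ.support with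
      input.length ∈ S ∧ ∀ j : Fin m, (input.length + 1 + (j : ℕ) ∈ S ↔ y j = true),
    ‖ψ S‖ ^ 2

/-- The probability that the rounds before round `τ` have all failed. -/
def reachProb (C : ℕ → List Gate) (input : List Bool) (m : ℕ) (τ : ℕ) : ℝ :=
  ∏ σ ∈ Finset.range τ, (1 - ∑ y, acceptProb (C σ) input m y)

/-- The law of the output. -/
def outputLaw (C : ℕ → List Gate) (input : List Bool) (m : ℕ) (y : Fin m → Bool) : ℝ :=
  ∑' τ, reachProb C input m τ * acceptProb (C τ) input m y

/-- The expected number of quantum operations: every round costs one operation for each input bit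
that is loaded, one for each gate, and one for each of the `1 + m` measured qubits. -/
def expectedOps (C : ℕ → List Gate) (input : List Bool) (m : ℕ) : ENNReal :=
  ∑' τ, ENNReal.ofReal (reachProb C input m τ) *
    ((input.length + (C τ).length + (1 + m) : ℕ) : ENNReal)

/-! ## Uniform algorithms and their inputs -/

/-- The instance data that the circuits may depend on: the numbers of visible and of hidden units,
the edges, and the size parameter `ℓ`. No weight, bias, mean-field parameter, constant `κ` or
training vector is part of it. -/
abbrev Shape := ℕ × ℕ × List (ℕ × ℕ) × ℕ

/-- The shape of a graph with size parameter `ℓ`. -/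
def BMGraph.shape (G : BMGraph) (ℓ : ℕ) : Shape :=
  (G.nv, G.nh, List.ofFn fun e => (((G.ends e).1 : ℕ), ((G.ends e).2 : ℕ)), ℓ)

/-- A uniform quantum sampling algorithm: two computable families of circuits, one for sampling the
model and one for sampling the hidden units given a training vector, indexed by the shape and by the
number of the round; all real inputs are read to `prec * ℓ` fractional bits. -/
structure SamplingAlgorithm where
  model : Shape → ℕ → List Gate
  data : Shape → ℕ → List Gate
  computable_model : Computable₂ model
  computable_data : Computable₂ data
  prec : ℕ

/-- The `p`-bit fixed-point representation of a real number: the lowest `2 p` bits of the two's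
complement expansion of `⌊2^p r⌋`, the least significant bit first. -/
def encodeReal (p : ℕ) (r : ℝ) : List Bool :=
  (List.range (2 * p)).map fun j => Int.testBit ⌊r * 2 ^ p⌋ j

/-- The fixed-point representations of the entries of a vector, one after the other. -/
def encodeVec (p : ℕ) {m : ℕ} (r : Fin m → ℝ) : List Bool :=
  (List.ofFn r).flatMap (encodeReal p)

namespace BMGraph

/-- The classical input of a run: the biases and weights, the product distribution with marginals
`μ` (through `log μ_i` and `log (1 - μ_i)`), `log Z_Q`, and `log κ`. -/
def encodeInput (G : BMGraph) (p : ℕ) (θ : G.Params) {m : ℕ} (μ : Fin m → ℝ) (logZ κ : ℝ) :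
    List Bool :=
  encodeVec p (fun i => θ (Sum.inl i)) ++ encodeVec p (fun e => θ (Sum.inr e)) ++
    encodeVec p (fun i => Real.log (μ i)) ++ encodeVec p (fun i => Real.log (1 - μ i)) ++
    encodeReal p logZ ++ encodeReal p (Real.log κ)

/-- The input for sampling the model. -/
def modelInput (G : BMGraph) (p : ℕ) (θ : G.Params) (μ : Fin (G.nv + G.nh) → ℝ) (κ : ℝ) :
    List Bool :=
  G.encodeInput p θ μ (logZQ (G.energy θ) μ) κ

/-- The input for sampling the hidden units with the visible units clamped to `x`. -/
def dataInput (G : BMGraph) (p : ℕ) (θ : G.Params) (x : G.Visible) (ν : Fin G.nh → ℝ) (κ : ℝ) :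
    List Bool :=
  G.encodeInput p θ ν (logZQ (G.clampedEnergy θ x) ν) κ ++ List.ofFn x

/-- The law of `N` independent model samples `s` and of independent samples `t k` of the hidden
units, one for each `k`, when a single model sample has law `P` and `t k` has law `R k`. -/
def jointLaw (G : BMGraph) {N : ℕ} (P : G.Config → ℝ) (R : Fin N → G.Hidden → ℝ)
    (s : Fin N → G.Config) (t : Fin N → G.Hidden) : ℝ :=
  ∏ k, P (s k) * R k (t k)

end BMGraph

namespace SamplingAlgorithm

/-- The law of one model sample produced by the algorithm. -/
def modelLaw (A : SamplingAlgorithm) (G : BMGraph) (ℓ : ℕ) (θ : G.Params)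
    (μ : Fin (G.nv + G.nh) → ℝ) (κ : ℝ) : G.Config → ℝ :=
  outputLaw (A.model (G.shape ℓ)) (G.modelInput (A.prec * ℓ) θ μ κ) (G.nv + G.nh)

/-- The law of one sample of the hidden units for the training vector `x`. -/
def dataLaw (A : SamplingAlgorithm) (G : BMGraph) (ℓ : ℕ) (θ : G.Params) (x : G.Visible)
    (ν : Fin G.nh → ℝ) (κ : ℝ) : G.Hidden → ℝ :=
  outputLaw (A.data (G.shape ℓ)) (G.dataInput (A.prec * ℓ) θ x ν κ) G.nh

/-- The expected number of quantum operations for `N` model samples and one sample of the hidden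
units for each of the `N` training vectors. -/
def totalExpectedOps (A : SamplingAlgorithm) (G : BMGraph) (ℓ : ℕ) (θ : G.Params) {N : ℕ}
    (x : Fin N → G.Visible) (μ : Fin (G.nv + G.nh) → ℝ) (κ : ℝ)
    (ν : Fin N → Fin G.nh → ℝ) (κx : Fin N → ℝ) : ENNReal :=
  N * expectedOps (A.model (G.shape ℓ)) (G.modelInput (A.prec * ℓ) θ μ κ) (G.nv + G.nh) +
    ∑ k, expectedOps (A.data (G.shape ℓ)) (G.dataInput (A.prec * ℓ) θ (x k) (ν k) (κx k)) G.nh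

end SamplingAlgorithm

end

/-!
The mean-field distribution `Q` is a proposal for rejection sampling: if `z ~ Q` is accepted with
probability `exp (-H z) / (Z_Q κ Q z)`, which is at most `1` by the choice of `κ`, the accepted
samples have exactly the Gibbs law of `H`, and the probability of acceptance is `Z / (Z_Q κ) ≥ 1 / κ`
by Gibbs' inequality `Z_Q ≤ Z` (`IsKappa.acceptance_mem`, `IsKappa.productDist_mul_exp_logRatio`).
Clamped runs are the special case in which some of the units are constant.

The sampler is a reversible classical computation on uniform random bits, and Grover search over
these bits replaces `κ` by `√κ`. The amplitudes of all accepted words stay equal during the search,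
so that a successful round has the conditional law of the classical sampler, whatever the number of
iterations (`acceptProb_groverCircuit`, `Shape.acceptProb_round`). Hence the unknown success
probability affects the running time only, and rounding is the only source of error in the law.
With `(3^k - 1) / 2` iterations the success probability is `sin² (3^k θ)`, where `sin² θ` is the
probability of acceptance; some `k` makes this at least `1 / 4`. The rounds go through all `k`,
cut off at a bound that grows so slowly that the late, long rounds are rarely reached: the expected
number of iterations is `O(ℓ √κ)` (`outputLaw_and_expectedOps_of_acceptProb`).

The arithmetic (`Shape.wire_acceptCircuit`) is chosen to need neither division nor a circuit for the
exponential function. A Bernoulli variable with parameter `exp (-x)`, `x` a fixed-point number, is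
the conjunction, over the bits `2^j` of `x`, of independent Bernoulli variables with parameters
`exp (-2^j)`. These parameters are constants of the circuit, computed by repeated squaring
(`squares_div_le`), and a comparison with a uniform random number realizes each of them. Applied to
`x = -log μ_i` this samples from `Q`; applied to minus the sum of the terms of the log acceptance
probability, computed by ripple-carry addition in two's complement, it decides on acceptance
(`abs_expProb_sub_exp_le`). To subtract a term its bits are complemented without adding one; this
makes all rounding errors downward, so that the rounded sum is still negative.

With `20 ℓ` fractional bits the weights of all samples are exact up to `2^{-12 ℓ}` in total. After
division by the acceptance probability the law of a run is within `2^{-11 ℓ}` of the Gibbs law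
(`Shape.run_spec`, `BMGraph.sampleShape_run_spec`), and telescoping over the `2 N ≤ 2^{ℓ+1}` runs
bounds the distance of the joint laws. Finally, a log partition function has the mean of the
sufficient statistics as its gradient, so the estimate is unbiased under exact samples
(`BMGraph.gradient_objective`); every statistic takes values in `[0, 1]` and has variance at most
`1 / 4`, and the estimate is an average of `N` independent differences of two of them
(`BMGraph.moments_estimate`). As the estimate deviates from its mean by at most `2`, the `ℓ¹`
distance of the laws controls the change of both moments (`BMGraph.moments_estimate_of_close`).
-/

noncomputable section

/-! ### Circuits as linear maps -/

/-- A circuit as a linear map on states. -/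
def circuitMap : List Gate → QState →ₗ[ℂ] QState
  | [] => LinearMap.id
  | g :: gs => circuitMap gs ∘ₗ g.apply

theorem runCircuit_eq_circuitMap (gs : List Gate) (ψ : QState) :
    runCircuit gs ψ = circuitMap gs ψ := by
  induction gs generalizing ψ with
  | nil => rfl
  | cons g gs ih => exact ih _

theorem circuitMap_append (gs hs : List Gate) (ψ : QState) :
    circuitMap (gs ++ hs) ψ = circuitMap hs (circuitMap gs ψ) := by
  induction gs generalizing ψ with
  | nil => rfl
  | cons g gs ih => exact ih _

theorem Gate.apply_single (g : Gate) (S : Finset ℕ) (a : ℂ) :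
    g.apply (Finsupp.single S a) = a • g.onBasis S := by
  simp [Gate.apply]

/-! ### Reversible classical circuits and phase oracles -/

/-- One Toffoli gate `(c, d, t)` on basis states; `c = d` is allowed and gives a controlled NOT. -/
def toffoliStep (S : Finset ℕ) (g : ℕ × ℕ × ℕ) : Finset ℕ :=
  if g.1 ∈ S ∧ g.2.1 ∈ S ∧ g.1 ≠ g.2.2 ∧ g.2.1 ≠ g.2.2 then flipQubit g.2.2 S else S

/-- A list of Toffoli gates on basis states. -/
def toffoliRun (gs : List (ℕ × ℕ × ℕ)) (S : Finset ℕ) : Finset ℕ := gs.foldl toffoliStep S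

/-- The circuit of a list of triples `(control, control, target)`. -/
def toffolis (gs : List (ℕ × ℕ × ℕ)) : List Gate := gs.map fun g => Gate.CCX g.1 g.2.1 g.2.2

theorem mem_flipQubit {i w : ℕ} {S : Finset ℕ} :
    w ∈ flipQubit i S ↔ if w = i then w ∉ S else w ∈ S := by
  unfold flipQubit
  by_cases h : w = i <;> simp [Finset.mem_symmDiff, h]

theorem toffoliStep_toffoliStep (S : Finset ℕ) (g : ℕ × ℕ × ℕ) :
    toffoliStep (toffoliStep S g) g = S := by
  obtain ⟨c, d, t⟩ := g
  unfold toffoliStep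
  by_cases h : c ∈ S ∧ d ∈ S ∧ c ≠ t ∧ d ≠ t
  · obtain ⟨h1, h2, h3, h4⟩ := h
    have : flipQubit t (flipQubit t S) = S := by simp [flipQubit]
    simp [mem_flipQubit, h1, h2, h3, h4, this]
  · simp only [h, if_false]

theorem toffoliRun_append (gs hs : List (ℕ × ℕ × ℕ)) (S : Finset ℕ) :
    toffoliRun (gs ++ hs) S = toffoliRun hs (toffoliRun gs S) := by
  simp [toffoliRun]

/-- Reversing the order of the gates uncomputes, since every gate is an involution. -/
theorem toffoliRun_reverse (gs : List (ℕ × ℕ × ℕ)) (S : Finset ℕ) :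
    toffoliRun gs.reverse (toffoliRun gs S) = S := by
  induction gs generalizing S with
  | nil => rfl
  | cons g gs ih =>
    rw [List.reverse_cons, toffoliRun_append]
    have : toffoliRun (g :: gs) S = toffoliRun gs (toffoliStep S g) := rfl
    rw [this, ih]
    exact toffoliStep_toffoliStep S g

theorem toffoliRun_injective (gs : List (ℕ × ℕ × ℕ)) : Function.Injective (toffoliRun gs) :=
  Function.LeftInverse.injective (toffoliRun_reverse gs)

theorem circuitMap_toffolis (gs : List (ℕ × ℕ × ℕ)) (S : Finset ℕ) (a : ℂ) :
    circuitMap (toffolis gs) (Finsupp.single S a) = Finsupp.single (toffoliRun gs S) a := by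
  induction gs generalizing S with
  | nil => rfl
  | cons g gs ih =>
    change circuitMap (toffolis gs) ((Gate.CCX g.1 g.2.1 g.2.2).apply (Finsupp.single S a)) = _
    rw [Gate.apply_single]
    have : a • (Gate.CCX g.1 g.2.1 g.2.2).onBasis S = Finsupp.single (toffoliStep S g) a := by
      simp [Gate.onBasis, toffoliStep]
    rw [this, ih]
    rfl

/-- Compute with `gs`, flip the phase if the wire `f` is set (`Z = T⁴`), and uncompute. -/
def phaseOracle (gs : List (ℕ × ℕ × ℕ)) (f : ℕ) : List Gate :=
  toffolis gs ++ (List.replicate 4 (Gate.T f) ++ toffolis gs.reverse)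

theorem circuitMap_T_four (f : ℕ) (S : Finset ℕ) (a : ℂ) :
    circuitMap (List.replicate 4 (Gate.T f)) (Finsupp.single S a) =
      Finsupp.single S (if f ∈ S then -a else a) := by
  have h4 : Complex.exp (Complex.I * (Real.pi / 4)) ^ 4 = -1 := by
    rw [← Complex.exp_nat_mul, ← Complex.exp_pi_mul_I]
    congr 1
    push_cast
    ring
  have h1 : ∀ b : ℂ, (Gate.T f).apply (Finsupp.single S b) =
      Finsupp.single S (b * (if f ∈ S then Complex.exp (Complex.I * (Real.pi / 4)) else 1)) := by
    intro b
    rw [Gate.apply_single]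
    simp only [Gate.onBasis, Finsupp.smul_single, smul_eq_mul]
  simp only [List.replicate, circuitMap, LinearMap.comp_apply, h1, LinearMap.id_apply]
  congr 1
  split_ifs with h
  · linear_combination a * h4
  · ring

theorem circuitMap_phaseOracle (gs : List (ℕ × ℕ × ℕ)) (f : ℕ) (S : Finset ℕ) (a : ℂ) :
    circuitMap (phaseOracle gs f) (Finsupp.single S a) =
      Finsupp.single S (if f ∈ toffoliRun gs S then -a else a) := by
  rw [phaseOracle, circuitMap_append, circuitMap_append, circuitMap_toffolis, circuitMap_T_four,
    circuitMap_toffolis, toffoliRun_reverse]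

/-! ### Hadamard layers -/

/-- Hadamard gates on a list of qubits. -/
def hadamards (us : List ℕ) : List Gate := us.map Gate.H

theorem inv_sqrt_two_mul_self :
    ((1 / Real.sqrt 2 : ℝ) : ℂ) * ((1 / Real.sqrt 2 : ℝ) : ℂ) = 1 / 2 := by
  rw [← Complex.ofReal_mul]
  have : (1 / Real.sqrt 2) * (1 / Real.sqrt 2) = 1 / 2 := by
    rw [div_mul_div_comm, Real.mul_self_sqrt (by norm_num)]
    norm_num
  rw [this]
  norm_num

theorem Gate.H_apply_H_apply (i : ℕ) (ψ : QState) : (H i).apply ((H i).apply ψ) = ψ := by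
  suffices h : (H i).apply ∘ₗ (H i).apply = LinearMap.id from LinearMap.congr_fun h ψ
  refine Finsupp.lhom_ext fun S b => ?_
  have key := inv_sqrt_two_mul_self
  rw [LinearMap.comp_apply, Gate.apply_single, map_smul, LinearMap.id_apply]
  simp only [Gate.onBasis, map_smul, map_add, Gate.apply_single, smul_smul]
  generalize ((1 / Real.sqrt 2 : ℝ) : ℂ) = r at key
  by_cases h : i ∈ S
  · simp only [h, if_true, Finset.notMem_erase, if_false, Finset.insert_erase,
      Finset.insert_eq_of_mem, smul_add, Finsupp.smul_single,
      smul_eq_mul, Finset.erase_idem]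
    ext T
    simp only [Finsupp.add_apply, Finsupp.single_apply]
    split_ifs <;> first | linear_combination 2 * b * key | ring
  · simp only [h, if_false, Finset.erase_eq_of_notMem, not_false_eq_true,
      Finset.mem_insert, true_or, if_true, Finset.insert_idem, Finset.erase_insert,
      smul_add, Finsupp.smul_single, smul_eq_mul]
    ext T
    simp only [Finsupp.add_apply, Finsupp.single_apply]
    split_ifs <;> first | linear_combination 2 * b * key | ring

/-- A Hadamard layer is undone by the same gates in reverse order. -/
theorem circuitMap_hadamards_reverse (us : List ℕ) (ψ : QState) :
    circuitMap (hadamards us.reverse) (circuitMap (hadamards us) ψ) = ψ := by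
  induction us generalizing ψ with
  | nil => rfl
  | cons u us ih =>
    have h1 : circuitMap (hadamards (u :: us)) ψ =
      circuitMap (hadamards us) ((Gate.H u).apply ψ) := rfl
    rw [h1, List.reverse_cons, hadamards, List.map_append, circuitMap_append]
    have := ih ((Gate.H u).apply ψ)
    rw [hadamards] at this
    rw [this]
    exact Gate.H_apply_H_apply u ψ

theorem circuitMap_hadamards_single (us : List ℕ) (hus : us.Nodup) (D : Finset ℕ)
    (hD : ∀ u ∈ us, u ∉ D) (a : ℂ) :
    circuitMap (hadamards us) (Finsupp.single D a) =
      ∑ A ∈ us.toFinset.powerset,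
        Finsupp.single (D ∪ A) (((1 / Real.sqrt 2 : ℝ) : ℂ) ^ us.length * a) := by
  induction us generalizing D a with
  | nil => simp [hadamards, circuitMap]
  | cons u us ih =>
    rw [List.nodup_cons] at hus
    have hu : u ∉ D := hD u (by simp)
    change circuitMap (hadamards us) ((Gate.H u).apply (Finsupp.single D a)) = _
    rw [Gate.apply_single]
    have e : a • (Gate.H u).onBasis D = Finsupp.single D (a * ((1 / Real.sqrt 2 : ℝ) : ℂ)) +
        Finsupp.single (insert u D) (a * ((1 / Real.sqrt 2 : ℝ) : ℂ)) := by
      simp [Gate.onBasis, hu, Finset.erase_eq_of_notMem]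
    rw [e, map_add, ih hus.2 D (fun w hw => hD w (by simp [hw])),
      ih hus.2 (insert u D) (fun w hw => by
        rw [Finset.mem_insert, not_or]
        exact ⟨fun h => hus.1 (h ▸ hw), hD w (by simp [hw])⟩)]
    rw [List.toFinset_cons, Finset.sum_powerset_insert (by simpa using hus.1)]
    simp only [List.length_cons, pow_succ, Finset.insert_union, Finset.union_insert]
    congr 1 <;> refine Finset.sum_congr rfl fun A _ => ?_ <;> congr 1 <;> ring

theorem circuitMap_hadamards_single_apply_eq_zero (us : List ℕ) {i : ℕ} (hi : i ∉ us)
    {S D : Finset ℕ} (hS : i ∈ S) (hD : i ∉ D) (a : ℂ) :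
    circuitMap (hadamards us) (Finsupp.single S a) D = 0 := by
  induction us generalizing S a with
  | nil =>
    rw [show circuitMap (hadamards []) (Finsupp.single S a) = Finsupp.single S a from rfl,
      Finsupp.single_apply, if_neg]
    rintro rfl
    exact hD hS
  | cons u us ih =>
    rw [List.mem_cons, not_or] at hi
    change circuitMap (hadamards us) ((Gate.H u).apply (Finsupp.single S a)) D = _
    rw [Gate.apply_single]
    simp only [Gate.onBasis, map_smul, map_add, Finsupp.smul_apply, Finsupp.add_apply]
    rw [ih hi.2 (by simp [hS, hi.1]), ih hi.2 (by simp [hS])]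
    simp

/-- The amplitude of the all-zero word after a Hadamard layer does not depend on the initial
word. -/
theorem circuitMap_hadamards_single_apply (us : List ℕ) (hus : us.Nodup) {S D : Finset ℕ}
    (hD : ∀ u ∈ us, u ∉ D) (hS : S \ us.toFinset = D) (a : ℂ) :
    circuitMap (hadamards us) (Finsupp.single S a) D =
      ((1 / Real.sqrt 2 : ℝ) : ℂ) ^ us.length * a := by
  induction us generalizing S a with
  | nil =>
    simp only [List.toFinset_nil, Finset.sdiff_empty] at hS
    subst hS
    simp [hadamards, circuitMap]
  | cons u us ih =>
    rw [List.nodup_cons] at hus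
    change circuitMap (hadamards us) ((Gate.H u).apply (Finsupp.single S a)) D = _
    rw [Gate.apply_single]
    simp only [Gate.onBasis, map_smul, map_add, Finsupp.smul_apply, Finsupp.add_apply]
    rw [ih hus.2 (fun w hw => hD w (by simp [hw])) (by
        rw [← hS]; ext w; simp only [Finset.mem_sdiff, Finset.mem_erase, List.mem_toFinset,
          List.mem_cons]; tauto),
      circuitMap_hadamards_single_apply_eq_zero us hus.1 (Finset.mem_insert_self u S)
        (hD u (by simp))]
    simp only [smul_eq_mul, List.length_cons, pow_succ]
    ring

/-! ### Amplitude amplification -/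

/-- The superposition of the basis states `D ∪ A` for `A ⊆ U`, with amplitudes `f A`. -/
def superpos (D U : Finset ℕ) : (Finset ℕ → ℂ) →ₗ[ℂ] QState where
  toFun f := ∑ A ∈ U.powerset, Finsupp.single (D ∪ A) (f A)
  map_add' f g := by simp [Finset.sum_add_distrib]
  map_smul' c f := by simp [Finset.smul_sum]

theorem superpos_apply (D U : Finset ℕ) (f : Finset ℕ → ℂ) :
    superpos D U f = ∑ A ∈ U.powerset, Finsupp.single (D ∪ A) (f A) := rfl

theorem superpos_congr {D U : Finset ℕ} {f g : Finset ℕ → ℂ} (h : ∀ A ⊆ U, f A = g A) :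
    superpos D U f = superpos D U g := by
  rw [superpos_apply, superpos_apply]
  exact Finset.sum_congr rfl fun A hA => by rw [h A (Finset.mem_powerset.1 hA)]

theorem single_mem_range_superpos {D U A : Finset ℕ} (hA : A ⊆ U) (c : ℂ) :
    Finsupp.single (D ∪ A) c ∈ LinearMap.range (superpos D U) := by
  classical
  refine ⟨Pi.single A c, ?_⟩
  rw [superpos_apply, Finset.sum_eq_single A]
  · simp
  · intro B _ hB
    simp [hB]
  · intro h
    exact absurd (Finset.mem_powerset.2 hA) h

theorem circuitMap_hadamards_mem_range {D U : Finset ℕ} (us : List ℕ) (hus : ∀ u ∈ us, u ∈ U)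
    (hD : ∀ u ∈ us, u ∉ D) {ψ : QState} (hψ : ψ ∈ LinearMap.range (superpos D U)) :
    circuitMap (hadamards us) ψ ∈ LinearMap.range (superpos D U) := by
  induction us generalizing ψ with
  | nil => exact hψ
  | cons u us ih =>
    change circuitMap (hadamards us) ((Gate.H u).apply ψ) ∈ _
    refine ih (fun w hw => hus w (by simp [hw])) (fun w hw => hD w (by simp [hw])) ?_
    obtain ⟨f, rfl⟩ := hψ
    rw [superpos_apply, map_sum]
    refine Submodule.sum_mem _ fun A hA => ?_
    have hA := Finset.mem_powerset.1 hA
    have huD := hD u (by simp)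
    rw [Gate.apply_single]
    simp only [Gate.onBasis]
    refine Submodule.smul_mem _ _ (Submodule.smul_mem _ _ (Submodule.add_mem _ ?_ ?_))
    · rw [Finset.erase_union_distrib, Finset.erase_eq_of_notMem huD]
      exact single_mem_range_superpos ((Finset.erase_subset _ _).trans hA) _
    · rw [← Finset.union_insert]
      exact single_mem_range_superpos (Finset.insert_subset (hus u (by simp)) hA) _

/-- The amplitude of the all-zero search word is `f ∅`, because `D` holds no search qubit. -/
theorem superpos_apply_self {D U : Finset ℕ} (hD : Disjoint D U) (f : Finset ℕ → ℂ) :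
    superpos D U f D = f ∅ := by
  classical
  rw [superpos_apply, Finsupp.finsetSum_apply, Finset.sum_eq_single ∅]
  · simp
  · intro A hA hne
    rw [Finsupp.single_apply, if_neg]
    intro h
    apply hne
    rw [Finset.mem_powerset] at hA
    rw [Finset.union_eq_left] at h
    exact Finset.subset_empty.1 (fun a ha => (Finset.disjoint_left.1 hD (h ha) (hA ha)).elim)
  · intro h
    exact absurd (Finset.empty_mem_powerset U) h

theorem circuitMap_phaseOracle_superpos (gs : List (ℕ × ℕ × ℕ)) (f : ℕ) (D U : Finset ℕ)
    (g : Finset ℕ → ℂ) :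
    circuitMap (phaseOracle gs f) (superpos D U g) =
      superpos D U fun A => if f ∈ toffoliRun gs (D ∪ A) then -g A else g A := by
  rw [superpos_apply, map_sum, superpos_apply]
  exact Finset.sum_congr rfl fun A _ => circuitMap_phaseOracle _ _ _ _

/-- One Grover iteration: the phase oracle of `V` followed by the reflection about the uniform
superposition. `nz` is the wire of `V₀` that tells whether some search bit is set. -/
def groverIteration (V : List (ℕ × ℕ × ℕ)) (f : ℕ) (V₀ : List (ℕ × ℕ × ℕ)) (nz : ℕ)
    (us : List ℕ) : List Gate :=
  phaseOracle V f ++ (hadamards us ++ (phaseOracle V₀ nz ++ hadamards us.reverse))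

/-- On superpositions of search words, an iteration flips the signs of the amplitudes of the
accepted words and then reflects all amplitudes at their mean. -/
theorem circuitMap_groverIteration (V : List (ℕ × ℕ × ℕ)) (f : ℕ) (V₀ : List (ℕ × ℕ × ℕ)) (nz : ℕ)
    (us : List ℕ) (hus : us.Nodup) (D : Finset ℕ) (hD : ∀ u ∈ us, u ∉ D)
    (hnz : ∀ A ⊆ us.toFinset, nz ∈ toffoliRun V₀ (D ∪ A) ↔ A ≠ ∅) (g : Finset ℕ → ℂ) :
    circuitMap (groverIteration V f V₀ nz us) (superpos D us.toFinset g) =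
      superpos D us.toFinset fun A =>
        -(if f ∈ toffoliRun V (D ∪ A) then -g A else g A) +
          2 * (1 / 2 : ℂ) ^ us.length * ∑ A' ∈ us.toFinset.powerset,
            if f ∈ toffoliRun V (D ∪ A') then -g A' else g A' := by
  classical
  set U := us.toFinset with hU
  have hDU : Disjoint D U := by
    rw [Finset.disjoint_right]
    intro u hu
    exact hD u (by simpa [hU] using hu)
  set g' : Finset ℕ → ℂ := fun A => if f ∈ toffoliRun V (D ∪ A) then -g A else g A with hg'
  set r : ℂ := ((1 / Real.sqrt 2 : ℝ) : ℂ) with hr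
  rw [groverIteration, circuitMap_append, circuitMap_append, circuitMap_append,
    circuitMap_phaseOracle_superpos]
  obtain ⟨h, hh⟩ := circuitMap_hadamards_mem_range us (U := U) (D := D) (by simp [hU]) hD
    (LinearMap.mem_range_self (superpos D U) g')
  have h0 : h ∅ = r ^ us.length * ∑ A ∈ U.powerset, g' A := by
    rw [← superpos_apply_self hDU h, hh, superpos_apply, map_sum, Finsupp.finsetSum_apply,
      Finset.mul_sum]
    refine Finset.sum_congr rfl fun A hA => ?_
    rw [circuitMap_hadamards_single_apply us hus hD]
    rw [Finset.union_sdiff_distrib, Finset.sdiff_eq_empty_iff_subset.2 (Finset.mem_powerset.1 hA),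
      Finset.union_empty, Finset.sdiff_eq_self_of_disjoint hDU]
  rw [← hh, circuitMap_phaseOracle_superpos]
  have e1 : (superpos D U fun A => if nz ∈ toffoliRun V₀ (D ∪ A) then -h A else h A) =
      -superpos D U h + Finsupp.single D (2 * h ∅) := by
    rw [superpos_congr (g := -h + Pi.single ∅ (2 * h ∅))]
    · rw [map_add, map_neg]
      congr 1
      rw [superpos_apply, Finset.sum_eq_single ∅]
      · simp
      · intro B _ hB
        simp [hB]
      · intro h
        exact absurd (Finset.empty_mem_powerset U) h
    · intro A hA
      by_cases hA0 : A = ∅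
      · subst hA0
        have := (hnz ∅ hA).not.2 (by simp)
        simp only [this, if_false, Pi.add_apply, Pi.neg_apply, Pi.single_eq_same]
        ring
      · simp [(hnz A hA).2 hA0, hA0]
  rw [e1, map_add, map_neg, hh, circuitMap_hadamards_reverse,
    circuitMap_hadamards_single us.reverse (List.nodup_reverse.2 hus) D (by simpa using hD), h0]
  have e2 : (us.reverse).toFinset = U := by simp [hU]
  rw [e2, List.length_reverse, ← hr]
  have e3 : (∑ A ∈ U.powerset, Finsupp.single (D ∪ A)
      (r ^ us.length * (2 * (r ^ us.length * ∑ A ∈ U.powerset, g' A))) : QState) =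
      superpos D U fun _ => 2 * (1 / 2 : ℂ) ^ us.length * ∑ A' ∈ U.powerset, g' A' := by
    rw [superpos_apply]
    refine Finset.sum_congr rfl fun A _ => ?_
    congr 1
    rw [← inv_sqrt_two_mul_self, ← hr, mul_pow]
    ring
  rw [e3, ← map_neg, ← map_add]
  rfl

/-- The amplitudes of the accepted and of the rejected words after `K` Grover iterations, in units
of the initial amplitude, when `s² = sin² θ` is the fraction of accepted words. -/
def groverAmps (s2 : ℝ) : ℕ → ℝ × ℝ
  | 0 => (1, 1)
  | K + 1 =>
    let a := groverAmps s2 K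
    (a.1 + 2 * (-a.1 * s2 + a.2 * (1 - s2)), -a.2 + 2 * (-a.1 * s2 + a.2 * (1 - s2)))

/-- In the plane spanned by the accepted and the rejected words, an iteration is the rotation by
`2θ`. -/
theorem groverAmps_sin (θ : ℝ) (K : ℕ) :
    (groverAmps (Real.sin θ ^ 2) K).1 * Real.sin θ = Real.sin ((2 * K + 1) * θ) ∧
    (groverAmps (Real.sin θ ^ 2) K).2 * Real.cos θ = Real.cos ((2 * K + 1) * θ) := by
  have hcs := Real.sin_sq_add_cos_sq θ
  have hc : Real.cos θ ^ 2 = 1 - Real.sin θ ^ 2 := by linarith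
  induction K with
  | zero => simp [groverAmps]
  | succ K ih =>
    obtain ⟨h1, h2⟩ := ih
    have e : (2 * ((K + 1 : ℕ) : ℝ) + 1) * θ = (2 * K + 1) * θ + 2 * θ := by push_cast; ring
    rw [e, Real.sin_add, Real.cos_add, ← h1, ← h2, Real.sin_two_mul, Real.cos_two_mul]
    simp only [groverAmps]
    generalize (groverAmps (Real.sin θ ^ 2) K).1 = a
    generalize (groverAmps (Real.sin θ ^ 2) K).2 = b
    constructor
    · linear_combination (-2 * b * Real.sin θ - 2 * a * Real.sin θ) * hc
    · linear_combination (-2 * b * Real.cos θ) * hc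

theorem circuitMap_flatMap_const (K : ℕ) (gs : List Gate) (ψ : QState) :
    circuitMap ((List.range (K + 1)).flatMap fun _ => gs) ψ =
      circuitMap gs (circuitMap ((List.range K).flatMap fun _ => gs) ψ) := by
  rw [List.range_succ, List.flatMap_append, circuitMap_append]
  simp

/-- Amplitude amplification with `K` iterations, followed by the computation `V`. -/
def groverCircuit (V : List (ℕ × ℕ × ℕ)) (f : ℕ) (V₀ : List (ℕ × ℕ × ℕ)) (nz : ℕ)
    (us : List ℕ) (one : ℕ) (K : ℕ) : List Gate :=
  Gate.X one :: (hadamards us.reverse ++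
    (((List.range K).flatMap fun _ => groverIteration V f V₀ nz us) ++ toffolis V))

/-- The state before the measurement: all accepted words have one common amplitude, and so have all
rejected words. -/
theorem circuitMap_groverCircuit (V : List (ℕ × ℕ × ℕ)) (f : ℕ) (V₀ : List (ℕ × ℕ × ℕ)) (nz : ℕ)
    (us : List ℕ) (hus : us.Nodup) (one : ℕ) (D₀ D : Finset ℕ) (hD₀ : flipQubit one D₀ = D)
    (hD : ∀ u ∈ us, u ∉ D)
    (hnz : ∀ A ⊆ us.toFinset, nz ∈ toffoliRun V₀ (D ∪ A) ↔ A ≠ ∅) (s2 : ℝ)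
    (hs2 : s2 = ((us.toFinset.powerset.filter fun A => f ∈ toffoliRun V (D ∪ A)).card : ℝ) /
      2 ^ us.length) (K : ℕ) :
    circuitMap (groverCircuit V f V₀ nz us one K) (Finsupp.single D₀ 1) =
      ∑ A ∈ us.toFinset.powerset, Finsupp.single (toffoliRun V (D ∪ A))
        ((((1 / Real.sqrt 2) ^ us.length * if f ∈ toffoliRun V (D ∪ A) then (groverAmps s2 K).1
          else (groverAmps s2 K).2 : ℝ) : ℂ)) := by
  classical
  have key : ∀ K, circuitMap ((List.range K).flatMap fun _ => groverIteration V f V₀ nz us)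
      (superpos D us.toFinset fun _ => ((1 / Real.sqrt 2 : ℝ) : ℂ) ^ us.length) =
      superpos D us.toFinset fun A => (((1 / Real.sqrt 2) ^ us.length *
        if f ∈ toffoliRun V (D ∪ A) then (groverAmps s2 K).1 else (groverAmps s2 K).2 : ℝ) : ℂ) := by
    intro K
    induction K with
    | zero => simp [circuitMap, groverAmps]
    | succ K ih =>
      rw [circuitMap_flatMap_const, ih, circuitMap_groverIteration _ _ _ _ _ hus _ hD hnz]
      refine superpos_congr fun A _ => ?_
      generalize hR : (1 / Real.sqrt 2) ^ us.length = R
      have hcard : us.toFinset.powerset.card = 2 ^ us.length := by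
        rw [Finset.card_powerset, List.toFinset_card_of_nodup hus]
      have hsplit := Finset.card_filter_add_card_filter_not (s := us.toFinset.powerset)
        (fun A => f ∈ toffoliRun V (D ∪ A))
      set M := (us.toFinset.powerset.filter fun A => f ∈ toffoliRun V (D ∪ A)).card with hM
      have hnot : ((us.toFinset.powerset.filter fun A => ¬ f ∈ toffoliRun V (D ∪ A)).card : ℝ) =
          2 ^ us.length - M := by
        rw [hcard] at hsplit
        have : ((M + (us.toFinset.powerset.filter fun A => ¬ f ∈ toffoliRun V (D ∪ A)).card : ℕ) :
          ℝ) = ((2 ^ us.length : ℕ) : ℝ) := by rw [hsplit]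
        push_cast at this
        linarith
      have hpow : (2 : ℝ) ^ us.length ≠ 0 := by positivity
      have hM' : (M : ℝ) = s2 * 2 ^ us.length := by rw [hs2]; field_simp
      have hhalf : (1 / 2 : ℝ) ^ us.length * 2 ^ us.length = 1 := by
        rw [← mul_pow]; norm_num
      have hsum : (∑ A' ∈ us.toFinset.powerset,
          if f ∈ toffoliRun V (D ∪ A') then -(R * if f ∈ toffoliRun V (D ∪ A') then
            (groverAmps s2 K).1 else (groverAmps s2 K).2)
          else (R * if f ∈ toffoliRun V (D ∪ A') then
            (groverAmps s2 K).1 else (groverAmps s2 K).2)) =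
          2 ^ us.length * (R * (-(groverAmps s2 K).1 * s2 + (groverAmps s2 K).2 * (1 - s2))) := by
        rw [Finset.sum_ite]
        have s1 : ∀ A ∈ us.toFinset.powerset.filter (fun A => f ∈ toffoliRun V (D ∪ A)),
            -(R * if f ∈ toffoliRun V (D ∪ A) then (groverAmps s2 K).1 else (groverAmps s2 K).2) =
              -(R * (groverAmps s2 K).1) := fun A hA => by rw [if_pos (Finset.mem_filter.1 hA).2]
        have s2 : ∀ A ∈ us.toFinset.powerset.filter (fun A => ¬ f ∈ toffoliRun V (D ∪ A)),
            (R * if f ∈ toffoliRun V (D ∪ A) then (groverAmps s2 K).1 else (groverAmps s2 K).2) =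
              R * (groverAmps s2 K).2 := fun A hA => by rw [if_neg (Finset.mem_filter.1 hA).2]
        rw [Finset.sum_congr rfl s1, Finset.sum_congr rfl s2]
        rw [Finset.sum_const, Finset.sum_const, nsmul_eq_mul, nsmul_eq_mul, hnot, ← hM, hM']
        ring
      have hsumC : (∑ A' ∈ us.toFinset.powerset,
          if f ∈ toffoliRun V (D ∪ A') then -((R * if f ∈ toffoliRun V (D ∪ A') then
            (groverAmps s2 K).1 else (groverAmps s2 K).2 : ℝ) : ℂ)
          else ((R * if f ∈ toffoliRun V (D ∪ A') then
            (groverAmps s2 K).1 else (groverAmps s2 K).2 : ℝ) : ℂ)) =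
          ((2 ^ us.length * (R * (-(groverAmps s2 K).1 * s2 + (groverAmps s2 K).2 * (1 - s2))) :
            ℝ) : ℂ) := by
        rw [← hsum, Complex.ofReal_sum]
        refine Finset.sum_congr rfl fun A' _ => ?_
        split_ifs <;> simp
      rw [hsumC]
      have e : (2 * (1 / 2 : ℂ) ^ us.length) = ((2 * (1 / 2 : ℝ) ^ us.length : ℝ) : ℂ) := by
        push_cast; rfl
      rw [e, ← Complex.ofReal_mul]
      have e2 : (2 * (1 / 2 : ℝ) ^ us.length) * (2 ^ us.length *
          (R * (-(groverAmps s2 K).1 * s2 + (groverAmps s2 K).2 * (1 - s2)))) =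
          R * (2 * (-(groverAmps s2 K).1 * s2 + (groverAmps s2 K).2 * (1 - s2))) := by
        linear_combination (2 * R * (-(groverAmps s2 K).1 * s2 + (groverAmps s2 K).2 * (1 - s2)))
          * hhalf
      rw [e2]
      by_cases h : f ∈ toffoliRun V (D ∪ A)
      · simp only [h, if_true, groverAmps]
        push_cast
        ring
      · simp only [h, if_false, groverAmps]
        push_cast
        ring
  change circuitMap (hadamards us.reverse ++ _) ((Gate.X one).apply (Finsupp.single D₀ 1)) = _
  rw [Gate.apply_single]
  have e : (1 : ℂ) • (Gate.X one).onBasis D₀ = Finsupp.single D 1 := by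
    simp [Gate.onBasis, hD₀]
  have e1 : circuitMap (hadamards us.reverse) (Finsupp.single D 1) =
      superpos D us.toFinset fun _ => ((1 / Real.sqrt 2 : ℝ) : ℂ) ^ us.length := by
    rw [circuitMap_hadamards_single us.reverse (List.nodup_reverse.2 hus) D (by simpa using hD)]
    rw [superpos_apply]
    simp
  rw [e, circuitMap_append, circuitMap_append, e1, key, superpos_apply, map_sum]
  exact Finset.sum_congr rfl fun A _ => circuitMap_toffolis _ _ _

theorem sum_norm_sq_support {ι : Type*} [DecidableEq ι] (P : Finset ι) (φ : ι → Finset ℕ)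
    (hφ : Set.InjOn φ P) (g : ι → ℂ) (p : Finset ℕ → Prop) [DecidablePred p] :
    (∑ S ∈ (∑ A ∈ P, Finsupp.single (φ A) (g A) : QState).support with p S,
      ‖(∑ A ∈ P, Finsupp.single (φ A) (g A) : QState) S‖ ^ 2) =
      ∑ A ∈ P with p (φ A), ‖g A‖ ^ 2 := by
  set ψ : QState := ∑ A ∈ P, Finsupp.single (φ A) (g A) with hψ
  have hval : ∀ A ∈ P, ψ (φ A) = g A := by
    intro A hA
    rw [hψ, Finsupp.finsetSum_apply, Finset.sum_eq_single A]
    · simp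
    · intro B hB hne
      rw [Finsupp.single_apply, if_neg]
      exact fun h => hne (hφ hB hA h)
    · intro h
      exact absurd hA h
  have hsupp : ψ.support ⊆ P.image φ := by
    intro S hS
    by_contra hcon
    rw [Finsupp.mem_support_iff] at hS
    apply hS
    rw [hψ, Finsupp.finsetSum_apply]
    refine Finset.sum_eq_zero fun A hA => ?_
    rw [Finsupp.single_apply, if_neg]
    rintro rfl
    exact hcon (Finset.mem_image_of_mem _ hA)
  rw [Finset.sum_filter, Finset.sum_filter, Finset.sum_subset hsupp, Finset.sum_image hφ]
  · exact Finset.sum_congr rfl fun A hA => by rw [hval A hA]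
  · intro S _ hS
    rw [Finsupp.notMem_support_iff] at hS
    simp [hS]

/-- In a round of amplitude amplification every word accepted by `V` has the same probability, and
the total probability of acceptance after `K` iterations is `sin² ((2K+1)θ)`. -/
theorem acceptProb_groverCircuit (V : List (ℕ × ℕ × ℕ)) (V₀ : List (ℕ × ℕ × ℕ)) (nz : ℕ)
    (us : List ℕ) (hus : us.Nodup) (one : ℕ) (input : List Bool) (D : Finset ℕ)
    (hD₀ : flipQubit one
      ((Finset.range input.length).filter fun i => input.getD i false = true) = D)
    (hD : ∀ u ∈ us, u ∉ D)
    (hnz : ∀ A ⊆ us.toFinset, nz ∈ toffoliRun V₀ (D ∪ A) ↔ A ≠ ∅) (θ : ℝ)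
    (hθ : Real.sin θ ^ 2 = ((us.toFinset.powerset.filter fun A =>
      input.length ∈ toffoliRun V (D ∪ A)).card : ℝ) / 2 ^ us.length)
    (hθ0 : Real.sin θ ≠ 0) (K m : ℕ) (y : Fin m → Bool) :
    acceptProb (groverCircuit V input.length V₀ nz us one K) input m y =
      Real.sin ((2 * K + 1) * θ) ^ 2 * (((us.toFinset.powerset.filter fun A =>
        input.length ∈ toffoliRun V (D ∪ A) ∧ ∀ j : Fin m,
          (input.length + 1 + (j : ℕ) ∈ toffoliRun V (D ∪ A) ↔ y j = true)).card : ℝ) /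
        2 ^ us.length / Real.sin θ ^ 2) := by
  classical
  have hinj : Set.InjOn (fun A => toffoliRun V (D ∪ A))
      (us.toFinset.powerset : Set (Finset ℕ)) := by
    intro A hA B hB hAB
    have h := toffoliRun_injective V hAB
    simp only [Finset.coe_powerset, Set.mem_preimage, Set.mem_powerset_iff, Finset.coe_subset]
      at hA hB
    have hd : ∀ A ⊆ us.toFinset, (D ∪ A) \ D = A := by
      intro A hA
      rw [Finset.union_sdiff_left, Finset.sdiff_eq_self_iff_disjoint, Finset.disjoint_left]
      intro a ha hd
      exact hD a (by simpa using hA ha) hd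
    rw [← hd A hA, ← hd B hB, h]
  unfold acceptProb
  simp only [runCircuit_eq_circuitMap, loadInput]
  rw [circuitMap_groverCircuit V input.length V₀ nz us hus one _ D hD₀ hD hnz _ hθ K]
  have := sum_norm_sq_support us.toFinset.powerset (fun A => toffoliRun V (D ∪ A)) hinj
    (fun A => (((1 / Real.sqrt 2) ^ us.length * if input.length ∈ toffoliRun V (D ∪ A) then
      (groverAmps (Real.sin θ ^ 2) K).1 else (groverAmps (Real.sin θ ^ 2) K).2 : ℝ) : ℂ))
    (fun S => input.length ∈ S ∧ ∀ j : Fin m, (input.length + 1 + (j : ℕ) ∈ S ↔ y j = true))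
  refine Eq.trans ?_ (this.trans ?_)
  · congr!
  rw [Finset.sum_congr rfl (g := fun _ => Real.sin ((2 * K + 1) * θ) ^ 2 *
    (1 / 2 ^ us.length / Real.sin θ ^ 2))]
  · rw [Finset.sum_const, nsmul_eq_mul]
    have e : ∀ (s : Finset (Finset ℕ)) (x y z : ℝ), (s.card : ℝ) * (x * (1 / y / z)) =
      x * (s.card / y / z) := by intros; ring
    rw [e]
  · intro A hA
    have h := (Finset.mem_filter.1 hA).2.1
    rw [if_pos h, Complex.norm_real, Real.norm_eq_abs, sq_abs, mul_pow, ← (groverAmps_sin θ K).1,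
      ← pow_mul, mul_comm us.length 2, pow_mul]
    have : (1 / Real.sqrt 2) ^ 2 = 1 / 2 := by
      rw [div_pow, Real.sq_sqrt (by norm_num)]; norm_num
    have hhalf : (1 / 2 : ℝ) ^ us.length * 2 ^ us.length = 1 := by
      rw [← mul_pow]; norm_num
    rw [this, mul_pow]
    field_simp
    linear_combination (groverAmps (Real.sin θ ^ 2) K).1 ^ 2 * hhalf

/-! ### Straight-line programs -/

/-- The value of a wire. -/
def wire (S : Finset ℕ) (w : ℕ) : Bool := decide (w ∈ S)

theorem mem_iff_wire {S : Finset ℕ} {w : ℕ} : w ∈ S ↔ wire S w = true := by simp [wire]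

/-- The sum modulo 2 of the products of the given pairs of wires. -/
def parity (S : Finset ℕ) : List (ℕ × ℕ) → Bool
  | [] => false
  | w :: ws => ((wire S w.1 && wire S w.2) ^^ parity S ws)

theorem parity_nil (S : Finset ℕ) : parity S [] = false := rfl

theorem parity_cons (S : Finset ℕ) (w : ℕ × ℕ) (ws : List (ℕ × ℕ)) :
    parity S (w :: ws) = ((wire S w.1 && wire S w.2) ^^ parity S ws) := rfl

theorem parity_congr {S S' : Finset ℕ} {ws : List (ℕ × ℕ)}
    (h : ∀ w ∈ ws, wire S w.1 = wire S' w.1 ∧ wire S w.2 = wire S' w.2) :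
    parity S ws = parity S' ws := by
  induction ws with
  | nil => rfl
  | cons w ws ih =>
    rw [parity_cons, parity_cons, (h w (by simp)).1, (h w (by simp)).2,
      ih fun v hv => h v (by simp [hv])]

/-- The gates that add the parity of `ws` to the wire `t`. -/
def addParity (t : ℕ) (ws : List (ℕ × ℕ)) : List (ℕ × ℕ × ℕ) := ws.map fun w => (w.1, w.2, t)

/-- The straight-line program that assigns to the fresh wire `base + i`, for `i < T`, the parity of
the products listed in `body i`. -/
def cells (base T : ℕ) (body : ℕ → List (ℕ × ℕ)) : List (ℕ × ℕ × ℕ) :=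
  (List.range T).flatMap fun i => addParity (base + i) (body i)

theorem wire_toffoliStep (S : Finset ℕ) {c d t : ℕ} (hc : c ≠ t) (hd : d ≠ t) (w : ℕ) :
    wire (toffoliStep S (c, d, t)) w =
      if w = t then ((wire S c && wire S d) ^^ wire S t) else wire S w := by
  unfold toffoliStep wire
  by_cases h1 : c ∈ S <;> by_cases h2 : d ∈ S <;> by_cases h : w = t <;>
    simp [h1, h2, hc, hd, h, mem_flipQubit]

theorem wire_toffoliRun_addParity (t : ℕ) (ws : List (ℕ × ℕ)) (hws : ∀ w ∈ ws, w.1 ≠ t ∧ w.2 ≠ t)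
    (S : Finset ℕ) (w : ℕ) :
    wire (toffoliRun (addParity t ws) S) w =
      if w = t then (parity S ws ^^ wire S t) else wire S w := by
  induction ws generalizing S with
  | nil =>
    change wire S w = _
    split_ifs with h
    · simp [h, parity]
    · rfl
  | cons v ws ih =>
    have hv := hws v (by simp)
    change wire (toffoliRun (addParity t ws) (toffoliStep S (v.1, v.2, t))) w = _
    rw [ih (fun x hx => hws x (by simp [hx]))]
    have hp : parity (toffoliStep S (v.1, v.2, t)) ws = parity S ws := by
      refine parity_congr fun x hx => ?_
      have := hws x (by simp [hx])
      rw [wire_toffoliStep S hv.1 hv.2, wire_toffoliStep S hv.1 hv.2, if_neg this.1, if_neg this.2]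
      exact ⟨rfl, rfl⟩
    rw [hp, wire_toffoliStep S hv.1 hv.2, wire_toffoliStep S hv.1 hv.2, parity_cons]
    by_cases h : w = t
    · simp only [h, if_true]
      rw [← Bool.xor_assoc]
      congr 1
      exact Bool.xor_comm _ _
    · simp only [h, if_false]

/-- The wires from `base` on are clear. -/
def ClearFrom (S : Finset ℕ) (base : ℕ) : Prop := ∀ w, base ≤ w → wire S w = false

/-- Running a straight-line program: the wires below `base` are unchanged, and every cell satisfies
its defining equation in the final state. -/
theorem toffoliRun_cells {base T : ℕ} {body : ℕ → List (ℕ × ℕ)} {S : Finset ℕ}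
    (hS : ClearFrom S base)
    (hb : ∀ i < T, ∀ w ∈ body i, w.1 < base + i ∧ w.2 < base + i) :
    (∀ w < base, wire (toffoliRun (cells base T body) S) w = wire S w) ∧
    ClearFrom (toffoliRun (cells base T body) S) (base + T) ∧
    ∀ i < T, wire (toffoliRun (cells base T body) S) (base + i) =
      parity (toffoliRun (cells base T body) S) (body i) := by
  induction T with
  | zero => exact ⟨fun _ _ => rfl, hS, fun i hi => absurd hi (by omega)⟩
  | succ T ih =>
    obtain ⟨h1, h2, h3⟩ := ih fun i hi => hb i (by omega)
    have e : toffoliRun (cells base (T + 1) body) S =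
        toffoliRun (addParity (base + T) (body T)) (toffoliRun (cells base T body) S) := by
      rw [cells, List.range_succ, List.flatMap_append, toffoliRun_append]
      simp [cells]
    set S' := toffoliRun (cells base T body) S
    have hw := wire_toffoliRun_addParity (base + T) (body T)
      (fun w hw => by have := hb T (by omega) w hw; omega) S'
    rw [← e] at hw
    refine ⟨fun w hlt => ?_, fun w hle => ?_, fun i hi => ?_⟩
    · rw [hw, if_neg (by omega), h1 w hlt]
    · rw [hw, if_neg (by omega), h2 w (by omega)]
    · have hp : parity (toffoliRun (cells base (T + 1) body) S) (body i) = parity S' (body i) := by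
        refine parity_congr fun w hwi => ?_
        have := hb i hi w hwi
        rw [hw, hw, if_neg (by omega), if_neg (by omega)]
        exact ⟨rfl, rfl⟩
      rw [hp, hw]
      split_ifs with h
      · have : i = T := by omega
        subst this
        rw [h2 _ le_rfl, Bool.xor_false]
      · exact h3 i (by omega)

/-- Copies of the wires `src i` to the wires `dst + i`, `i < n`. -/
def copies (dst n : ℕ) (src : ℕ → ℕ) : List (ℕ × ℕ × ℕ) :=
  (List.range n).flatMap fun i => addParity (dst + i) [(src i, src i)]

theorem wire_toffoliRun_copies {dst n : ℕ} {src : ℕ → ℕ} {S : Finset ℕ}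
    (hsrc : ∀ i < n, dst + n ≤ src i) (hS : ∀ i < n, wire S (dst + i) = false) : ∀ w,
    wire (toffoliRun (copies dst n src) S) w =
      if dst ≤ w ∧ w < dst + n then wire S (src (w - dst)) else wire S w := by
  induction n with
  | zero =>
    intro w
    rw [if_neg (by omega)]
    rfl
  | succ n ih =>
    have e : toffoliRun (copies dst (n + 1) src) S =
        toffoliRun (addParity (dst + n) [(src n, src n)]) (toffoliRun (copies dst n src) S) := by
      rw [copies, List.range_succ, List.flatMap_append, toffoliRun_append]
      simp [copies]
    have ih' := fun w => ih (fun i hi => by have := hsrc i (by omega); omega)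
      (fun i hi => hS i (by omega)) w
    intro w
    have hn := hsrc n (by omega)
    have hw := wire_toffoliRun_addParity (dst + n) [(src n, src n)]
      (fun w hw => by simp at hw; subst hw; simp; omega) (toffoliRun (copies dst n src) S) w
    rw [e, hw, parity_cons, parity_nil, ih', ih', ih']
    clear hw e
    by_cases h : w = dst + n
    · subst h
      simp [hS n (by omega), show ¬ (dst ≤ src n ∧ src n < dst + n) by omega]
    · rw [if_neg h]
      simp only [show (dst ≤ w ∧ w < dst + (n + 1)) ↔ (dst ≤ w ∧ w < dst + n) by omega]

/-! ### The test whether some search bit is set -/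

/-- The cells of the disjunction of the `n` wires from `ubase` on. -/
def anyBody (wz ubase base i : ℕ) : List (ℕ × ℕ) :=
  let prev := if i = 0 then wz else base + i - 1
  [(ubase + i, ubase + i), (prev, prev), (ubase + i, prev)]

theorem wire_any {wz ubase base n : ℕ} {S : Finset ℕ} (hS : ClearFrom S base)
    (hz : wz < base) (hz0 : wire S wz = false) (hu : ubase + n ≤ base) (hn : 0 < n) :
    wire (toffoliRun (cells base n (anyBody wz ubase base)) S) (base + (n - 1)) =
      decide (∃ i < n, wire S (ubase + i) = true) := by
  obtain ⟨h1, -, h3⟩ := toffoliRun_cells (T := n) (body := anyBody wz ubase base) hS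
    (fun i hi w hw => by
      simp only [anyBody, List.mem_cons, List.not_mem_nil, or_false] at hw
      split_ifs at hw <;> rcases hw with rfl | rfl | rfl <;> constructor <;> simp only <;> omega)
  set S' := toffoliRun (cells base n (anyBody wz ubase base)) S
  have key : ∀ k < n, wire S' (base + k) = decide (∃ i < k + 1, wire S (ubase + i) = true) := by
    intro k
    induction k with
    | zero =>
      intro h
      rw [h3 0 h]
      simp only [anyBody, if_true, parity_cons, parity_nil, h1 _ hz, hz0,
        h1 (ubase + 0) (by omega)]
      simp
    | succ k ih =>
      intro h
      rw [h3 _ h]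
      simp only [anyBody, Nat.succ_ne_zero, if_false, parity_cons, parity_nil,
        h1 (ubase + (k + 1)) (by omega), show base + (k + 1) - 1 = base + k by omega,
        ih (by omega), Nat.lt_succ_iff_lt_or_eq (n := k + 1), or_and_right, exists_or,
        exists_eq_left]
      by_cases h' : ∃ i < k + 1, wire S (ubase + i) = true <;>
        cases wire S (ubase + (k + 1)) <;> simp
  rw [key _ (by omega), show n - 1 + 1 = n by omega]

/-! ### Bernoulli variables with exponentially small parameters -/

theorem mul_add_div_mod (r d k : ℕ) (h : k < d) : (r * d + k) / d = r ∧ (r * d + k) % d = k := by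
  constructor
  · rw [mul_comm, Nat.mul_add_div (by omega), Nat.div_eq_of_lt h, Nat.add_zero]
  · rw [mul_comm, Nat.mul_add_mod, Nat.mod_eq_of_lt h]

/-- The comparison `u < c` of the `k` low bits, by the recursion on the most significant bit. -/
def ltBit (c : ℕ) (u : ℕ → Bool) : ℕ → Bool
  | 0 => false
  | k + 1 => if c.testBit k then (!u k) ^^ (u k && ltBit c u k)
      else ltBit c u k ^^ (u k && ltBit c u k)

theorem ltBit_eq (c : ℕ) (u : ℕ → Bool) (k : ℕ) :
    ltBit c u k = decide (∑ i ∈ Finset.range k, (u i).toNat * 2 ^ i < c % 2 ^ k) := by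
  induction k with
  | zero => simp [ltBit, Nat.mod_one]
  | succ k ih =>
    have hb : ∑ i ∈ Finset.range k, (u i).toNat * 2 ^ i < 2 ^ k := by
      clear ih
      induction k with
      | zero => simp
      | succ k ih =>
        rw [Finset.sum_range_succ, pow_succ]
        have : (u k).toNat * 2 ^ k ≤ 1 * 2 ^ k := Nat.mul_le_mul_right _ (Bool.toNat_le _)
        omega
    have hc : c % 2 ^ k < 2 ^ k := Nat.mod_lt _ (by positivity)
    rw [ltBit, ih, Finset.sum_range_succ, Nat.mod_pow_succ, ← Nat.toNat_testBit]
    generalize ∑ i ∈ Finset.range k, (u i).toNat * 2 ^ i = s at *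
    generalize c % 2 ^ k = d at *
    generalize 2 ^ k = t at *
    rcases Bool.eq_false_or_eq_true (c.testBit k) with h | h <;>
      rcases Bool.eq_false_or_eq_true (u k) with h' | h' <;>
      simp only [h, h', Bool.toNat_true, Bool.toNat_false, Bool.not_true, Bool.not_false,
        Bool.true_and, Bool.false_and, Bool.xor_false, Bool.false_xor, Bool.xor_self,
        if_true, if_false, Nat.one_mul, Nat.mul_one, Nat.mul_zero, Nat.zero_mul, Nat.add_zero,
        Bool.false_eq_true, true_eq_decide_iff, decide_eq_decide,
        false_eq_decide_iff] <;> omega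

/-- The cells of the conjunctions, over the rows `r` of a block of `B` rows, of "the wire
`abase + astride * r` is set or the random number in row `r` is less than `c (r % B)`". Every row
takes `R` cells for the comparison, one for the disjunction and one for the conjunction. -/
def samplerBody (wz one base abase astride ubase B R : ℕ) (c : ℕ → ℕ) (i : ℕ) : List (ℕ × ℕ) :=
  let r := i / (R + 2)
  let k := i % (R + 2)
  let prev := if k = 0 then wz else base + i - 1
  let u := ubase + (r * R + k)
  let a := abase + astride * r
  if k < R then
    if (c (r % B)).testBit k then [(one, one), (u, u), (u, prev)] else [(prev, prev), (u, prev)]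
  else if k = R then [(a, a), (prev, prev), (a, prev)]
  else [(if r % B = 0 then one else base + i - (R + 2), prev)]

/-- The sampler computes, at the end of each block `i` of `B` rows, the conjunction over the rows of
the block. -/
theorem wire_sampler {wz one base abase astride ubase B R : ℕ} {c : ℕ → ℕ} {S : Finset ℕ}
    (hS : ClearFrom S base) {n : ℕ} (hwz : wz < base) (hz0 : wire S wz = false)
    (hone : one < base) (hone1 : wire S one = true) (ha : ∀ r < n, abase + astride * r < base)
    (hu : ubase + n * R ≤ base) (hR : 0 < R) (hB : 0 < B) :
    (∀ w < base, wire (toffoliRun (cells base (n * (R + 2))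
      (samplerBody wz one base abase astride ubase B R c)) S) w = wire S w) ∧
    ClearFrom (toffoliRun (cells base (n * (R + 2))
      (samplerBody wz one base abase astride ubase B R c)) S) (base + n * (R + 2)) ∧
    ∀ i, (i + 1) * B ≤ n → wire (toffoliRun (cells base (n * (R + 2))
      (samplerBody wz one base abase astride ubase B R c)) S)
        (base + ((i * B + (B - 1)) * (R + 2) + (R + 1))) =
      decide (∀ j < B, wire S (abase + astride * (i * B + j)) = true ∨
        ltBit (c j) (fun k => wire S (ubase + ((i * B + j) * R + k))) R = true) := by
  have hu' : ∀ r < n, ∀ k < R, ubase + (r * R + k) < base := by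
    intro r hr k hk
    have : (r + 1) * R ≤ n * R := Nat.mul_le_mul_right _ hr
    have e : (r + 1) * R = r * R + R := by ring
    omega
  obtain ⟨h1, h2, h3⟩ := toffoliRun_cells (T := n * (R + 2))
    (body := samplerBody wz one base abase astride ubase B R c) hS
    (fun i hi w hw => by
      have hr : i / (R + 2) < n := Nat.div_lt_of_lt_mul (by rwa [mul_comm])
      have ha' := ha _ hr
      simp only [samplerBody] at hw
      split_ifs at hw with g1 g2 g3 g4 g5 g6 g7 <;>
        simp only [List.mem_cons, List.not_mem_nil, or_false] at hw <;>
        (try have hu'' := hu' _ hr _ (by assumption)) <;>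
        rcases hw with rfl | rfl | rfl <;> constructor <;> simp only <;> omega)
  refine ⟨h1, h2, ?_⟩
  set S' := toffoliRun (cells base (n * (R + 2))
    (samplerBody wz one base abase astride ubase B R c)) S
  have hlt : ∀ r < n, ∀ k < R + 2, r * (R + 2) + k < n * (R + 2) := by
    intro r hr k hk
    have : (r + 1) * (R + 2) ≤ n * (R + 2) := Nat.mul_le_mul_right _ hr
    have e : (r + 1) * (R + 2) = r * (R + 2) + (R + 2) := by ring
    omega
  have cmp : ∀ r < n, ∀ k < R, wire S' (base + (r * (R + 2) + k)) =
      ltBit (c (r % B)) (fun k => wire S (ubase + (r * R + k))) (k + 1) := by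
    intro r hr k
    induction k with
    | zero =>
      intro hk
      rw [h3 _ (hlt r hr 0 (by omega))]
      simp only [samplerBody, (mul_add_div_mod r (R + 2) 0 (by omega)).1,
        (mul_add_div_mod r (R + 2) 0 (by omega)).2, if_true, hk, ltBit]
      have h0 := h1 _ (hu' r hr 0 hk)
      rw [Nat.add_zero] at h0
      split_ifs with hc <;>
      simp [parity_cons, parity_nil, h1 _ hone, hone1, h1 _ hwz, hz0, h0]
    | succ k ih =>
      intro hk
      have ih := ih (by omega)
      rw [h3 _ (hlt r hr (k + 1) (by omega))]
      simp only [samplerBody, (mul_add_div_mod r (R + 2) (k + 1) (by omega)).1,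
        (mul_add_div_mod r (R + 2) (k + 1) (by omega)).2, if_true, hk]
      rw [ltBit]
      rw [if_neg (Nat.succ_ne_zero k), show base + (r * (R + 2) + (k + 1)) - 1 =
        base + (r * (R + 2) + k) by omega]
      split_ifs with hc <;>
        simp [parity_cons, parity_nil, h1 _ hone, hone1, ih, h1 _ (hu' r hr (k + 1) hk)]
  have orr : ∀ r < n, wire S' (base + (r * (R + 2) + R)) =
      (wire S (abase + astride * r) ||
        ltBit (c (r % B)) (fun k => wire S (ubase + (r * R + k))) R) := by
    intro r hr
    have hc := cmp r hr (R - 1) (by omega)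
    rw [h3 _ (hlt r hr R (by omega))]
    simp only [samplerBody, (mul_add_div_mod r (R + 2) R (by omega)).1,
        (mul_add_div_mod r (R + 2) R (by omega)).2, if_true, lt_irrefl, if_false,
        show R ≠ 0 by omega]
    rw [show base + (r * (R + 2) + R) - 1 = base + (r * (R + 2) + (R - 1)) by omega]
    simp only [parity_cons, parity_nil, hc, h1 _ (ha r hr), show R - 1 + 1 = R by omega]
    cases wire S (abase + astride * r) <;>
      cases ltBit (c (r % B)) (fun k => wire S (ubase + (r * R + k))) R <;> rfl
  have conj : ∀ i, ∀ j < B, i * B + j < n → wire S' (base + ((i * B + j) * (R + 2) + (R + 1))) =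
      decide (∀ j' < j + 1, wire S (abase + astride * (i * B + j')) = true ∨
        ltBit (c j') (fun k => wire S (ubase + ((i * B + j') * R + k))) R = true) := by
    intro i j
    induction j with
    | zero =>
      intro hj hn
      rw [h3 _ (hlt _ hn _ (by omega))]
      simp only [samplerBody, (mul_add_div_mod (i * B + 0) (R + 2) (R + 1) (by omega)).1,
        (mul_add_div_mod (i * B + 0) (R + 2) (R + 1) (by omega)).2,
        (mul_add_div_mod i B 0 hB).2, if_true, show ¬ R + 1 < R by omega, if_false,
        show R + 1 ≠ R by omega, Nat.succ_ne_zero]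
      rw [show base + ((i * B + 0) * (R + 2) + (R + 1)) - 1 =
        base + ((i * B + 0) * (R + 2) + R) by omega]
      simp only [parity_cons, parity_nil, orr _ hn, h1 _ hone, hone1,
        (mul_add_div_mod i B 0 hB).2]
      simp
    | succ j ih =>
      intro hj hn
      have ih := ih (by omega) (by omega)
      rw [h3 _ (hlt _ hn _ (by omega))]
      simp only [samplerBody, (mul_add_div_mod (i * B + (j + 1)) (R + 2) (R + 1) (by omega)).1,
        (mul_add_div_mod (i * B + (j + 1)) (R + 2) (R + 1) (by omega)).2,
        (mul_add_div_mod i B (j + 1) hj).2, show ¬ R + 1 < R by omega, if_false,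
        show R + 1 ≠ R by omega, Nat.succ_ne_zero]
      have e : (i * B + (j + 1)) * (R + 2) = (i * B + j) * (R + 2) + (R + 2) := by ring
      rw [show base + ((i * B + (j + 1)) * (R + 2) + (R + 1)) - 1 =
        base + ((i * B + (j + 1)) * (R + 2) + R) by omega,
        show base + ((i * B + (j + 1)) * (R + 2) + (R + 1)) - (R + 2) =
        base + ((i * B + j) * (R + 2) + (R + 1)) by omega]
      simp only [parity_cons, parity_nil, orr _ hn, ih,
        (mul_add_div_mod i B (j + 1) hj).2, Bool.xor_false]
      rw [Bool.eq_iff_iff]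
      simp only [Bool.and_eq_true, decide_eq_true_eq, Bool.or_eq_true]
      constructor
      · rintro ⟨p, q⟩ j' hj'
        rcases Nat.lt_succ_iff_lt_or_eq.1 hj' with h | rfl
        · exact p j' h
        · exact q
      · exact fun p => ⟨fun j' hj' => p j' (by omega), p _ (by omega)⟩
  intro i hi
  have e : (i + 1) * B = i * B + B := by ring
  rw [conj i (B - 1) (by omega) (by omega), show B - 1 + 1 = B by omega]

/-! ### Sums in two's complement -/

/-- The cells of the ripple-carry addition of the numbers `q < T`, of `B` bits each, whose bits are
the wires `q * B + j`. The number `q` is gated by the wire `gbase + q`, and from the number `nneg`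
on its bits are complemented. Every bit takes a cell for the gated bit, the sum and the carry. -/
def adderBody (wz gbase base B nneg : ℕ) (i : ℕ) : List (ℕ × ℕ) :=
  let r := i / 3
  let g := gbase + r / B
  let a := base + r * 3
  let s := if r < B then wz else base + ((r - B) * 3 + 1)
  let cin := if r % B = 0 then wz else base + ((r - 1) * 3 + 2)
  if i % 3 = 0 then (g, r) :: if nneg ≤ r / B then [(g, g)] else []
  else if i % 3 = 1 then [(a, a), (s, s), (cin, cin)]
  else [(a, s), (a, cin), (s, cin)]

/-- The number that the `q`-th row of the adder contributes. -/
def addend (B nneg : ℕ) (g : ℕ → Bool) (X : ℕ → BitVec B) (q : ℕ) : BitVec B :=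
  if g q then (if nneg ≤ q then ~~~X q else X q) else 0#B

/-- The sum of the first `t` addends. -/
def partialSum (B nneg : ℕ) (g : ℕ → Bool) (X : ℕ → BitVec B) : ℕ → BitVec B
  | 0 => 0#B
  | t + 1 => partialSum B nneg g X t + addend B nneg g X t

theorem partialSum_succ (B nneg : ℕ) (g : ℕ → Bool) (X : ℕ → BitVec B) (t : ℕ) :
    partialSum B nneg g X (t + 1) = partialSum B nneg g X t + addend B nneg g X t := rfl

theorem carry_zero_left {B : ℕ} (j : ℕ) (y : BitVec B) :
    BitVec.carry j 0#B y false = false := by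
  have : y.toNat % 2 ^ j < 2 ^ j := Nat.mod_lt _ (by positivity)
  simp [BitVec.carry, this]

/-- The ripple-carry adder computes the partial sums; its cell `(t, j)` for the sum holds the bit
`j` of the sum of the rows up to `t`. -/
theorem wire_adder {wz gbase base B nneg : ℕ} {S : Finset ℕ} (hS : ClearFrom S base) {T : ℕ}
    (hwz : wz < base) (hz0 : wire S wz = false) (hg : gbase + T ≤ base) (hx : T * B ≤ base)
    (hB : 0 < B) (X : ℕ → BitVec B)
    (hX : ∀ q < T, ∀ j < B, (X q).getLsbD j = wire S (q * B + j)) :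
    (∀ w < base, wire (toffoliRun (cells base (T * B * 3)
      (adderBody wz gbase base B nneg)) S) w = wire S w) ∧
    ClearFrom (toffoliRun (cells base (T * B * 3)
      (adderBody wz gbase base B nneg)) S) (base + T * B * 3) ∧
    ∀ t < T, ∀ j < B, wire (toffoliRun (cells base (T * B * 3)
      (adderBody wz gbase base B nneg)) S) (base + ((t * B + j) * 3 + 1)) =
        (partialSum B nneg (fun q => wire S (gbase + q)) X (t + 1)).getLsbD j := by
  obtain ⟨h1, h2, h3⟩ := toffoliRun_cells (T := T * B * 3)
    (body := adderBody wz gbase base B nneg) hS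
    (fun i hi w hw => by
      have hr : i / 3 < T * B := by omega
      have hq : i / 3 / B < T := Nat.div_lt_of_lt_mul (by rwa [mul_comm])
      have hi3 := Nat.div_add_mod i 3
      have hr0 : ¬ i / 3 % B = 0 → 1 ≤ i / 3 := by
        intro h
        rcases Nat.eq_zero_or_pos (i / 3) with h0 | h0
        · rw [h0] at h; simp at h
        · exact h0
      simp only [adderBody] at hw
      generalize i / 3 % B = rm at *
      generalize i / 3 / B = rq at *
      split_ifs at hw <;>
        simp only [List.mem_cons, List.not_mem_nil, or_false] at hw <;>
        rcases hw with rfl | rfl | rfl <;> constructor <;> simp only <;> omega)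
  refine ⟨h1, h2, ?_⟩
  set S' := toffoliRun (cells base (T * B * 3) (adderBody wz gbase base B nneg)) S
  set G : ℕ → Bool := fun q => wire S (gbase + q) with hG
  have hlt : ∀ t < T, ∀ j < B, t * B + j < T * B := by
    intro t ht j hj
    have : (t + 1) * B ≤ T * B := Nat.mul_le_mul_right _ ht
    have e : (t + 1) * B = t * B + B := by ring
    omega
  have ha : ∀ t < T, ∀ j < B, wire S' (base + (t * B + j) * 3) =
      (addend B nneg G X t).getLsbD j := by
    intro t ht j hj
    have hl := hlt t ht j hj
    have e1 : (t * B + j) * 3 / 3 = t * B + j := by omega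
    have e2 : (t * B + j) * 3 % 3 = 0 := by omega
    have hg' := h1 (gbase + t) (by omega)
    have hx' : wire S' (t * B + j) = (X t).getLsbD j := by
      rw [h1 _ (by omega), hX t ht j hj]
    rw [h3 _ (by omega)]
    simp only [adderBody, e1, e2, (mul_add_div_mod t B j hj).1, if_true]
    simp only [addend, hG]
    by_cases hn : nneg ≤ t
    · cases hgt : wire S (gbase + t) <;>
        simp [hn, parity_cons, parity_nil, hg', hx', hgt, hj]
    · cases hgt : wire S (gbase + t) <;>
        simp [hn, parity_cons, parity_nil, hg', hx', hgt]
  -- the sum and the carry, by induction on the row and then on the bit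
  have main : ∀ t < T, ∀ j < B,
      wire S' (base + ((t * B + j) * 3 + 1)) = (partialSum B nneg G X (t + 1)).getLsbD j ∧
      wire S' (base + ((t * B + j) * 3 + 2)) =
        BitVec.carry (j + 1) (partialSum B nneg G X t) (addend B nneg G X t) false := by
    intro t
    induction t with
    | zero =>
      intro ht j
      induction j with
      | zero =>
        intro hj
        have hl := hlt 0 ht 0 hj
        have ha' := ha 0 ht 0 hj
        rw [h3 _ (by omega), h3 _ (by omega)]
        simp only [adderBody, show ((0 * B + 0) * 3 + 1) / 3 = 0 by omega,
          show ((0 * B + 0) * 3 + 2) / 3 = 0 by omega, show ((0 * B + 0) * 3 + 1) % 3 = 1 by omega,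
          show ((0 * B + 0) * 3 + 2) % 3 = 2 by omega, Nat.zero_mod, if_true, hB]
        simp only [Nat.zero_mul, Nat.add_zero] at ha'
        simp [parity_cons, parity_nil, h1 _ hwz, hz0, ha', partialSum, BitVec.carry_succ]
      | succ j ih =>
        intro hj
        have ih := ih (by omega)
        have hl := hlt 0 ht (j + 1) hj
        have ha' := ha 0 ht (j + 1) hj
        rw [h3 _ (by omega), h3 _ (by omega)]
        simp only [adderBody, show ((0 * B + (j + 1)) * 3 + 1) / 3 = 0 * B + (j + 1) by omega,
          show ((0 * B + (j + 1)) * 3 + 2) / 3 = 0 * B + (j + 1) by omega,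
          show ((0 * B + (j + 1)) * 3 + 1) % 3 = 1 by omega,
          show ((0 * B + (j + 1)) * 3 + 2) % 3 = 2 by omega, (mul_add_div_mod 0 B _ hj).2]
        rw [if_pos (by omega : 0 * B + (j + 1) < B),
          show 0 * B + (j + 1) - 1 = 0 * B + j by omega]
        simp [parity_cons, parity_nil, h1 _ hwz, hz0, ha', ih.2, partialSum, BitVec.carry_succ (j + 1),
          carry_zero_left,
          -Nat.zero_mul, -zero_mul]
    | succ t iht =>
      intro ht j
      have iht := iht (by omega)
      induction j with
      | zero =>
        intro hj
        have hl := hlt (t + 1) ht 0 hj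
        have ha' := ha (t + 1) ht 0 hj
        have hs := (iht 0 hj).1
        have e : (t + 1) * B = t * B + B := by ring
        rw [h3 _ (by omega), h3 _ (by omega)]
        simp only [adderBody, show (((t + 1) * B + 0) * 3 + 1) / 3 = (t + 1) * B + 0 by omega,
          show (((t + 1) * B + 0) * 3 + 2) / 3 = (t + 1) * B + 0 by omega,
          show (((t + 1) * B + 0) * 3 + 1) % 3 = 1 by omega,
          show (((t + 1) * B + 0) * 3 + 2) % 3 = 2 by omega, (mul_add_div_mod (t + 1) B _ hj).2]
        rw [if_neg (by omega : ¬ (t + 1) * B + 0 < B),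
          show (t + 1) * B + 0 - B = t * B + 0 by omega]
        simp only [parity_cons, parity_nil, h1 _ hwz, hz0, ha', hs, if_true, Nat.one_ne_zero, if_false,
          show (2 : ℕ) ≠ 0 by omega, show (2 : ℕ) ≠ 1 by omega]
        rw [partialSum_succ (t := t + 1), BitVec.getLsbD_add hj, BitVec.carry_succ, BitVec.carry_zero]
        cases (addend B nneg G X (t + 1)).getLsbD 0 <;>
          cases (partialSum B nneg G X (t + 1)).getLsbD 0 <;> simp
      | succ j ih =>
        intro hj
        have ih := ih (by omega)
        have hl := hlt (t + 1) ht (j + 1) hj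
        have ha' := ha (t + 1) ht (j + 1) hj
        have hs := (iht (j + 1) hj).1
        have e : (t + 1) * B = t * B + B := by ring
        rw [h3 _ (by omega), h3 _ (by omega)]
        simp only [adderBody,
          show (((t + 1) * B + (j + 1)) * 3 + 1) / 3 = (t + 1) * B + (j + 1) by omega,
          show (((t + 1) * B + (j + 1)) * 3 + 2) / 3 = (t + 1) * B + (j + 1) by omega,
          show (((t + 1) * B + (j + 1)) * 3 + 1) % 3 = 1 by omega,
          show (((t + 1) * B + (j + 1)) * 3 + 2) % 3 = 2 by omega,
          (mul_add_div_mod (t + 1) B _ hj).2]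
        rw [if_neg (by omega : ¬ (t + 1) * B + (j + 1) < B),
          show (t + 1) * B + (j + 1) - B = t * B + (j + 1) by omega,
          show (t + 1) * B + (j + 1) - 1 = (t + 1) * B + j by omega]
        simp only [parity_cons, parity_nil, ha', hs, ih.2, Nat.succ_ne_zero, if_true,
          if_false, show (2 : ℕ) ≠ 1 by omega]
        rw [partialSum_succ (t := t + 1), BitVec.getLsbD_add hj, BitVec.carry_succ (j + 1)]
        cases (addend B nneg G X (t + 1)).getLsbD (j + 1) <;>
          cases (partialSum B nneg G X (t + 1)).getLsbD (j + 1) <;>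
          cases BitVec.carry (j + 1) (partialSum B nneg G X (t + 1)) (addend B nneg G X (t + 1))
            false <;> simp
  exact fun t ht j hj => (main t ht j hj).1

/-! ### The acceptance circuit

For a shape `(v, h, edges, ℓ)` the units are `0, …, v + h - 1`; the first `v` of them are clamped to
the last `v` bits of the input, and the other `h` are sampled. -/

namespace Shape

/-- The number of fractional bits of the input. -/
def prec (s : Shape) : ℕ := 20 * s.2.2.2

/-- The number of bits of every number in the input. -/
def bits (s : Shape) : ℕ := 2 * s.prec

/-- The number of random bits for each Bernoulli variable. -/
def rand (s : Shape) : ℕ := 6 * s.prec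

/-- The number of units. -/
def units (s : Shape) : ℕ := s.1 + s.2.1

/-- The number of units and edges. -/
def params (s : Shape) : ℕ := s.units + s.2.2.1.length

/-- The number of real numbers in the input. -/
def terms (s : Shape) : ℕ := s.params + (s.2.1 + s.2.1 + 2)

/-- The number of input bits. -/
def inputLen (s : Shape) : ℕ := s.terms * s.bits + s.1

/-- A wire that is never set. -/
def zeroWire (s : Shape) : ℕ := s.inputLen + s.2.1 + 1

/-- A wire that is always set. -/
def oneWire (s : Shape) : ℕ := s.inputLen + s.2.1 + 2

/-- The first search qubit. -/
def searchBase (s : Shape) : ℕ := s.inputLen + s.2.1 + 3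

/-- The number of search qubits: `rand` of them for each bit of the exponents of the `h` units and
of the acceptance probability. -/
def searchSize (s : Shape) : ℕ := (s.2.1 + 1) * s.bits * s.rand

/-- The first cell of the sampler of the units. -/
def unitBase (s : Shape) : ℕ := s.searchBase + s.searchSize

/-- The first of the wires that gate the summands of the log acceptance probability. -/
def gateBase (s : Shape) : ℕ := s.unitBase + s.2.1 * s.bits * (s.rand + 2)

/-- The first cell of the adder. -/
def adderBase (s : Shape) : ℕ := s.gateBase + s.terms

/-- The first cell of the sampler of the acceptance decision. -/
def acceptBase (s : Shape) : ℕ := s.adderBase + s.terms * s.bits * 3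

/-- The wire that holds the sampled value of the unit `i`. -/
def sampleWire (s : Shape) (i : ℕ) : ℕ :=
  s.unitBase + ((i * s.bits + (s.bits - 1)) * (s.rand + 2) + (s.rand + 1))

/-- The wire that holds the acceptance decision. -/
def acceptWire (s : Shape) : ℕ :=
  s.acceptBase + ((0 * s.bits + (s.bits - 1)) * (s.rand + 2) + (s.rand + 1))

/-- The wire that holds the value of the unit `i`, clamped or sampled. -/
def unitWire (s : Shape) (i : ℕ) : ℕ :=
  if i < s.1 then s.terms * s.bits + i else s.sampleWire (i - s.1)

/-- The cells of the gates of the summands: `z_i` for a bias and for `log μ_i`, `z_i z_j` for a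
weight, `1 - z_i` for `log (1 - μ_i)`, and `1` for `log Z` and `log κ`. -/
def gateBody (s : Shape) (q : ℕ) : List (ℕ × ℕ) :=
  if q < s.units then [(s.unitWire q, s.unitWire q)]
  else if q < s.params then
    [(s.unitWire (s.2.2.1.getD (q - s.units) (0, 0)).1,
      s.unitWire (s.2.2.1.getD (q - s.units) (0, 0)).2)]
  else if q < s.params + s.2.1 then
    [(s.sampleWire (q - s.params), s.sampleWire (q - s.params))]
  else if q < s.params + s.2.1 + s.2.1 then
    [(s.oneWire, s.oneWire), (s.sampleWire (q - s.params - s.2.1),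
      s.sampleWire (q - s.params - s.2.1))]
  else [(s.oneWire, s.oneWire)]

end Shape

/-- The sequence of rounded-down repeated squares of `1 - 2^{-q}` as fixed-point numbers with `R`
fractional bits; the `i`-th entry approximates `exp (-2^{i-q})`. -/
def squares (R q : ℕ) : ℕ → ℕ
  | 0 => 2 ^ R - 2 ^ (R - q)
  | i + 1 => squares R q i * squares R q i / 2 ^ R

namespace Shape

/-- The threshold for the bit `j` of an exponent, `2^rand * exp (-2^{j - prec})` up to rounding. -/
def threshold (s : Shape) (j : ℕ) : ℕ := squares s.rand (3 * s.prec) (j + 2 * s.prec)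

/-- The acceptance circuit: sample the units, add up the log acceptance probability, sample the
acceptance decision, and copy the results to the flag and output qubits. -/
def acceptCircuit (s : Shape) : List (ℕ × ℕ × ℕ) :=
  cells s.unitBase (s.2.1 * s.bits * (s.rand + 2))
    (samplerBody s.zeroWire s.oneWire s.unitBase (s.params * s.bits) 1 s.searchBase s.bits s.rand
      s.threshold) ++
  (cells s.gateBase s.terms s.gateBody ++
  (cells s.adderBase (s.terms * s.bits * 3)
    (adderBody s.zeroWire s.gateBase s.adderBase s.bits s.params) ++
  (cells s.acceptBase (s.bits * (s.rand + 2))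
    (samplerBody s.zeroWire s.oneWire s.acceptBase
      (s.adderBase + ((s.terms - 1) * s.bits * 3 + 1)) 3
      (s.searchBase + s.2.1 * s.bits * s.rand) s.bits s.rand s.threshold) ++
  copies s.inputLen (s.2.1 + 1) fun i => if i = 0 then s.acceptWire else s.sampleWire (i - 1))))

/-- The gate of the summand `q` when the clamped units have the values `x` and the sampled ones the
values `z`. -/
def gateVal (s : Shape) (x z : ℕ → Bool) (q : ℕ) : Bool :=
  let val := fun i => if i < s.1 then x i else z (i - s.1)
  if q < s.units then val q
  else if q < s.params then val (s.2.2.1.getD (q - s.units) (0, 0)).1 &&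
    val (s.2.2.1.getD (q - s.units) (0, 0)).2
  else if q < s.params + s.2.1 then z (q - s.params)
  else if q < s.params + s.2.1 + s.2.1 then !z (q - s.params - s.2.1)
  else true

end Shape

/-- The conjunction, over the bits `j < B`, of "`a j` or the random number in row `j` is less than
the threshold `c j`". -/
def expBernoulli (B R : ℕ) (c : ℕ → ℕ) (a : ℕ → Bool) (u : ℕ → ℕ → Bool) : Bool :=
  decide (∀ j < B, a j = true ∨ ltBit (c j) (u j) R = true)

namespace Shape

/-- The value of the sampled unit `i` when the wires have the values of `S`. -/
def sampleVal (s : Shape) (S : Finset ℕ) (i : ℕ) : Bool :=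
  expBernoulli s.bits s.rand s.threshold (fun j => wire S ((s.params + i) * s.bits + j))
    fun j k => wire S (s.searchBase + ((i * s.bits + j) * s.rand + k))

/-- The flag wire holds the Bernoulli variable of the log acceptance probability of the sampled
units, and the output wires hold the sampled units. -/
theorem wire_acceptCircuit (s : Shape) (hl : 0 < s.2.2.2) (S : Finset ℕ)
    (hedges : ∀ e ∈ s.2.2.1, e.1 < s.units ∧ e.2 < s.units)
    (hS : ClearFrom S s.unitBase) (hone : wire S s.oneWire = true)
    (hclear : ∀ i ≤ s.2.1 + 1, wire S (s.inputLen + i) = false) (X : ℕ → BitVec s.bits)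
    (hX : ∀ q < s.terms, ∀ j < s.bits, (X q).getLsbD j = wire S (q * s.bits + j)) :
    wire (toffoliRun s.acceptCircuit S) s.inputLen =
      expBernoulli s.bits s.rand s.threshold
        (fun j => (partialSum s.bits s.params (s.gateVal (fun i => wire S (s.terms * s.bits + i))
          (s.sampleVal S)) X s.terms).getLsbD j)
        (fun j k => wire S (s.searchBase + ((s.2.1 * s.bits + j) * s.rand + k))) ∧
    ∀ i < s.2.1, wire (toffoliRun s.acceptCircuit S) (s.inputLen + 1 + i) = s.sampleVal S i := by
  have hB : 0 < s.bits := by unfold bits prec; omega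
  have hR : 0 < s.rand := by unfold rand prec; omega
  have hT : 0 < s.terms := by unfold terms; omega
  have hz0 : wire S s.zeroWire = false := hclear (s.2.1 + 1) le_rfl
  have eT : s.terms * s.bits = s.params * s.bits + (s.2.1 * s.bits + s.2.1 * s.bits +
    2 * s.bits) := by rw [terms]; ring
  have eLen : s.inputLen = s.terms * s.bits + s.1 := rfl
  have eZ : s.zeroWire = s.inputLen + s.2.1 + 1 := rfl
  have eO : s.oneWire = s.inputLen + s.2.1 + 2 := rfl
  have eU : s.searchBase = s.inputLen + s.2.1 + 3 := rfl
  have eN : s.searchSize = s.2.1 * s.bits * s.rand + s.bits * s.rand := by rw [searchSize]; ring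
  have e1 : s.unitBase = s.searchBase + s.searchSize := rfl
  have e2 : s.gateBase = s.unitBase + s.2.1 * s.bits * (s.rand + 2) := rfl
  have e3 : s.adderBase = s.gateBase + s.terms := rfl
  have e4 : s.acceptBase = s.adderBase + s.terms * s.bits * 3 := rfl
  -- sampling the units
  obtain ⟨a1, a2, a3⟩ := wire_sampler (base := s.unitBase) (abase := s.params * s.bits)
    (astride := 1) (ubase := s.searchBase) (c := s.threshold) hS (n := s.2.1 * s.bits)
    (by omega) hz0 (by omega) hone (fun r hr => by omega) (by omega) hR hB
  set S1 := toffoliRun (cells s.unitBase (s.2.1 * s.bits * (s.rand + 2))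
    (samplerBody s.zeroWire s.oneWire s.unitBase (s.params * s.bits) 1 s.searchBase s.bits s.rand
      s.threshold)) S with hS1
  have hsample_lt : ∀ i < s.2.1, s.unitBase ≤ s.sampleWire i ∧ s.sampleWire i < s.gateBase := by
    intro i hi
    have h1 : (i + 1) * s.bits ≤ s.2.1 * s.bits := Nat.mul_le_mul_right _ hi
    have h2 : (i + 1) * s.bits = i * s.bits + s.bits := by ring
    have h3 : (i * s.bits + (s.bits - 1) + 1) * (s.rand + 2) ≤ s.2.1 * s.bits * (s.rand + 2) :=
      Nat.mul_le_mul_right _ (by omega)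
    have h4 : (i * s.bits + (s.bits - 1) + 1) * (s.rand + 2) =
      (i * s.bits + (s.bits - 1)) * (s.rand + 2) + (s.rand + 2) := by ring
    rw [sampleWire, e2]
    omega
  have hsample : ∀ i < s.2.1, wire S1 (s.sampleWire i) = s.sampleVal S i := by
    intro i hi
    rw [sampleWire, a3 i (Nat.mul_le_mul_right _ hi), sampleVal, expBernoulli]
    have : ∀ j, s.params * s.bits + 1 * (i * s.bits + j) = (s.params + i) * s.bits + j := by
      intro j; ring
    simp only [this]
  have hunit : ∀ i < s.units, s.unitWire i < s.gateBase ∧ wire S1 (s.unitWire i) =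
      if i < s.1 then wire S (s.terms * s.bits + i) else s.sampleVal S (i - s.1) := by
    intro i hi
    rw [unitWire]
    split_ifs with h
    · exact ⟨by omega, a1 _ (by omega)⟩
    · have hi' : i - s.1 < s.2.1 := by unfold units at hi; omega
      exact ⟨(hsample_lt _ hi').2, hsample _ hi'⟩
  have hedge : ∀ q, (s.2.2.1.getD (q - s.units) (0, 0)).1 < s.units ∧
      (s.2.2.1.getD (q - s.units) (0, 0)).2 < s.units ∨ ¬ (s.units ≤ q ∧ q < s.params) := by
    intro q
    by_cases h : s.units ≤ q ∧ q < s.params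
    · left
      have hlt : q - s.units < s.2.2.1.length := by unfold params at h; omega
      rw [List.getD_eq_getElem _ _ hlt]
      exact hedges _ (List.getElem_mem hlt)
    · exact Or.inr h
  -- the gates
  obtain ⟨b1, b2, b3⟩ := toffoliRun_cells (base := s.gateBase) (T := s.terms)
    (body := s.gateBody) (S := S1) a2 (by
      intro q hq w hw
      have hed := hedge q
      simp only [gateBody] at hw
      split_ifs at hw with g1 g2 g3 g4 <;>
        simp only [List.mem_cons, List.not_mem_nil, or_false] at hw
      · have := (hunit q g1).1
        subst hw; constructor <;> simp only <;> omega
      · rcases hed with hed | hed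
        · have := (hunit _ hed.1).1
          have := (hunit _ hed.2).1
          subst hw; constructor <;> simp only <;> omega
        · omega
      · have := (hsample_lt (q - s.params) (by omega)).2
        subst hw; constructor <;> simp only <;> omega
      · have := (hsample_lt (q - s.params - s.2.1) (by omega)).2
        rcases hw with rfl | rfl <;> constructor <;> simp only <;> omega
      · subst hw; constructor <;> simp only <;> omega)
  set S2 := toffoliRun (cells s.gateBase s.terms s.gateBody) S1 with hS2
  have hgate : ∀ q < s.terms, wire S2 (s.gateBase + q) =
      s.gateVal (fun i => wire S (s.terms * s.bits + i)) (s.sampleVal S) q := by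
    intro q hq
    have hed := hedge q
    have ho : wire S2 s.oneWire = true := by
      rw [b1 _ (by omega), a1 _ (by omega), hone]
    rw [b3 q hq]
    simp only [gateBody, gateVal]
    split_ifs with g1 g2 g3 g4 <;> simp only [parity_cons, parity_nil, Bool.xor_false, ho]
    · rw [b1 _ (hunit q g1).1, (hunit q g1).2, Bool.and_self, if_pos (by assumption)]
    · rw [b1 _ (hunit q g1).1, (hunit q g1).2, Bool.and_self, if_neg (by assumption)]
    all_goals try
      rcases hed with hed | hed
      · rw [b1 _ (hunit _ hed.1).1, (hunit _ hed.1).2, b1 _ (hunit _ hed.2).1, (hunit _ hed.2).2]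
        simp only [*, if_true, if_false]
      · omega
    · have hlt : q - s.params < s.2.1 := by omega
      rw [b1 _ (hsample_lt _ hlt).2, hsample _ hlt, Bool.and_self]
    · have hlt : q - s.params - s.2.1 < s.2.1 := by omega
      rw [b1 _ (hsample_lt _ hlt).2, hsample _ hlt]
      simp
    · rfl
  -- the sum
  have hX2 : ∀ q < s.terms, ∀ j < s.bits, (X q).getLsbD j = wire S2 (q * s.bits + j) := by
    intro q hq j hj
    have h1 : (q + 1) * s.bits ≤ s.terms * s.bits := Nat.mul_le_mul_right _ hq
    have h2 : (q + 1) * s.bits = q * s.bits + s.bits := by ring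
    rw [hX q hq j hj, b1 _ (by omega), a1 _ (by omega)]
  obtain ⟨c1, c2, c3⟩ := wire_adder (wz := s.zeroWire) (gbase := s.gateBase) (base := s.adderBase)
    (B := s.bits) (nneg := s.params) b2 (T := s.terms) (by omega)
    (by rw [b1 _ (by omega), a1 _ (by omega), hz0]) (by omega) (by omega) hB X hX2
  set S3 := toffoliRun (cells s.adderBase (s.terms * s.bits * 3)
    (adderBody s.zeroWire s.gateBase s.adderBase s.bits s.params)) S2 with hS3
  have hpartial : ∀ t ≤ s.terms, partialSum s.bits s.params (fun q => wire S2 (s.gateBase + q)) X t =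
      partialSum s.bits s.params (s.gateVal (fun i => wire S (s.terms * s.bits + i))
        (s.sampleVal S)) X t := by
    intro t
    induction t with
    | zero => intro _; rfl
    | succ t ih =>
      intro ht
      rw [partialSum_succ, partialSum_succ, ih (by omega), addend, addend, hgate t (by omega)]
  -- the acceptance decision
  have e5 : (s.terms - 1) * s.bits + s.bits = s.terms * s.bits := by
    have : s.terms = s.terms - 1 + 1 := by omega
    conv_rhs => rw [this]
    ring
  have hold : ∀ w < s.unitBase, wire S3 w = wire S w := by
    intro w hw
    rw [c1 _ (by omega), b1 _ (by omega), a1 _ hw]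
  obtain ⟨d1, d2, d3⟩ := wire_sampler (base := s.acceptBase)
    (abase := s.adderBase + ((s.terms - 1) * s.bits * 3 + 1))
    (astride := 3) (ubase := s.searchBase + s.2.1 * s.bits * s.rand) (B := s.bits) (R := s.rand)
    (c := s.threshold) (wz := s.zeroWire) (one := s.oneWire) (S := S3)
    (by rw [e4, ← Nat.add_assoc] at *; exact c2) (n := s.bits)
    (by omega) (by rw [hold _ (by omega), hz0]) (by omega) (by rw [hold _ (by omega), hone])
    (fun r hr => by omega) (by omega) hR hB
  set S4 := toffoliRun (cells s.acceptBase (s.bits * (s.rand + 2))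
    (samplerBody s.zeroWire s.oneWire s.acceptBase
      (s.adderBase + ((s.terms - 1) * s.bits * 3 + 1)) 3
      (s.searchBase + s.2.1 * s.bits * s.rand) s.bits s.rand s.threshold)) S3 with hS4
  have haccept : wire S4 s.acceptWire = expBernoulli s.bits s.rand s.threshold
        (fun j => (partialSum s.bits s.params (s.gateVal (fun i => wire S (s.terms * s.bits + i))
          (s.sampleVal S)) X s.terms).getLsbD j)
        (fun j k => wire S (s.searchBase + ((s.2.1 * s.bits + j) * s.rand + k))) := by
    rw [acceptWire, d3 0 (by omega), expBernoulli]
    congr 1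
    refine propext (forall_congr' fun j => forall_congr' fun hj => ?_)
    have h1 : wire S3 (s.adderBase + ((s.terms - 1) * s.bits * 3 + 1) + 3 * (0 * s.bits + j)) =
        (partialSum s.bits s.params (s.gateVal (fun i => wire S (s.terms * s.bits + i))
          (s.sampleVal S)) X s.terms).getLsbD j := by
      have := c3 (s.terms - 1) (by omega) j hj
      rw [show s.terms - 1 + 1 = s.terms by omega, hpartial _ le_rfl] at this
      rw [← this]
      congr 1
      ring
    rw [h1]
    have h2 : ltBit (s.threshold j) (fun k => wire S3 (s.searchBase + s.2.1 * s.bits * s.rand +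
        ((0 * s.bits + j) * s.rand + k))) s.rand =
        ltBit (s.threshold j)
          (fun k => wire S (s.searchBase + ((s.2.1 * s.bits + j) * s.rand + k))) s.rand := by
      rw [ltBit_eq, ltBit_eq]
      congr 2
      refine Finset.sum_congr rfl fun k hk => ?_
      rw [Finset.mem_range] at hk
      have h3 : (j + 1) * s.rand ≤ s.bits * s.rand := Nat.mul_le_mul_right _ hj
      have h4 : (j + 1) * s.rand = j * s.rand + s.rand := by ring
      have h5 : (0 * s.bits + j) * s.rand = j * s.rand := by ring
      have h6 : (s.2.1 * s.bits + j) * s.rand = s.2.1 * s.bits * s.rand + j * s.rand := by ring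
      rw [h5, h6, hold _ (by omega)]
      congr 3
      ring
    rw [h2]
  -- the copies
  have hrun : toffoliRun s.acceptCircuit S = toffoliRun (copies s.inputLen (s.2.1 + 1) fun i =>
      if i = 0 then s.acceptWire else s.sampleWire (i - 1)) S4 := by
    rw [acceptCircuit, toffoliRun_append, toffoliRun_append, toffoliRun_append, toffoliRun_append]
  have hold4 : ∀ w < s.gateBase, wire S4 w = wire S1 w := by
    intro w hw
    rw [d1 _ (by omega), c1 _ (by omega), b1 _ (by omega)]
  have hcopy := wire_toffoliRun_copies (dst := s.inputLen) (n := s.2.1 + 1)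
    (src := fun i => if i = 0 then s.acceptWire else s.sampleWire (i - 1)) (S := S4)
    (by
      intro i hi
      split_ifs with h
      · rw [acceptWire]; omega
      · have := (hsample_lt (i - 1) (by omega)).1
        omega)
    (by
      intro i hi
      rw [hold4 _ (by omega), a1 _ (by omega), hclear i (by omega)])
  rw [hrun]
  refine ⟨?_, fun i hi => ?_⟩
  · rw [hcopy, if_pos (by omega), Nat.sub_self, if_pos rfl, haccept]
  · rw [hcopy, if_pos (by omega), show s.inputLen + 1 + i - s.inputLen = i + 1 by omega,
      if_neg (by omega), Nat.add_sub_cancel, hold4 _ (hsample_lt i hi).2, hsample i hi]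

end Shape

/-! ### Counting accepted words -/

/-- Subsets of the range of an injection correspond to Boolean functions on its domain. -/
theorem card_filter_powerset_image {ι : Type*} [Fintype ι] [DecidableEq ι] (e : ι → ℕ)
    (he : Function.Injective e) (P : (ι → Bool) → Prop) [DecidablePred P] :
    ((Finset.univ.image e).powerset.filter fun A => P fun x => wire A (e x)).card =
      (Finset.univ.filter P).card := by
  refine Finset.card_nbij' (fun A x => wire A (e x))
    (fun u => (Finset.univ.filter fun x => u x = true).image e) ?_ ?_ ?_ ?_
  · intro A hA
    simpa using (Finset.mem_filter.1 hA).2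
  · intro u hu
    have hu' : (fun x => wire ((Finset.univ.filter fun x => u x = true).image e) (e x)) = u := by
      funext x
      rw [Bool.eq_iff_iff, ← mem_iff_wire]
      simp [he.eq_iff]
    rw [Finset.mem_coe, Finset.mem_filter]
    refine ⟨Finset.mem_powerset.2 (Finset.image_subset_image (Finset.filter_subset _ _)), ?_⟩
    rw [hu']
    exact (Finset.mem_filter.1 hu).2
  · intro A hA
    have hA' := Finset.mem_powerset.1 (Finset.mem_filter.1 hA).1
    ext w
    simp only [Finset.mem_image, Finset.mem_filter, Finset.mem_univ, true_and, ← mem_iff_wire]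
    constructor
    · rintro ⟨x, hx, rfl⟩
      exact hx
    · intro hw
      obtain ⟨x, -, rfl⟩ := Finset.mem_image.1 (hA' hw)
      exact ⟨x, hw, rfl⟩
  · intro u _
    funext x
    rw [Bool.eq_iff_iff, ← mem_iff_wire]
    simp [he.eq_iff]

/-- A uniform random number of `R` bits is less than `c` with probability `c / 2^R`. -/
theorem card_filter_binary_lt (R c : ℕ) (hc : c ≤ 2 ^ R) :
    (Finset.univ.filter fun w : Fin R → Bool => ∑ k, (w k).toNat * 2 ^ (k : ℕ) < c).card = c := by
  have h : (Finset.univ.filter fun n : Fin (2 ^ R) => (n : ℕ) < c).card = c := by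
    rw [Fin.card_filter_val_lt]
    omega
  conv_rhs => rw [← h]
  refine Finset.card_equiv ((Equiv.arrowCongr (Equiv.refl _) finTwoEquiv.symm).trans
    finFunctionFinEquiv) fun w => ?_
  simp only [Finset.mem_filter, Finset.mem_univ, true_and, Equiv.trans_apply,
    finFunctionFinEquiv_apply]
  have : ∀ b : Bool, ((finTwoEquiv.symm b : Fin 2) : ℕ) = b.toNat := by decide
  simp [Equiv.arrowCongr, this]

/-- The event of `expBernoulli` as a property of the finite array of random bits. -/
def ExpEvent {B R : ℕ} (c : ℕ → ℕ) (a : ℕ → Bool) (w : Fin B → Fin R → Bool) : Prop :=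
  ∀ j : Fin B, a j = true ∨ ∑ k, (w j k).toNat * 2 ^ (k : ℕ) < c j

instance {B R : ℕ} (c : ℕ → ℕ) (a : ℕ → Bool) :
    DecidablePred (ExpEvent (B := B) (R := R) c a) :=
  fun _ => inferInstanceAs (Decidable (∀ _, _))

theorem expBernoulli_eq_true_iff {B R : ℕ} {c : ℕ → ℕ} (hc : ∀ j, c j < 2 ^ R) (a : ℕ → Bool)
    (u : ℕ → ℕ → Bool) :
    expBernoulli B R c a u = true ↔ ExpEvent c a fun (j : Fin B) (k : Fin R) => u j k := by
  rw [expBernoulli, decide_eq_true_eq, ExpEvent, Fin.forall_iff]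
  refine forall_congr' fun j => forall_congr' fun _ => ?_
  rw [ltBit_eq, decide_eq_true_eq, Nat.mod_eq_of_lt (hc j),
    Fin.sum_univ_eq_sum_range (fun k => (u j k).toNat * 2 ^ k)]

/-- The probability of the event of `expBernoulli`. -/
def expProb (B R : ℕ) (c : ℕ → ℕ) (a : ℕ → Bool) : ℝ :=
  ∏ j ∈ Finset.range B, if a j then 1 else (c j : ℝ) / 2 ^ R

/-- The rows are independent, so the probability of the conjunction is the product. -/
theorem card_expEvent {B R : ℕ} {c : ℕ → ℕ} (hc : ∀ j, c j < 2 ^ R) (a : ℕ → Bool) :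
    ((Finset.univ.filter fun w : Fin B → Fin R → Bool => ExpEvent c a w).card : ℝ) =
      (2 ^ R) ^ B * expProb B R c a := by
  have h : (Finset.univ.filter fun w : Fin B → Fin R → Bool => ExpEvent c a w) =
      Fintype.piFinset fun j : Fin B => Finset.univ.filter fun w : Fin R → Bool =>
        a j = true ∨ ∑ k, (w k).toNat * 2 ^ (k : ℕ) < c j := by
    ext w
    simp only [Finset.mem_filter, Finset.mem_univ, true_and, Fintype.mem_piFinset]
    rfl
  rw [h, Fintype.card_piFinset, expProb, ← Fin.prod_univ_eq_prod_range
    (fun j => if a j then 1 else (c j : ℝ) / 2 ^ R), Nat.cast_prod]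
  have e : ((2 : ℝ) ^ R) ^ B = ∏ _j : Fin B, (2 : ℝ) ^ R := by simp
  rw [e, ← Finset.prod_mul_distrib]
  refine Finset.prod_congr rfl fun j _ => ?_
  cases a j
  · simp only [Bool.false_eq_true, false_or, if_false]
    rw [card_filter_binary_lt _ _ (hc j).le]
    field_simp
  · simp

/-- The number of arrays of random bits for which the first `h` events have the outcomes `y` and the
last one, whose exponent may depend on `y`, happens. -/
theorem card_samples {B R h : ℕ} {c : ℕ → ℕ} (hc : ∀ j, c j < 2 ^ R) (a : ℕ → ℕ → Bool)
    (b : ℕ → Bool) (y : Fin h → Bool) :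
    ((Finset.univ.filter fun w : Fin (h + 1) × Fin B × Fin R → Bool =>
      ExpEvent c b (fun j k => w (Fin.last h, j, k)) ∧
        ∀ i : Fin h, ExpEvent c (a i) (fun j k => w (i.castSucc, j, k)) ↔ y i = true).card : ℝ) =
      ((2 ^ R) ^ B) ^ (h + 1) *
        (productDist (fun i : Fin h => expProb B R c (a i)) y * expProb B R c b) := by
  classical
  let E : Fin (h + 1) → Finset (Fin B → Fin R → Bool) :=
    Fin.lastCases (motive := fun _ => Finset (Fin B → Fin R → Bool))
      (Finset.univ.filter fun w => ExpEvent c b w)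
      fun i => Finset.univ.filter fun w => ExpEvent c (a i) w ↔ y i = true
  have h1 : (Finset.univ.filter fun w : Fin (h + 1) × Fin B × Fin R → Bool =>
      ExpEvent c b (fun j k => w (Fin.last h, j, k)) ∧
        ∀ i : Fin h, ExpEvent c (a i) (fun j k => w (i.castSucc, j, k)) ↔ y i = true).card =
      (Fintype.piFinset E).card := by
    refine Finset.card_equiv ((Equiv.curry _ _ _).trans
      (Equiv.arrowCongr (Equiv.refl _) (Equiv.curry _ _ _))) fun w => ?_
    simp only [Finset.mem_filter, Finset.mem_univ, true_and, Fintype.mem_piFinset,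
      Fin.forall_fin_succ']
    simp only [E, Fin.lastCases_castSucc, Fin.lastCases_last, Finset.mem_filter, Finset.mem_univ,
      true_and]
    rw [and_comm]
    rfl
  rw [h1, Fintype.card_piFinset, Fin.prod_univ_castSucc, Nat.cast_mul, Nat.cast_prod]
  simp only [E, Fin.lastCases_castSucc, Fin.lastCases_last]
  rw [card_expEvent hc, pow_succ, productDist]
  have h2 : ∀ i : Fin h, ((Finset.univ.filter fun w : Fin B → Fin R → Bool =>
      ExpEvent c (a i) w ↔ y i = true).card : ℝ) =
      (2 ^ R) ^ B * if y i = true then expProb B R c (a i) else 1 - expProb B R c (a i) := by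
    intro i
    cases y i
    · have h3 := Finset.card_filter_add_card_filter_not
        (s := (Finset.univ : Finset (Fin B → Fin R → Bool))) (fun w => ExpEvent c (a i) w)
      have h4 : ((((Finset.univ.filter fun w : Fin B → Fin R → Bool => ExpEvent c (a i) w).card +
        (Finset.univ.filter fun w : Fin B → Fin R → Bool => ¬ ExpEvent c (a i) w).card : ℕ)) : ℝ) =
        (2 ^ R) ^ B := by
        rw [h3]
        simp
      push_cast at h4
      rw [card_expEvent hc] at h4
      simp only [Bool.false_eq_true, iff_false, if_false]
      linarith
    · simp only [iff_true, if_true]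
      exact card_expEvent hc _
  simp only [h2]
  rw [Finset.prod_mul_distrib]
  simp
  ring

theorem squares_lt (R q i : ℕ) : squares R q i < 2 ^ R := by
  induction i with
  | zero =>
    have h1 : 0 < 2 ^ (R - q) := by positivity
    have h2 : 0 < 2 ^ R := by positivity
    rw [squares]
    omega
  | succ i ih =>
    rw [squares]
    refine Nat.div_lt_of_lt_mul ?_
    exact Nat.mul_lt_mul'' ih ih

/-! ### The rounds -/

namespace Shape

/-- The test whether some search qubit is set. -/
def anyCircuit (s : Shape) : List (ℕ × ℕ × ℕ) :=
  cells s.unitBase s.searchSize (anyBody s.zeroWire s.searchBase s.unitBase)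

/-- The search qubits. -/
def searchQubits (s : Shape) : List ℕ := (List.range s.searchSize).map fun t => s.searchBase + t

/-- The circuit of a round with `(3^k - 1) / 2` Grover iterations, which multiplies the angle by
`3^k`. -/
def round (s : Shape) (k : ℕ) : List Gate :=
  groverCircuit s.acceptCircuit s.inputLen s.anyCircuit (s.unitBase + (s.searchSize - 1))
    s.searchQubits s.oneWire ((3 ^ k - 1) / 2)

/-- The word `y` extended by `false`. -/
def extend {h : ℕ} (y : Fin h → Bool) (i : ℕ) : Bool := if hi : i < h then y ⟨i, hi⟩ else false

theorem gateVal_congr (s : Shape) (hedges : ∀ e ∈ s.2.2.1, e.1 < s.units ∧ e.2 < s.units)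
    (x : ℕ → Bool) {z z' : ℕ → Bool} (h : ∀ i < s.2.1, z i = z' i) (q : ℕ) :
    s.gateVal x z q = s.gateVal x z' q := by
  have hval : ∀ i < s.units, (if i < s.1 then x i else z (i - s.1)) =
      if i < s.1 then x i else z' (i - s.1) := by
    intro i hi
    split_ifs
    · rfl
    · exact h _ (by unfold units at hi; omega)
  simp only [gateVal]
  by_cases h1 : q < s.units
  · rw [if_pos h1, if_pos h1, hval q h1]
  rw [if_neg h1, if_neg h1]
  by_cases h2 : q < s.params
  · have hlt : q - s.units < s.2.2.1.length := by unfold params at h2; omega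
    have := hedges _ (List.getElem_mem hlt)
    rw [if_pos h2, if_pos h2, List.getD_eq_getElem _ _ hlt, hval _ this.1, hval _ this.2]
  rw [if_neg h2, if_neg h2]
  by_cases h3 : q < s.params + s.2.1
  · rw [if_pos h3, if_pos h3, h _ (by omega)]
  rw [if_neg h3, if_neg h3]
  by_cases h4 : q < s.params + s.2.1 + s.2.1
  · rw [if_pos h4, if_pos h4, h _ (by omega)]
  rw [if_neg h4, if_neg h4]

/-- The probability with which the sampler sets the unit `i`. -/
def unitProb (s : Shape) (inp : ℕ → Bool) (i : ℕ) : ℝ :=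
  expProb s.bits s.rand s.threshold fun j => inp ((s.params + i) * s.bits + j)

/-- The sum of the summands of the log acceptance probability of `y`, in two's complement. -/
def logAccept (s : Shape) (inp : ℕ → Bool) (X : ℕ → BitVec s.bits) (y : ℕ → Bool) :
    BitVec s.bits :=
  partialSum s.bits s.params (s.gateVal (fun i => inp (s.terms * s.bits + i)) y) X s.terms

/-- The probability that the sampler returns `y` and accepts. -/
def weight (s : Shape) (inp : ℕ → Bool) (X : ℕ → BitVec s.bits) (y : Fin s.2.1 → Bool) : ℝ :=
  productDist (fun i : Fin s.2.1 => s.unitProb inp i) y *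
    expProb s.bits s.rand s.threshold fun j => (s.logAccept inp X (extend y)).getLsbD j

theorem threshold_lt (s : Shape) (j : ℕ) : s.threshold j < 2 ^ s.rand := squares_lt _ _ _

/-- The basis state of the input, with the constant wire set. -/
def initial (s : Shape) (input : List Bool) : Finset ℕ :=
  flipQubit s.oneWire ((Finset.range input.length).filter fun i => input.getD i false = true)

theorem wire_initial (s : Shape) (input : List Bool) (hlen : input.length = s.inputLen) (w : ℕ) :
    wire (s.initial input) w = if w = s.oneWire then true else input.getD w false := by
  have hO : s.oneWire = s.inputLen + s.2.1 + 2 := rfl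
  rw [Bool.eq_iff_iff, ← mem_iff_wire, initial, mem_flipQubit]
  by_cases h : w = s.oneWire
  · simp only [h, if_true, Finset.mem_filter, Finset.mem_range, iff_true]
    omega
  · simp only [h, if_false, Finset.mem_filter, Finset.mem_range]
    constructor
    · exact fun h => h.2
    · intro h'
      refine ⟨?_, h'⟩
      by_contra hcon
      rw [List.getD_eq_default _ _ (by omega)] at h'
      exact absurd h' (by simp)

theorem wire_union (S A : Finset ℕ) (w : ℕ) : wire (S ∪ A) w = (wire S w || wire A w) := by
  simp [wire]

theorem mem_searchQubits (s : Shape) (w : ℕ) :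
    w ∈ s.searchQubits ↔ s.searchBase ≤ w ∧ w < s.unitBase := by
  have e1 : s.unitBase = s.searchBase + s.searchSize := rfl
  simp only [searchQubits, List.mem_map, List.mem_range]
  constructor
  · rintro ⟨t, ht, rfl⟩
    omega
  · intro h
    exact ⟨w - s.searchBase, by omega, by omega⟩

/-- The address of the search bit `k` in row `j` of the block `i`. -/
def searchAddr (s : Shape) (x : Fin (s.2.1 + 1) × Fin s.bits × Fin s.rand) : ℕ :=
  s.searchBase + ((x.1 * s.bits + x.2.1) * s.rand + x.2.2)

theorem searchAddr_injective (s : Shape) : Function.Injective s.searchAddr := by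
  rintro ⟨i, j, k⟩ ⟨i', j', k'⟩ h
  simp only [searchAddr] at h
  have h1 := Nat.add_left_cancel h
  have h2 := mul_add_div_mod (i * s.bits + j) s.rand k k.2
  have h3 := mul_add_div_mod (i' * s.bits + j') s.rand k' k'.2
  rw [h1, h3.1, h3.2] at h2
  have h4 := mul_add_div_mod i s.bits j j.2
  have h5 := mul_add_div_mod i' s.bits j' j'.2
  rw [← h2.1, h5.1, h5.2] at h4
  ext
  · exact h4.1.symm
  · exact h4.2.symm
  · exact h2.2.symm

theorem image_searchAddr (s : Shape) :
    Finset.univ.image s.searchAddr = s.searchQubits.toFinset := by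
  have e1 : s.unitBase = s.searchBase + s.searchSize := rfl
  ext w
  rw [List.mem_toFinset, mem_searchQubits, Finset.mem_image]
  constructor
  · rintro ⟨⟨i, j, k⟩, -, rfl⟩
    have h1 : ((i : ℕ) + 1) * s.bits ≤ (s.2.1 + 1) * s.bits := Nat.mul_le_mul_right _ i.2
    have h2 : ((i : ℕ) + 1) * s.bits = i * s.bits + s.bits := by ring
    have h3 : ((i : ℕ) * s.bits + j + 1) * s.rand ≤ (s.2.1 + 1) * s.bits * s.rand :=
      Nat.mul_le_mul_right _ (by have := j.2; omega)
    have h4 : ((i : ℕ) * s.bits + j + 1) * s.rand = (i * s.bits + j) * s.rand + s.rand := by ring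
    have h5 : s.searchSize = (s.2.1 + 1) * s.bits * s.rand := rfl
    have h6 := k.2
    simp only [searchAddr]
    omega
  · rintro ⟨h1, h2⟩
    have hlt : w - s.searchBase < (s.2.1 + 1) * s.bits * s.rand := by
      have h5 : s.searchSize = (s.2.1 + 1) * s.bits * s.rand := rfl
      omega
    have hR : 0 < s.rand := by
      rcases Nat.eq_zero_or_pos s.rand with h | h
      · rw [h] at hlt; omega
      · exact h
    have hB : 0 < s.bits := by
      rcases Nat.eq_zero_or_pos s.bits with h | h
      · rw [h] at hlt; simp at hlt
      · exact h
    have hr : (w - s.searchBase) / s.rand < (s.2.1 + 1) * s.bits :=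
      Nat.div_lt_of_lt_mul (by rwa [mul_comm])
    refine ⟨⟨⟨(w - s.searchBase) / s.rand / s.bits, Nat.div_lt_of_lt_mul (by rwa [mul_comm])⟩,
      ⟨(w - s.searchBase) / s.rand % s.bits, Nat.mod_lt _ hB⟩,
      ⟨(w - s.searchBase) % s.rand, Nat.mod_lt _ hR⟩⟩, Finset.mem_univ _, ?_⟩
    simp only [searchAddr]
    rw [Nat.div_add_mod', Nat.div_add_mod']
    omega

section Run

variable (s : Shape) (hl : 0 < s.2.2.2) (input : List Bool) (hlen : input.length = s.inputLen)
  (hedges : ∀ e ∈ s.2.2.1, e.1 < s.units ∧ e.2 < s.units) (X : ℕ → BitVec s.bits)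
  (hX : ∀ q < s.terms, ∀ j < s.bits, (X q).getLsbD j = input.getD (q * s.bits + j) false)

include hl hlen hedges hX in
/-- Acceptance with output `y` in terms of the random bits in the search register `A`: the Bernoulli
variables of the units have the values `y`, and that of the log acceptance probability of `y` holds.
-/
theorem accept_iff (A : Finset ℕ) (hA : A ⊆ s.searchQubits.toFinset) (y : Fin s.2.1 → Bool) :
    (input.length ∈ toffoliRun s.acceptCircuit (s.initial input ∪ A) ∧
      ∀ j : Fin s.2.1, (input.length + 1 + (j : ℕ) ∈
        toffoliRun s.acceptCircuit (s.initial input ∪ A) ↔ y j = true)) ↔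
    ExpEvent s.threshold (fun j => (s.logAccept (fun w => input.getD w false) X
        (extend y)).getLsbD j)
      (fun (j : Fin s.bits) (k : Fin s.rand) => wire A (s.searchAddr (Fin.last s.2.1, j, k))) ∧
    ∀ i : Fin s.2.1, ExpEvent s.threshold
      (fun j => input.getD ((s.params + i) * s.bits + j) false)
      (fun (j : Fin s.bits) (k : Fin s.rand) => wire A (s.searchAddr (i.castSucc, j, k))) ↔
        y i = true := by
  have hin : ∀ w, wire (s.initial input ∪ A) w = if w = s.oneWire then true
      else if w < s.inputLen then input.getD w false else wire A w := by
    intro w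
    have hO : s.oneWire = s.inputLen + s.2.1 + 2 := rfl
    have hU : s.searchBase = s.inputLen + s.2.1 + 3 := rfl
    rw [wire_union, wire_initial s input hlen]
    split_ifs with h1 h2
    · rfl
    · have : wire A w = false := by
        rw [← Bool.not_eq_true, ← mem_iff_wire]
        intro h
        have := (s.mem_searchQubits w).1 (List.mem_toFinset.1 (hA h))
        omega
      rw [this, Bool.or_false]
    · rw [List.getD_eq_default _ _ (by omega), Bool.false_or]
  have hAout : ∀ w, ¬ (s.searchBase ≤ w ∧ w < s.unitBase) → wire A w = false := by
    intro w hw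
    rw [← Bool.not_eq_true, ← mem_iff_wire]
    exact fun h => hw ((s.mem_searchQubits w).1 (List.mem_toFinset.1 (hA h)))
  have hLen : s.inputLen = s.terms * s.bits + s.1 := rfl
  have hO : s.oneWire = s.inputLen + s.2.1 + 2 := rfl
  have hU : s.searchBase = s.inputLen + s.2.1 + 3 := rfl
  have e1 : s.unitBase = s.searchBase + s.searchSize := rfl
  have hlow : ∀ w < s.inputLen, wire (s.initial input ∪ A) w = input.getD w false := by
    intro w hw
    rw [hin, if_neg (by omega), if_pos hw]
  have hsearch : ∀ t, wire (s.initial input ∪ A) (s.searchBase + t) = wire A (s.searchBase + t) := by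
    intro t
    rw [hin, if_neg (by omega), if_neg (by omega)]
  have hterm : ∀ q < s.terms, ∀ j < s.bits, q * s.bits + j < s.inputLen := by
    intro q hq j hj
    have h1 : (q + 1) * s.bits ≤ s.terms * s.bits := Nat.mul_le_mul_right _ hq
    have h2 : (q + 1) * s.bits = q * s.bits + s.bits := by ring
    omega
  obtain ⟨h1, h2⟩ := s.wire_acceptCircuit hl (s.initial input ∪ A) hedges
    (by
      intro w hw
      rw [hin, if_neg (by omega), if_neg (by omega), hAout _ (by omega)])
    (by rw [hin, if_pos rfl])
    (by
      intro i hi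
      rw [hin, if_neg (by omega), if_neg (by omega), hAout _ (by omega)]) X
    (by
      intro q hq j hj
      rw [hX q hq j hj, hlow _ (hterm q hq j hj)])
  have hunit : ∀ i : Fin s.2.1, s.sampleVal (s.initial input ∪ A) i = true ↔
      ExpEvent s.threshold (fun j => input.getD ((s.params + i) * s.bits + j) false)
        (fun (j : Fin s.bits) (k : Fin s.rand) => wire A (s.searchAddr (i.castSucc, j, k))) := by
    intro i
    rw [sampleVal, expBernoulli_eq_true_iff s.threshold_lt]
    simp only [hsearch]
    refine forall_congr' fun j => ?_
    simp only
    rw [hlow _ (hterm _ (by have := i.2; unfold terms; omega) j j.2)]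
    rfl
  rw [hlen, mem_iff_wire, h1]
  simp only [mem_iff_wire, fun j : Fin s.2.1 => h2 j j.2, hunit]
  rw [and_congr_left_iff]
  intro hy
  rw [expBernoulli_eq_true_iff s.threshold_lt]
  have hval : ∀ i < s.2.1, s.sampleVal (s.initial input ∪ A) i = extend y i := by
    intro i hi
    rw [Bool.eq_iff_iff, extend, dif_pos hi, ← hy ⟨i, hi⟩]
    exact hunit ⟨i, hi⟩
  have hg : s.gateVal (fun i => wire (s.initial input ∪ A) (s.terms * s.bits + i))
      (s.sampleVal (s.initial input ∪ A)) =
      s.gateVal (fun i => input.getD (s.terms * s.bits + i) false) (extend y) := by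
    funext q
    rw [s.gateVal_congr hedges _ hval q]
    have hx : ∀ i < s.1, wire (s.initial input ∪ A) (s.terms * s.bits + i) =
        input.getD (s.terms * s.bits + i) false := fun i hi => hlow _ (by omega)
    simp only [gateVal]
    have hx' : ∀ i (b : Bool), (if i < s.1 then wire (s.initial input ∪ A) (s.terms * s.bits + i)
        else b) = if i < s.1 then input.getD (s.terms * s.bits + i) false else b := by
      intro i b
      split_ifs with hi
      · exact hx i hi
      · rfl
    simp only [hx']
  rw [hg]
  simp only [hsearch]
  rfl

theorem length_searchQubits : s.searchQubits.length = s.searchSize := by simp [searchQubits]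

include hl hlen hedges hX in
/-- The fraction of search words that are accepted with output `y` is `weight y`. -/
theorem card_accept (y : Fin s.2.1 → Bool) :
    ((s.searchQubits.toFinset.powerset.filter fun A =>
      input.length ∈ toffoliRun s.acceptCircuit (s.initial input ∪ A) ∧ ∀ j : Fin s.2.1,
        (input.length + 1 + (j : ℕ) ∈ toffoliRun s.acceptCircuit (s.initial input ∪ A) ↔
          y j = true)).card : ℝ) / 2 ^ s.searchQubits.length =
      s.weight (fun w => input.getD w false) X y := by
  rw [Finset.filter_congr fun A hA =>
    s.accept_iff hl input hlen hedges X hX A (Finset.mem_powerset.1 hA) y]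
  rw [← image_searchAddr]
  have h := card_filter_powerset_image s.searchAddr s.searchAddr_injective
    fun w : Fin (s.2.1 + 1) × Fin s.bits × Fin s.rand → Bool =>
      ExpEvent s.threshold (fun j => (s.logAccept (fun w => input.getD w false) X
        (extend y)).getLsbD j) (fun j k => w (Fin.last s.2.1, j, k)) ∧
      ∀ i : Fin s.2.1, ExpEvent s.threshold
        (fun j => input.getD ((s.params + i) * s.bits + j) false)
        (fun j k => w (i.castSucc, j, k)) ↔ y i = true
  rw [h, card_samples s.threshold_lt
    (fun i j => input.getD ((s.params + i) * s.bits + j) false)]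
  have e : (2 : ℝ) ^ s.searchQubits.length = ((2 ^ s.rand) ^ s.bits) ^ (s.2.1 + 1) := by
    rw [length_searchQubits, searchSize, ← pow_mul, ← pow_mul]
    congr 1
    ring
  rw [e, mul_div_cancel_left₀ _ (by positivity)]
  rfl

include hl hlen hedges hX in
/-- A round succeeds with probability `sin² (3^k θ)`, where `sin² θ` is the total weight, and the
law of its output, given success, is the normalized weight, which does not depend on `k`. -/
theorem acceptProb_round (θ : ℝ)
    (hθ : Real.sin θ ^ 2 = ∑ y, s.weight (fun w => input.getD w false) X y)
    (hθ0 : Real.sin θ ≠ 0) (k : ℕ) (y : Fin s.2.1 → Bool) :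
    acceptProb (s.round k) input s.2.1 y =
      Real.sin (3 ^ k * θ) ^ 2 * (s.weight (fun w => input.getD w false) X y /
        ∑ y, s.weight (fun w => input.getD w false) X y) := by
  classical
  have hO : s.oneWire = s.inputLen + s.2.1 + 2 := rfl
  have hU : s.searchBase = s.inputLen + s.2.1 + 3 := rfl
  have e1 : s.unitBase = s.searchBase + s.searchSize := rfl
  have hpos : 0 < s.searchSize := by
    have h1 : 0 < s.bits := by unfold bits prec; omega
    have h2 : 0 < s.rand := by unfold rand prec; omega
    unfold searchSize
    positivity
  have hcard : Real.sin θ ^ 2 = ((s.searchQubits.toFinset.powerset.filter fun A =>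
      input.length ∈ toffoliRun s.acceptCircuit (s.initial input ∪ A)).card : ℝ) /
      2 ^ s.searchQubits.length := by
    rw [hθ, Finset.card_eq_sum_card_fiberwise (t := Finset.univ)
      (f := fun A => fun j : Fin s.2.1 => wire (toffoliRun s.acceptCircuit (s.initial input ∪ A))
        (input.length + 1 + (j : ℕ))) (fun _ _ => Finset.mem_coe.2 (Finset.mem_univ _)),
      Nat.cast_sum, Finset.sum_div]
    refine Finset.sum_congr rfl fun y _ => ?_
    rw [← s.card_accept hl input hlen hedges X hX y, Finset.filter_filter]
    congr 3
    refine Finset.filter_congr fun A _ => ?_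
    rw [funext_iff]
    simp only [mem_iff_wire]
    refine and_congr_right fun _ => forall_congr' fun j => ?_
    generalize wire (toffoliRun s.acceptCircuit (s.initial input ∪ A)) _ = b
    cases b <;> cases y j <;> simp
  have hwire : ∀ A ⊆ s.searchQubits.toFinset, ∀ w,
      wire (s.initial input ∪ A) w = if w = s.oneWire then true
        else if w < s.inputLen then input.getD w false else wire A w := by
    intro A hA w
    rw [wire_union, wire_initial s input hlen]
    split_ifs with h1 h2
    · rfl
    · have : wire A w = false := by
        rw [← Bool.not_eq_true, ← mem_iff_wire]
        intro h
        have := (s.mem_searchQubits w).1 (List.mem_toFinset.1 (hA h))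
        omega
      rw [this, Bool.or_false]
    · rw [List.getD_eq_default _ _ (by omega), Bool.false_or]
  have hAout : ∀ A ⊆ s.searchQubits.toFinset, ∀ w, ¬ (s.searchBase ≤ w ∧ w < s.unitBase) →
      wire A w = false := by
    intro A hA w hw
    rw [← Bool.not_eq_true, ← mem_iff_wire]
    exact fun h => hw ((s.mem_searchQubits w).1 (List.mem_toFinset.1 (hA h)))
  have hmain := acceptProb_groverCircuit s.acceptCircuit s.anyCircuit
    (s.unitBase + (s.searchSize - 1)) s.searchQubits
    (by
      refine List.Nodup.map (fun a b h => ?_) List.nodup_range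
      simpa using h) s.oneWire input (s.initial input) rfl
    (by
      intro u hu
      rw [mem_searchQubits] at hu
      rw [mem_iff_wire, wire_initial s input hlen, if_neg (by omega),
        List.getD_eq_default _ _ (by omega)]
      simp)
    (by
      intro A hA
      rw [mem_iff_wire, anyCircuit,
        wire_any (base := s.unitBase) (ubase := s.searchBase) (n := s.searchSize)
        (fun w hw => by
          rw [hwire A hA, if_neg (by omega), if_neg (by omega), hAout A hA _ (by omega)])
        (by unfold zeroWire; omega)
        (by
          have hZ : s.zeroWire = s.inputLen + s.2.1 + 1 := rfl
          rw [hwire A hA, if_neg (by omega), if_neg (by omega), hAout A hA _ (by omega)])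
        e1.ge hpos, decide_eq_true_eq, ← Finset.nonempty_iff_ne_empty]
      constructor
      · rintro ⟨i, hi, h⟩
        rw [hwire A hA, if_neg (by omega), if_neg (by omega), ← mem_iff_wire] at h
        exact ⟨_, h⟩
      · rintro ⟨w, hw⟩
        have h := (s.mem_searchQubits w).1 (List.mem_toFinset.1 (hA hw))
        refine ⟨w - s.searchBase, by omega, ?_⟩
        rw [show s.searchBase + (w - s.searchBase) = w by omega, hwire A hA, if_neg (by omega),
          if_neg (by omega), ← mem_iff_wire]
        exact hw) θ hcard hθ0 ((3 ^ k - 1) / 2) s.2.1 y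
  rw [← hθ, ← s.card_accept hl input hlen hedges X hX y]
  -- `2K + 1 = 3^k` for `K = (3^k - 1) / 2`, as `3^k` is odd
  have hodd : 2 * (((3 ^ k - 1) / 2 : ℕ) : ℝ) + 1 = 3 ^ k := by
    have h1 : 2 * ((3 ^ k - 1) / 2) + 1 = 3 ^ k := by
      have : 3 ^ k % 2 = 1 := by rw [Nat.pow_mod]; simp
      generalize 3 ^ k = n at *
      omega
    exact_mod_cast h1
  rw [hodd] at hmain
  rw [round, ← hlen]
  exact hmain

end Run

end Shape

/-! ### The schedule of the rounds -/

/-- The exponent of the round `τ`. The rounds are grouped into blocks of `W`, the exponents in the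
block `b` are `0, 1, …, W - 1` cut off at `b / 5`; thus the cut-off grows by 1 every 5 blocks. -/
def exponent (W τ : ℕ) : ℕ := min (τ % W) (τ / W / 5)

section Schedule

variable {S : ℕ → ℝ} {W k₀ : ℕ}

/-- The probability of reaching the round `τ` when the round `σ` succeeds with probability `S σ`. -/
def reach (S : ℕ → ℝ) (τ : ℕ) : ℝ := ∏ σ ∈ Finset.range τ, (1 - S σ)

theorem reach_succ (S : ℕ → ℝ) (τ : ℕ) : reach S (τ + 1) = reach S τ * (1 - S τ) := by
  rw [reach, Finset.prod_range_succ, reach]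

theorem reach_nonneg (hS : ∀ τ, S τ ≤ 1) (τ : ℕ) : 0 ≤ reach S τ :=
  Finset.prod_nonneg fun σ _ => sub_nonneg.2 (hS σ)

theorem reach_antitone (h0 : ∀ τ, 0 ≤ S τ) (hS : ∀ τ, S τ ≤ 1) : Antitone (reach S) := by
  refine antitone_nat_of_succ_le fun τ => ?_
  rw [reach_succ]
  exact mul_le_of_le_one_right (reach_nonneg hS τ) (by linarith [h0 τ])

/-- From the block `5 k₀` on, every block contains a round with the exponent `k₀`, which fails with
probability at most `3 / 4`. -/
theorem reach_block (h0 : ∀ τ, 0 ≤ S τ) (hS : ∀ τ, S τ ≤ 1) (hk : k₀ < W)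
    (hgood : ∀ τ, exponent W τ = k₀ → 1 / 4 ≤ S τ) (b : ℕ) :
    reach S (W * b) ≤ (3 / 4 : ℝ) ^ (b - 5 * k₀) := by
  induction b with
  | zero => simp [reach]
  | succ b ih =>
    by_cases hb : 5 * k₀ ≤ b
    · have e : b + 1 - 5 * k₀ = b - 5 * k₀ + 1 := by omega
      have hx : exponent W (W * b + k₀) = k₀ := by
        rw [exponent, Nat.mul_add_mod, Nat.mod_eq_of_lt hk, Nat.mul_add_div (by omega),
          Nat.div_eq_of_lt hk]
        omega
      have h1 : reach S (W * (b + 1)) ≤ reach S (W * b + k₀ + 1) :=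
        reach_antitone h0 hS (by rw [Nat.mul_add]; omega)
      have h2 : reach S (W * b + k₀) ≤ reach S (W * b) := reach_antitone h0 hS (by omega)
      rw [e, pow_succ]
      refine h1.trans ?_
      rw [reach_succ]
      exact mul_le_mul (h2.trans ih) (by linarith [hgood _ hx]) (by linarith [hS (W * b + k₀)])
        (by positivity)
    · rw [show b + 1 - 5 * k₀ = 0 by omega, pow_zero]
      exact Finset.prod_le_one (fun σ _ => sub_nonneg.2 (hS σ)) fun σ _ => by linarith [h0 σ]

theorem tendsto_reach (h0 : ∀ τ, 0 ≤ S τ) (hS : ∀ τ, S τ ≤ 1) (hk : k₀ < W)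
    (hgood : ∀ τ, exponent W τ = k₀ → 1 / 4 ≤ S τ) :
    Filter.Tendsto (reach S) Filter.atTop (nhds 0) := by
  rw [Metric.tendsto_atTop]
  intro ε hε
  obtain ⟨n, hn⟩ := exists_pow_lt_of_lt_one hε (by norm_num : (3 / 4 : ℝ) < 1)
  refine ⟨W * (n + 5 * k₀), fun τ hτ => ?_⟩
  have h1 := reach_antitone h0 hS hτ
  have h2 := reach_block h0 hS hk hgood (n + 5 * k₀)
  rw [Nat.add_sub_cancel] at h2
  rw [Real.dist_eq, sub_zero, abs_of_nonneg (reach_nonneg hS τ)]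
  linarith

theorem hasSum_reach_mul (h0 : ∀ τ, 0 ≤ S τ) (hS : ∀ τ, S τ ≤ 1) (hk : k₀ < W)
    (hgood : ∀ τ, exponent W τ = k₀ → 1 / 4 ≤ S τ) : HasSum (fun τ => reach S τ * S τ) 1 := by
  rw [hasSum_iff_tendsto_nat_of_nonneg fun τ => mul_nonneg (reach_nonneg hS τ) (h0 τ)]
  have : ∀ n, ∑ τ ∈ Finset.range n, reach S τ * S τ = 1 - reach S n := by
    intro n
    induction n with
    | zero => simp [reach]
    | succ n ih => rw [Finset.sum_range_succ, ih, reach_succ]; ring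
  simp only [this]
  simpa using (tendsto_reach h0 hS hk hgood).const_sub 1

theorem three_pow_div_five_le (c : ℕ) : (3 : ℝ) ^ (c / 5) ≤ (5 / 4) ^ c := by
  calc (3 : ℝ) ^ (c / 5) ≤ ((5 / 4) ^ 5) ^ (c / 5) :=
        pow_le_pow_left₀ (by norm_num) (by norm_num) _
    _ = (5 / 4) ^ (5 * (c / 5)) := by rw [pow_mul]
    _ ≤ (5 / 4) ^ c := pow_le_pow_right₀ (by norm_num) (Nat.mul_div_le c 5)

theorem sum_pow_div_five_le (k : ℕ) :
    ∑ b ∈ Finset.range (5 * k), (3 : ℝ) ^ (b / 5) ≤ 3 * 3 ^ k := by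
  induction k with
  | zero => simp
  | succ k ih =>
    have hp : (0 : ℝ) < 3 ^ k := by positivity
    rw [show 5 * (k + 1) = 5 * k + 5 by ring, Finset.sum_range_add]
    have : ∀ i ∈ Finset.range 5, (3 : ℝ) ^ ((5 * k + i) / 5) = 3 ^ k := by
      intro i hi
      rw [Finset.mem_range] at hi
      congr 1
      omega
    rw [Finset.sum_congr rfl this, Finset.sum_const, Finset.card_range, pow_succ, nsmul_eq_mul]
    push_cast
    linarith

/-- The cut-off grows slowly enough for the decay of the probability of reaching a block to win: the
cost of a round triples every 5 blocks, and `3 ≤ (5 / 4)^5`, while `3 / 4 * 5 / 4 = 15 / 16 < 1`. -/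
theorem sum_block_le (k₀ b : ℕ) :
    ∑ b' ∈ Finset.range b, (3 / 4 : ℝ) ^ (b' - 5 * k₀) * 3 ^ (b' / 5) ≤ 19 * 3 ^ k₀ := by
  have hp : (0 : ℝ) < 3 ^ k₀ := by positivity
  -- before the block `5 k₀` there is no decay, but the cut-off is below `k₀`
  have hfirst : ∑ b' ∈ Finset.range (5 * k₀), (3 / 4 : ℝ) ^ (b' - 5 * k₀) * 3 ^ (b' / 5) ≤
      3 * 3 ^ k₀ := by
    refine le_trans (le_of_eq ?_) (sum_pow_div_five_le k₀)
    refine Finset.sum_congr rfl fun b' hb' => ?_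
    rw [Finset.mem_range] at hb'
    rw [show b' - 5 * k₀ = 0 by omega, pow_zero, one_mul]
  have hmono : ∑ b' ∈ Finset.range b, (3 / 4 : ℝ) ^ (b' - 5 * k₀) * 3 ^ (b' / 5) ≤
      ∑ b' ∈ Finset.range (5 * k₀ + b), (3 / 4 : ℝ) ^ (b' - 5 * k₀) * 3 ^ (b' / 5) :=
    Finset.sum_le_sum_of_subset_of_nonneg
      (Finset.range_subset_range.2 (by omega)) fun _ _ _ => by positivity
  refine hmono.trans ?_
  rw [Finset.sum_range_add]
  have hgeom : ∑ c ∈ Finset.range b, (15 / 16 : ℝ) ^ c = 16 * (1 - (15 / 16) ^ b) := by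
    rw [geom_sum_eq (by norm_num)]
    ring
  -- from there on the terms are dominated by a geometric series of ratio `15 / 16`
  have hsecond : ∑ c ∈ Finset.range b, (3 / 4 : ℝ) ^ (5 * k₀ + c - 5 * k₀) *
      3 ^ ((5 * k₀ + c) / 5) ≤ 16 * 3 ^ k₀ := by
    calc _ ≤ ∑ c ∈ Finset.range b, 3 ^ k₀ * (15 / 16 : ℝ) ^ c := by
          refine Finset.sum_le_sum fun c _ => ?_
          rw [Nat.add_sub_cancel_left, show (5 * k₀ + c) / 5 = k₀ + c / 5 by omega, pow_add,
            show (15 / 16 : ℝ) = 3 / 4 * (5 / 4) by norm_num, mul_pow]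
          have := three_pow_div_five_le c
          have h34 : (0 : ℝ) < (3 / 4) ^ c := by positivity
          calc (3 / 4 : ℝ) ^ c * (3 ^ k₀ * 3 ^ (c / 5)) = 3 ^ k₀ * ((3 / 4) ^ c * 3 ^ (c / 5)) := by
                ring
            _ ≤ _ := by gcongr
      _ = 3 ^ k₀ * (16 * (1 - (15 / 16) ^ b)) := by rw [← Finset.mul_sum, hgeom]
      _ ≤ 16 * 3 ^ k₀ := by
          have : (0 : ℝ) < (15 / 16) ^ b := by positivity
          nlinarith
  linarith

/-- The expected total of `3 ^ exponent` over the rounds is `O(W 3^{k₀})` if the rounds with the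
exponent `k₀` succeed with probability at least `1 / 4`. -/
theorem sum_reach_mul_pow_le (h0 : ∀ τ, 0 ≤ S τ) (hS : ∀ τ, S τ ≤ 1) (hk : k₀ < W)
    (hgood : ∀ τ, exponent W τ = k₀ → 1 / 4 ≤ S τ) (n : ℕ) :
    ∑ τ ∈ Finset.range n, reach S τ * 3 ^ exponent W τ ≤ 19 * W * 3 ^ k₀ := by
  have hnn : ∀ τ, 0 ≤ reach S τ * (3 : ℝ) ^ exponent W τ := fun τ =>
    mul_nonneg (reach_nonneg hS τ) (by positivity)
  have h1 : ∑ τ ∈ Finset.range n, reach S τ * (3 : ℝ) ^ exponent W τ ≤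
      ∑ τ ∈ Finset.range (W * n), reach S τ * 3 ^ exponent W τ :=
    Finset.sum_le_sum_of_subset_of_nonneg
      (Finset.range_subset_range.2 (Nat.le_mul_of_pos_left n (by omega))) fun τ _ _ => hnn τ
  have h2 : ∀ b, ∑ τ ∈ Finset.range (W * b), reach S τ * (3 : ℝ) ^ exponent W τ ≤
      W * ∑ b' ∈ Finset.range b, (3 / 4 : ℝ) ^ (b' - 5 * k₀) * 3 ^ (b' / 5) := by
    intro b
    induction b with
    | zero => simp
    | succ b ih =>
      rw [Nat.mul_succ, Finset.sum_range_add, Finset.sum_range_succ, mul_add]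
      refine add_le_add ih ?_
      calc ∑ i ∈ Finset.range W, reach S (W * b + i) * (3 : ℝ) ^ exponent W (W * b + i)
          ≤ ∑ _i ∈ Finset.range W, (3 / 4 : ℝ) ^ (b - 5 * k₀) * 3 ^ (b / 5) := by
            refine Finset.sum_le_sum fun i hi => ?_
            rw [Finset.mem_range] at hi
            have he : exponent W (W * b + i) ≤ b / 5 := by
              rw [exponent, Nat.mul_add_div (by omega), Nat.div_eq_of_lt hi, Nat.add_zero]
              exact min_le_right _ _
            refine mul_le_mul ((reach_antitone h0 hS (by omega)).trans
              (reach_block h0 hS hk hgood b)) (pow_le_pow_right₀ (by norm_num) he)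
              (by positivity) (by positivity)
        _ = _ := by rw [Finset.sum_const, Finset.card_range, nsmul_eq_mul]
  refine (h1.trans (h2 n)).trans ?_
  calc (W : ℝ) * _ ≤ W * (19 * 3 ^ k₀) := by gcongr; exact sum_block_le k₀ n
    _ = _ := by ring

end Schedule

/-- Tripling an angle in `(0, π/2]` sufficiently often makes its sine at least `1/2`. -/
theorem exists_pow_three_mul_mem {θ : ℝ} (h0 : 0 < θ) (h1 : θ ≤ Real.pi / 2) :
    ∃ k : ℕ, Real.pi / 6 ≤ 3 ^ k * θ ∧ 3 ^ k * θ ≤ Real.pi / 2 := by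
  have hex : ∃ k : ℕ, Real.pi / 6 ≤ 3 ^ k * θ := by
    obtain ⟨k, hk⟩ := pow_unbounded_of_one_lt (Real.pi / 6 / θ) (by norm_num : (1 : ℝ) < 3)
    exact ⟨k, by rw [div_lt_iff₀ h0] at hk; exact hk.le⟩
  classical
  refine ⟨Nat.find hex, Nat.find_spec hex, ?_⟩
  rcases Nat.eq_zero_or_pos (Nat.find hex) with h | h
  · rw [h]; simpa using h1
  · have := Nat.find_min hex (Nat.sub_lt h one_pos)
    have e : (3 : ℝ) ^ Nat.find hex = 3 ^ (Nat.find hex - 1) * 3 := by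
      rw [← pow_succ]; congr 1; omega
    rw [not_le] at this
    rw [e]
    linarith

/-- The law of the output, and a bound on the expected number of operations, of a sampling run in
which the round `τ` succeeds with probability `sin² (3^k θ)`, `k` the exponent of `τ`. -/
theorem outputLaw_and_expectedOps_of_acceptProb {C : ℕ → List Gate} {input : List Bool} {m W : ℕ}
    {w : (Fin m → Bool) → ℝ} (hw : ∑ y, w y = 1) {p : ℝ} (hp0 : 0 < p) (hp1 : p ≤ 1)
    (hW : Real.pi / 2 / Real.sqrt p < 3 ^ W)
    (hC : ∀ θ, Real.sin θ ^ 2 = p → ∀ τ y,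
      acceptProb (C τ) input m y = Real.sin (3 ^ exponent W τ * θ) ^ 2 * w y)
    {L : ℕ} (hL : ∀ τ, input.length + (C τ).length + (1 + m) ≤ L * 3 ^ exponent W τ) :
    (∀ y, outputLaw C input m y = w y) ∧
    expectedOps C input m ≤ ENNReal.ofReal (L * (19 * W * (Real.pi / 2 / Real.sqrt p))) := by
  have hsq : 0 < Real.sqrt p := Real.sqrt_pos.2 hp0
  have hsq1 : Real.sqrt p ≤ 1 := Real.sqrt_le_one.2 hp1
  set θ := Real.arcsin (Real.sqrt p) with hθ
  have hsin : Real.sin θ = Real.sqrt p := Real.sin_arcsin (by linarith) hsq1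
  have hθ0 : 0 < θ := Real.arcsin_pos.2 hsq
  have hθ1 : θ ≤ Real.pi / 2 := Real.arcsin_le_pi_div_two _
  obtain ⟨k₀, hk1, hk2⟩ := exists_pow_three_mul_mem hθ0 hθ1
  have hpow : (3 : ℝ) ^ k₀ ≤ Real.pi / 2 / Real.sqrt p := by
    rw [le_div_iff₀ hsq, ← hsin]
    exact (mul_le_mul_of_nonneg_left (Real.sin_le hθ0.le) (by positivity)).trans hk2
  have hkW : k₀ < W := (pow_lt_pow_iff_right₀ (by norm_num : (1 : ℝ) < 3)).1 (hpow.trans_lt hW)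
  have hacc := hC θ (by rw [hsin, Real.sq_sqrt hp0.le])
  set S : ℕ → ℝ := fun τ => Real.sin (3 ^ exponent W τ * θ) ^ 2 with hSdef
  have hS0 : ∀ τ, 0 ≤ S τ := fun τ => sq_nonneg _
  have hS1 : ∀ τ, S τ ≤ 1 := fun τ => Real.sin_sq_le_one _
  have hgood : ∀ τ, exponent W τ = k₀ → 1 / 4 ≤ S τ := by
    intro τ hτ
    have h : Real.sin (Real.pi / 6) ≤ Real.sin (3 ^ k₀ * θ) :=
      Real.sin_le_sin_of_le_of_le_pi_div_two (by linarith [Real.pi_pos]) hk2 hk1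
    rw [Real.sin_pi_div_six] at h
    simp only [hSdef, hτ]
    nlinarith
  have hreach : ∀ τ, reachProb C input m τ = reach S τ := by
    intro τ
    rw [reachProb, reach]
    refine Finset.prod_congr rfl fun σ _ => ?_
    simp only [hacc, ← Finset.mul_sum, hw, mul_one, hSdef]
  refine ⟨fun y => ?_, ?_⟩
  · have h := (hasSum_reach_mul hS0 hS1 hkW hgood).mul_right (w y)
    rw [one_mul] at h
    rw [outputLaw, ← h.tsum_eq]
    refine tsum_congr fun τ => ?_
    rw [hreach, hacc, mul_assoc]
  · rw [expectedOps]
    refine ENNReal.tsum_le_of_sum_range_le fun n => ?_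
    have hterm : ∀ τ, ENNReal.ofReal (reachProb C input m τ) *
        ((input.length + (C τ).length + (1 + m) : ℕ) : ENNReal) ≤
        ENNReal.ofReal (L * (reach S τ * 3 ^ exponent W τ)) := by
      intro τ
      rw [hreach, ← ENNReal.ofReal_natCast, ← ENNReal.ofReal_mul (reach_nonneg hS1 τ)]
      refine ENNReal.ofReal_le_ofReal ?_
      have h : ((input.length + (C τ).length + (1 + m) : ℕ) : ℝ) ≤
          ((L * 3 ^ exponent W τ : ℕ) : ℝ) := by exact_mod_cast hL τ
      calc reach S τ * _ ≤ reach S τ * ((L * 3 ^ exponent W τ : ℕ) : ℝ) :=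
            mul_le_mul_of_nonneg_left h (reach_nonneg hS1 τ)
        _ = _ := by push_cast; ring
    refine (Finset.sum_le_sum fun τ _ => hterm τ).trans ?_
    rw [← ENNReal.ofReal_sum_of_nonneg fun τ _ =>
      mul_nonneg (Nat.cast_nonneg L) (mul_nonneg (reach_nonneg hS1 τ) (by positivity))]
    refine ENNReal.ofReal_le_ofReal ?_
    rw [← Finset.mul_sum]
    refine mul_le_mul_of_nonneg_left ?_ (Nat.cast_nonneg L)
    refine (sum_reach_mul_pow_le hS0 hS1 hkW hgood n).trans ?_
    gcongr

/-! ### Computability of the circuits -/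

section Primrec

variable {α : Type*} [Primcodable α]

theorem primrec_add {f g : α → ℕ} (hf : Primrec f) (hg : Primrec g) :
    Primrec fun a => f a + g a := Primrec.nat_add.comp hf hg

theorem primrec_sub {f g : α → ℕ} (hf : Primrec f) (hg : Primrec g) :
    Primrec fun a => f a - g a := Primrec.nat_sub.comp hf hg

theorem primrec_mul {f g : α → ℕ} (hf : Primrec f) (hg : Primrec g) :
    Primrec fun a => f a * g a := Primrec.nat_mul.comp hf hg

theorem primrec_div {f g : α → ℕ} (hf : Primrec f) (hg : Primrec g) :
    Primrec fun a => f a / g a := Primrec.nat_div.comp hf hg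

theorem primrec_mod {f g : α → ℕ} (hf : Primrec f) (hg : Primrec g) :
    Primrec fun a => f a % g a := Primrec.nat_mod.comp hf hg

theorem primrec_pow {f g : α → ℕ} (hf : Primrec f) (hg : Primrec g) :
    Primrec fun a => f a ^ g a :=
  (Primrec₂.unpaired'.1 Nat.Primrec.pow).comp hf hg

theorem primrec_cons {β : Type*} [Primcodable β] {f : α → β} {g : α → List β} (hf : Primrec f)
    (hg : Primrec g) : Primrec fun a => f a :: g a := Primrec.list_cons.comp hf hg

theorem primrec_append {β : Type*} [Primcodable β] {f g : α → List β} (hf : Primrec f)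
    (hg : Primrec g) : Primrec fun a => f a ++ g a := Primrec.list_append.comp hf hg

theorem primrec_ite_lt {β : Type*} [Primcodable β] {f g : α → ℕ} {u v : α → β} (hf : Primrec f)
    (hg : Primrec g) (hu : Primrec u) (hv : Primrec v) :
    Primrec fun a => if f a < g a then u a else v a :=
  Primrec.ite (Primrec.nat_lt.comp hf hg) hu hv

theorem primrec_ite_le {β : Type*} [Primcodable β] {f g : α → ℕ} {u v : α → β} (hf : Primrec f)
    (hg : Primrec g) (hu : Primrec u) (hv : Primrec v) :
    Primrec fun a => if f a ≤ g a then u a else v a :=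
  Primrec.ite (Primrec.nat_le.comp hf hg) hu hv

theorem primrec_ite_eq {β : Type*} [Primcodable β] {f g : α → ℕ} {u v : α → β} (hf : Primrec f)
    (hg : Primrec g) (hu : Primrec u) (hv : Primrec v) :
    Primrec fun a => if f a = g a then u a else v a :=
  Primrec.ite (Primrec.eq.comp hf hg) hu hv

theorem primrec_ite_testBit {β : Type*} [Primcodable β] {f g : α → ℕ} {u v : α → β}
    (hf : Primrec f) (hg : Primrec g) (hu : Primrec u) (hv : Primrec v) :
    Primrec fun a => if (f a).testBit (g a) then u a else v a := by
  refine (primrec_ite_eq (primrec_mod (primrec_div hf (primrec_pow (Primrec.const 2) hg))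
    (Primrec.const 2)) (Primrec.const 1) hu hv).of_eq fun a => ?_
  rw [Nat.testBit_eq_decide_div_mod_eq]
  simp

theorem primrec_cells {base T : α → ℕ} {body : α → ℕ → List (ℕ × ℕ)} (hbase : Primrec base)
    (hT : Primrec T) (hbody : Primrec₂ body) :
    Primrec fun a => cells (base a) (T a) (body a) := by
  refine Primrec.list_flatMap (Primrec.list_range.comp hT) (Primrec.list_map hbody ?_)
  exact ((Primrec.fst.comp Primrec.snd).pair ((Primrec.snd.comp Primrec.snd).pair
    (primrec_add (hbase.comp (Primrec.fst.comp Primrec.fst))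
      (Primrec.snd.comp Primrec.fst)))).to₂

theorem primrec_copies {dst n : α → ℕ} {src : α → ℕ → ℕ} (hdst : Primrec dst)
    (hn : Primrec n) (hsrc : Primrec₂ src) :
    Primrec fun a => copies (dst a) (n a) (src a) := by
  refine Primrec.list_flatMap (Primrec.list_range.comp hn) ?_
  refine Primrec.list_map (f := fun p : α × ℕ => [(src p.1 p.2, src p.1 p.2)])
    (primrec_cons (Primrec.pair (f := fun p : α × ℕ => src p.1 p.2) hsrc hsrc)
      (Primrec.const [])) ?_
  exact ((Primrec.fst.comp Primrec.snd).pair ((Primrec.snd.comp Primrec.snd).pair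
    (primrec_add (hdst.comp (Primrec.fst.comp Primrec.fst))
      (Primrec.snd.comp Primrec.fst)))).to₂

theorem primrec_anyBody {wz ubase base i : α → ℕ} (hwz : Primrec wz) (hu : Primrec ubase)
    (hbase : Primrec base) (hi : Primrec i) :
    Primrec fun a => anyBody (wz a) (ubase a) (base a) (i a) := by
  have hprev : Primrec fun a => if i a = 0 then wz a else base a + i a - 1 :=
    primrec_ite_eq hi (Primrec.const 0) hwz
      (primrec_sub (primrec_add hbase hi) (Primrec.const 1))
  have hui := primrec_add hu hi
  exact primrec_cons (hui.pair hui) (primrec_cons (hprev.pair hprev)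
    (primrec_cons (hui.pair hprev) (Primrec.const [])))

theorem primrec_samplerBody {wz one base abase astride ubase B R i : α → ℕ} {c : α → ℕ → ℕ}
    (hwz : Primrec wz) (hone : Primrec one) (hbase : Primrec base) (habase : Primrec abase)
    (hastride : Primrec astride) (hubase : Primrec ubase) (hB : Primrec B) (hR : Primrec R)
    (hc : Primrec₂ c) (hi : Primrec i) :
    Primrec fun a => samplerBody (wz a) (one a) (base a) (abase a) (astride a) (ubase a) (B a)
      (R a) (c a) (i a) := by
  have hR2 := primrec_add hR (Primrec.const 2)
  have hr := primrec_div hi hR2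
  have hk := primrec_mod hi hR2
  have hprev := primrec_ite_eq hk (Primrec.const 0) hwz
      (primrec_sub (primrec_add hbase hi) (Primrec.const 1))
  have hu := primrec_add hubase (primrec_add (primrec_mul hr hR) hk)
  have ha := primrec_add habase (primrec_mul hastride hr)
  have hrB := primrec_mod hr hB
  have hcr : Primrec fun a => c a (i a / (R a + 2) % B a) := hc.comp Primrec.id hrB
  have hnil : Primrec fun _ : α => ([] : List (ℕ × ℕ)) := Primrec.const []
  exact primrec_ite_lt hk hR
    (primrec_ite_testBit hcr hk
      (primrec_cons (hone.pair hone) (primrec_cons (hu.pair hu) (primrec_cons (hu.pair hprev) hnil)))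
      (primrec_cons (hprev.pair hprev) (primrec_cons (hu.pair hprev) hnil)))
    (primrec_ite_eq hk hR
      (primrec_cons (ha.pair ha) (primrec_cons (hprev.pair hprev)
        (primrec_cons (ha.pair hprev) hnil)))
      (primrec_cons ((primrec_ite_eq hrB (Primrec.const 0) hone
        (primrec_sub (primrec_add hbase hi) hR2)).pair hprev) hnil))

theorem primrec_adderBody {wz gbase base B nneg i : α → ℕ} (hwz : Primrec wz)
    (hgbase : Primrec gbase) (hbase : Primrec base) (hB : Primrec B) (hnneg : Primrec nneg)
    (hi : Primrec i) :
    Primrec fun a => adderBody (wz a) (gbase a) (base a) (B a) (nneg a) (i a) := by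
  have h3 : Primrec fun _ : α => 3 := Primrec.const 3
  have hr := primrec_div hi h3
  have hq := primrec_div hr hB
  have hg := primrec_add hgbase hq
  have ha := primrec_add hbase (primrec_mul hr h3)
  have hs := primrec_ite_lt hr hB hwz (primrec_add hbase
    (primrec_add (primrec_mul (primrec_sub hr hB) h3) (Primrec.const 1)))
  have hcin := primrec_ite_eq (primrec_mod hr hB) (Primrec.const 0) hwz (primrec_add hbase
    (primrec_add (primrec_mul (primrec_sub hr (Primrec.const 1)) h3) (Primrec.const 2)))
  have hnil : Primrec fun _ : α => ([] : List (ℕ × ℕ)) := Primrec.const []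
  exact primrec_ite_eq (primrec_mod hi h3) (Primrec.const 0)
    (primrec_cons (hg.pair hr) (primrec_ite_le hnneg hq (primrec_cons (hg.pair hg) hnil) hnil))
    (primrec_ite_eq (primrec_mod hi h3) (Primrec.const 1)
      (primrec_cons (ha.pair ha) (primrec_cons (hs.pair hs) (primrec_cons (hcin.pair hcin) hnil)))
      (primrec_cons (ha.pair hs) (primrec_cons (ha.pair hcin) (primrec_cons (hs.pair hcin) hnil))))

theorem primrec_squares {R q i : α → ℕ} (hR : Primrec R) (hq : Primrec q) (hi : Primrec i) :
    Primrec fun a => squares (R a) (q a) (i a) := by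
  have h2 : Primrec fun _ : α => 2 := Primrec.const 2
  refine (Primrec.nat_rec' (h := fun a p => p.2 * p.2 / 2 ^ R a) hi
    (primrec_sub (primrec_pow h2 hR) (primrec_pow h2 (primrec_sub hR hq))) ?_).of_eq fun a => ?_
  · exact (primrec_div (primrec_mul (Primrec.snd.comp Primrec.snd) (Primrec.snd.comp Primrec.snd))
      (primrec_pow (Primrec.const 2) (hR.comp Primrec.fst))).to₂
  · induction i a with
    | zero => rfl
    | succ n ih =>
      rw [squares, ← ih]

end Primrec

namespace Gate

theorem primrec_X : Primrec Gate.X :=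
  (Primrec.of_equiv_symm (e := equivSum)).comp Primrec.sumInl

theorem primrec_H : Primrec Gate.H :=
  (Primrec.of_equiv_symm (e := equivSum)).comp (Primrec.sumInr.comp Primrec.sumInl)

theorem primrec_T : Primrec Gate.T :=
  (Primrec.of_equiv_symm (e := equivSum)).comp
    (Primrec.sumInr.comp (Primrec.sumInr.comp Primrec.sumInl))

theorem primrec_CCX : Primrec fun g : ℕ × ℕ × ℕ => Gate.CCX g.1 g.2.1 g.2.2 :=
  (Primrec.of_equiv_symm (e := equivSum)).comp
    (Primrec.sumInr.comp (Primrec.sumInr.comp (Primrec.sumInr.comp Primrec.sumInr)))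

end Gate

theorem primrec_toffolis : Primrec toffolis :=
  Primrec.list_map Primrec.id (Gate.primrec_CCX.comp Primrec.snd).to₂

theorem primrec_hadamards : Primrec hadamards :=
  Primrec.list_map Primrec.id (Gate.primrec_H.comp Primrec.snd).to₂

section Primrec

variable {α : Type*} [Primcodable α]

theorem primrec_phaseOracle {gs : α → List (ℕ × ℕ × ℕ)} {f : α → ℕ} (hgs : Primrec gs)
    (hf : Primrec f) : Primrec fun a => phaseOracle (gs a) (f a) := by
  have hT := Gate.primrec_T.comp hf
  exact primrec_append (primrec_toffolis.comp hgs) (primrec_append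
    (primrec_cons hT (primrec_cons hT (primrec_cons hT (primrec_cons hT (Primrec.const [])))))
    (primrec_toffolis.comp (Primrec.list_reverse.comp hgs)))

theorem primrec_groverCircuit {V V₀ : α → List (ℕ × ℕ × ℕ)} {f nz one K : α → ℕ}
    {us : α → List ℕ} (hV : Primrec V) (hf : Primrec f) (hV₀ : Primrec V₀) (hnz : Primrec nz)
    (hus : Primrec us) (hone : Primrec one) (hK : Primrec K) :
    Primrec fun a => groverCircuit (V a) (f a) (V₀ a) (nz a) (us a) (one a) (K a) := by
  have hrev := primrec_hadamards.comp (Primrec.list_reverse.comp hus)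
  have hiter : Primrec fun a => groverIteration (V a) (f a) (V₀ a) (nz a) (us a) :=
    primrec_append (primrec_phaseOracle hV hf) (primrec_append (primrec_hadamards.comp hus)
      (primrec_append (primrec_phaseOracle hV₀ hnz) hrev))
  exact primrec_cons (Gate.primrec_X.comp hone) (primrec_append hrev (primrec_append
    (Primrec.list_flatMap (Primrec.list_range.comp hK) (hiter.comp Primrec.fst).to₂)
    (primrec_toffolis.comp hV)))

theorem primrec_exponent {W τ : α → ℕ} (hW : Primrec W) (hτ : Primrec τ) :
    Primrec fun a => exponent (W a) (τ a) :=
  Primrec.nat_min.comp (primrec_mod hτ hW) (primrec_div (primrec_div hτ hW) (Primrec.const 5))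

end Primrec

namespace Shape

theorem primrec_visible : Primrec fun s : Shape => s.1 := Primrec.fst

theorem primrec_hidden : Primrec fun s : Shape => s.2.1 := Primrec.fst.comp Primrec.snd

theorem primrec_edges : Primrec fun s : Shape => s.2.2.1 :=
  Primrec.fst.comp (Primrec.snd.comp Primrec.snd)

theorem primrec_size : Primrec fun s : Shape => s.2.2.2 :=
  Primrec.snd.comp (Primrec.snd.comp Primrec.snd)

theorem primrec_prec : Primrec prec := primrec_mul (Primrec.const 20) primrec_size

theorem primrec_bits : Primrec bits := primrec_mul (Primrec.const 2) primrec_prec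

theorem primrec_rand : Primrec rand := primrec_mul (Primrec.const 6) primrec_prec

theorem primrec_units : Primrec units := primrec_add primrec_visible primrec_hidden

theorem primrec_params : Primrec params :=
  primrec_add primrec_units (Primrec.list_length.comp primrec_edges)

theorem primrec_terms : Primrec terms :=
  primrec_add primrec_params (primrec_add (primrec_add primrec_hidden primrec_hidden)
    (Primrec.const 2))

theorem primrec_inputLen : Primrec inputLen :=
  primrec_add (primrec_mul primrec_terms primrec_bits) primrec_visible

theorem primrec_zeroWire : Primrec zeroWire :=
  primrec_add (primrec_add primrec_inputLen primrec_hidden) (Primrec.const 1)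

theorem primrec_oneWire : Primrec oneWire :=
  primrec_add (primrec_add primrec_inputLen primrec_hidden) (Primrec.const 2)

theorem primrec_searchBase : Primrec searchBase :=
  primrec_add (primrec_add primrec_inputLen primrec_hidden) (Primrec.const 3)

theorem primrec_searchSize : Primrec searchSize :=
  primrec_mul (primrec_mul (primrec_add primrec_hidden (Primrec.const 1)) primrec_bits) primrec_rand

theorem primrec_unitBase : Primrec unitBase := primrec_add primrec_searchBase primrec_searchSize

theorem primrec_unitCells : Primrec fun s : Shape => s.2.1 * s.bits * (s.rand + 2) :=
  primrec_mul (primrec_mul primrec_hidden primrec_bits) (primrec_add primrec_rand (Primrec.const 2))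

theorem primrec_gateBase : Primrec gateBase := primrec_add primrec_unitBase primrec_unitCells

theorem primrec_adderBase : Primrec adderBase := primrec_add primrec_gateBase primrec_terms

theorem primrec_adderCells : Primrec fun s : Shape => s.terms * s.bits * 3 :=
  primrec_mul (primrec_mul primrec_terms primrec_bits) (Primrec.const 3)

theorem primrec_acceptBase : Primrec acceptBase :=
  primrec_add primrec_adderBase primrec_adderCells

theorem primrec_sampleWire : Primrec₂ sampleWire := by
  have hb := primrec_bits.comp (Primrec.fst (α := Shape) (β := ℕ))
  have hR := primrec_rand.comp (Primrec.fst (α := Shape) (β := ℕ))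
  exact primrec_add (primrec_unitBase.comp Primrec.fst) (primrec_add
    (primrec_mul (primrec_add (primrec_mul Primrec.snd hb) (primrec_sub hb (Primrec.const 1)))
      (primrec_add hR (Primrec.const 2))) (primrec_add hR (Primrec.const 1)))

theorem primrec_acceptWire : Primrec acceptWire :=
  primrec_add primrec_acceptBase (primrec_add
    (primrec_mul (primrec_add (primrec_mul (Primrec.const 0) primrec_bits)
        (primrec_sub primrec_bits (Primrec.const 1)))
      (primrec_add primrec_rand (Primrec.const 2))) (primrec_add primrec_rand (Primrec.const 1)))

theorem primrec_unitWire : Primrec₂ unitWire := by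
  have hv := primrec_visible.comp (Primrec.fst (α := Shape) (β := ℕ))
  exact primrec_ite_lt Primrec.snd hv
    (primrec_add ((primrec_mul primrec_terms primrec_bits).comp Primrec.fst) Primrec.snd)
    (primrec_sampleWire.comp Primrec.fst (primrec_sub Primrec.snd hv))

theorem primrec_gateBody : Primrec₂ gateBody := by
  have hn := primrec_units.comp (Primrec.fst (α := Shape) (β := ℕ))
  have hp := primrec_params.comp (Primrec.fst (α := Shape) (β := ℕ))
  have hh := primrec_hidden.comp (Primrec.fst (α := Shape) (β := ℕ))
  have ho := primrec_oneWire.comp (Primrec.fst (α := Shape) (β := ℕ))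
  have hq : Primrec (Prod.snd : Shape × ℕ → ℕ) := Primrec.snd
  have he := (Primrec.list_getD ((0, 0) : ℕ × ℕ)).comp
    (primrec_edges.comp (Primrec.fst (α := Shape) (β := ℕ))) (primrec_sub hq hn)
  have hnil : Primrec fun _ : Shape × ℕ => ([] : List (ℕ × ℕ)) := Primrec.const []
  have h1 := primrec_unitWire.comp Primrec.fst hq
  have h2 := primrec_unitWire.comp (Primrec.fst (α := Shape) (β := ℕ)) (Primrec.fst.comp he)
  have h3 := primrec_unitWire.comp (Primrec.fst (α := Shape) (β := ℕ)) (Primrec.snd.comp he)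
  have h4 := primrec_sampleWire.comp Primrec.fst (primrec_sub hq hp)
  have h5 := primrec_sampleWire.comp Primrec.fst (primrec_sub (primrec_sub hq hp) hh)
  exact primrec_ite_lt hq hn (primrec_cons (h1.pair h1) hnil)
    (primrec_ite_lt hq hp (primrec_cons (h2.pair h3) hnil)
    (primrec_ite_lt hq (primrec_add hp hh) (primrec_cons (h4.pair h4) hnil)
    (primrec_ite_lt hq (primrec_add (primrec_add hp hh) hh)
      (primrec_cons (ho.pair ho) (primrec_cons (h5.pair h5) hnil))
      (primrec_cons (ho.pair ho) hnil))))

theorem primrec_threshold : Primrec₂ threshold := by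
  have hp := primrec_prec.comp (Primrec.fst (α := Shape) (β := ℕ))
  exact primrec_squares (primrec_rand.comp Primrec.fst) (primrec_mul (Primrec.const 3) hp)
    (primrec_add Primrec.snd (primrec_mul (Primrec.const 2) hp))

theorem primrec_unitBody : Primrec₂ fun (s : Shape) i =>
    samplerBody s.zeroWire s.oneWire s.unitBase (s.params * s.bits) 1 s.searchBase s.bits s.rand
      s.threshold i := by
  have hthr : Primrec₂ fun (p : Shape × ℕ) j => p.1.threshold j :=
    primrec_threshold.comp (Primrec.fst.comp Primrec.fst) Primrec.snd
  have h := primrec_samplerBody (α := Shape × ℕ) (primrec_zeroWire.comp Primrec.fst)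
    (primrec_oneWire.comp Primrec.fst) (primrec_unitBase.comp Primrec.fst)
    ((primrec_mul primrec_params primrec_bits).comp Primrec.fst) (Primrec.const 1)
    (primrec_searchBase.comp Primrec.fst) (primrec_bits.comp Primrec.fst)
    (primrec_rand.comp Primrec.fst) hthr Primrec.snd
  exact h

theorem primrec_sumBody : Primrec₂ fun (s : Shape) i =>
    adderBody s.zeroWire s.gateBase s.adderBase s.bits s.params i := by
  have h := primrec_adderBody (α := Shape × ℕ) (primrec_zeroWire.comp Primrec.fst)
    (primrec_gateBase.comp Primrec.fst) (primrec_adderBase.comp Primrec.fst)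
    (primrec_bits.comp Primrec.fst) (primrec_params.comp Primrec.fst) Primrec.snd
  exact h

theorem primrec_acceptBody : Primrec₂ fun (s : Shape) i =>
    samplerBody s.zeroWire s.oneWire s.acceptBase
      (s.adderBase + ((s.terms - 1) * s.bits * 3 + 1)) 3
      (s.searchBase + s.2.1 * s.bits * s.rand) s.bits s.rand s.threshold i := by
  have hthr : Primrec₂ fun (p : Shape × ℕ) j => p.1.threshold j :=
    primrec_threshold.comp (Primrec.fst.comp Primrec.fst) Primrec.snd
  have h := primrec_samplerBody (α := Shape × ℕ) (primrec_zeroWire.comp Primrec.fst)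
    (primrec_oneWire.comp Primrec.fst) (primrec_acceptBase.comp Primrec.fst)
    ((primrec_add primrec_adderBase (primrec_add (primrec_mul (primrec_mul
        (primrec_sub primrec_terms (Primrec.const 1)) primrec_bits) (Primrec.const 3))
        (Primrec.const 1))).comp Primrec.fst) (Primrec.const 3)
    ((primrec_add primrec_searchBase (primrec_mul (primrec_mul primrec_hidden primrec_bits)
        primrec_rand)).comp Primrec.fst) (primrec_bits.comp Primrec.fst)
    (primrec_rand.comp Primrec.fst) hthr Primrec.snd
  exact h

theorem primrec_resultWire : Primrec₂ fun (s : Shape) i =>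
    if i = 0 then s.acceptWire else s.sampleWire (i - 1) := by
  have h := primrec_ite_eq (α := Shape × ℕ) Primrec.snd (Primrec.const 0)
    (primrec_acceptWire.comp Primrec.fst)
    (primrec_sampleWire.comp Primrec.fst (primrec_sub Primrec.snd (Primrec.const 1)))
  exact h

theorem primrec_acceptCircuit : Primrec acceptCircuit :=
  primrec_append (primrec_cells primrec_unitBase primrec_unitCells primrec_unitBody)
    (primrec_append (primrec_cells primrec_gateBase primrec_terms primrec_gateBody)
    (primrec_append (primrec_cells primrec_adderBase primrec_adderCells primrec_sumBody)
    (primrec_append (primrec_cells primrec_acceptBase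
      (primrec_mul primrec_bits (primrec_add primrec_rand (Primrec.const 2))) primrec_acceptBody)
    (primrec_copies primrec_inputLen (primrec_add primrec_hidden (Primrec.const 1))
      primrec_resultWire))))

theorem primrec_anyCircuit : Primrec anyCircuit :=
  primrec_cells primrec_unitBase primrec_searchSize
    (primrec_anyBody (primrec_zeroWire.comp Primrec.fst) (primrec_searchBase.comp Primrec.fst)
      (primrec_unitBase.comp Primrec.fst) Primrec.snd)

theorem primrec_searchQubits : Primrec searchQubits :=
  Primrec.list_map (Primrec.list_range.comp primrec_searchSize)
    (primrec_add (primrec_searchBase.comp Primrec.fst) Primrec.snd)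

theorem primrec_round : Primrec₂ round := by
  have h := primrec_groverCircuit (α := Shape × ℕ) (primrec_acceptCircuit.comp Primrec.fst)
    (primrec_inputLen.comp Primrec.fst) (primrec_anyCircuit.comp Primrec.fst)
    ((primrec_add primrec_unitBase
      (primrec_sub primrec_searchSize (Primrec.const 1))).comp Primrec.fst)
    (primrec_searchQubits.comp Primrec.fst) (primrec_oneWire.comp Primrec.fst)
    (primrec_div (primrec_sub (primrec_pow (Primrec.const 3) Primrec.snd) (Primrec.const 1))
      (Primrec.const 2))
  exact h

/-- The rounds of a run: the exponents follow the schedule with blocks of length `ℓ + 2`. -/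
def run (s : Shape) (τ : ℕ) : List Gate := s.round (exponent (s.2.2.2 + 2) τ)

theorem primrec_run : Primrec₂ run :=
  primrec_round.comp Primrec.fst (primrec_exponent
    (primrec_add (primrec_size.comp Primrec.fst) (Primrec.const 2)) Primrec.snd)

/-- The shape in which all units are sampled. -/
def allHidden (s : Shape) : Shape := (0, s.1 + s.2.1, s.2.2.1, s.2.2.2)

theorem primrec_allHidden : Primrec allHidden :=
  (Primrec.const 0).pair ((primrec_add primrec_visible primrec_hidden).pair
    (primrec_edges.pair primrec_size))

end Shape

/-- The algorithm: clamped runs use the given shape, and runs for the model the shape in which all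
units are sampled. -/
def boltzmannSampler : SamplingAlgorithm where
  model s τ := s.allHidden.run τ
  data s τ := s.run τ
  computable_model := (Shape.primrec_run.comp (Shape.primrec_allHidden.comp Primrec.fst)
    Primrec.snd).to_comp.to₂
  computable_data := Shape.primrec_run.to_comp
  prec := 20

/-! ### Accuracy of the exponential probabilities -/

theorem abs_exp_sub_exp_le {a b : ℝ} (ha : a ≤ 0) (hb : b ≤ 0) :
    |Real.exp a - Real.exp b| ≤ |a - b| := by
  wlog h : a ≤ b generalizing a b
  · rw [abs_sub_comm, abs_sub_comm a]
    exact this hb ha (le_of_not_ge h)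
  rw [abs_sub_comm, abs_sub_comm a, abs_of_nonneg (sub_nonneg.2 (Real.exp_le_exp.2 h)),
    abs_of_nonneg (sub_nonneg.2 h)]
  have h1 : Real.exp a = Real.exp b * Real.exp (a - b) := by rw [← Real.exp_add]; ring_nf
  have h2 := Real.add_one_le_exp (a - b)
  have h3 : Real.exp b ≤ 1 := Real.exp_le_one_iff.2 hb
  nlinarith [Real.exp_pos b]

/-- The entries approximate the exponentials from below. A squaring at most doubles the error and
adds a rounding error of at most `2^{-R}`; the term `1 / 2^R` on the left absorbs the latter. -/
theorem squares_div_le (R q : ℕ) (hq : q ≤ R) (i : ℕ) :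
    (squares R q i : ℝ) / 2 ^ R ≤ Real.exp (-(2 ^ i / 2 ^ q)) ∧
      Real.exp (-(2 ^ i / 2 ^ q)) - (squares R q i : ℝ) / 2 ^ R + 1 / 2 ^ R ≤
        2 ^ i * (1 / 4 ^ q + 1 / 2 ^ R) := by
  have hR : (0 : ℝ) < 2 ^ R := by positivity
  induction i with
  | zero =>
    have h0 : (squares R q 0 : ℝ) / 2 ^ R = 1 - 1 / 2 ^ q := by
      rw [squares, Nat.cast_sub (Nat.pow_le_pow_right (by norm_num) (Nat.sub_le _ _))]
      push_cast
      rw [pow_sub₀ (2 : ℝ) (by norm_num) hq]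
      field_simp
    rw [h0, pow_zero]
    have hx : (1 : ℝ) / 2 ^ q ≤ 1 := by
      rw [div_le_one (by positivity)]
      exact one_le_pow₀ (by norm_num)
    have hx0 : (0 : ℝ) < 1 / 2 ^ q := by positivity
    have h1 := Real.add_one_le_exp (-(1 / 2 ^ q : ℝ))
    have h2 := (abs_le.1 (Real.abs_exp_sub_one_sub_id_le (x := -(1 / 2 ^ q : ℝ))
      (by rw [abs_neg, abs_of_pos hx0]; exact hx))).2
    have h3 : (-(1 / 2 ^ q) : ℝ) ^ 2 = 1 / 4 ^ q := by
      rw [neg_sq, div_pow, one_pow, ← pow_mul, mul_comm q, pow_mul]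
      norm_num
    rw [h3] at h2
    constructor <;> linarith
  | succ i ih =>
    set e := Real.exp (-(2 ^ i / 2 ^ q)) with he
    set d := (squares R q i : ℝ) / 2 ^ R with hd
    have he' : Real.exp (-(2 ^ (i + 1) / 2 ^ q)) = e * e := by
      rw [he, ← Real.exp_add]
      congr 1
      ring
    have hd0 : 0 ≤ d := by positivity
    have he1 : e ≤ 1 := by
      rw [he, Real.exp_le_one_iff, neg_nonpos]
      positivity
    have hle : (squares R q (i + 1) : ℝ) / 2 ^ R ≤ d * d := by
      rw [squares]
      have h := @Nat.cast_div_le ℝ _ _ _ (squares R q i * squares R q i) (2 ^ R)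
      push_cast at h
      calc _ ≤ ((squares R q i : ℝ) * squares R q i / 2 ^ R) / 2 ^ R := by gcongr
        _ = d * d := by rw [hd]; ring
    have hge : d * d ≤ (squares R q (i + 1) : ℝ) / 2 ^ R + 1 / 2 ^ R := by
      rw [squares, ← add_div, hd, div_mul_div_comm, ← div_div]
      gcongr
      rw [div_le_iff₀ hR]
      exact_mod_cast (Nat.lt_mul_of_div_lt (Nat.lt_succ_self _) (by positivity)).le
    rw [he']
    obtain ⟨ih1, ih2⟩ := ih
    refine ⟨hle.trans (mul_self_le_mul_self hd0 ih1), ?_⟩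
    have hpos : (0 : ℝ) ≤ 1 / 2 ^ R := by positivity
    have h1 : e * e - d * d ≤ 2 * (e - d) := by nlinarith
    rw [pow_succ]
    linarith

theorem abs_prod_sub_prod_le {ι : Type*} (s : Finset ι) (f g : ι → ℝ)
    (hf : ∀ i ∈ s, |f i| ≤ 1) (hg : ∀ i ∈ s, |g i| ≤ 1) :
    |∏ i ∈ s, f i - ∏ i ∈ s, g i| ≤ ∑ i ∈ s, |f i - g i| := by
  classical
  induction s using Finset.induction_on with
  | empty => simp
  | insert i s hi ih =>
    rw [Finset.prod_insert hi, Finset.prod_insert hi, Finset.sum_insert hi]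
    have h1 := ih (fun j hj => hf j (Finset.mem_insert_of_mem hj))
      (fun j hj => hg j (Finset.mem_insert_of_mem hj))
    have h2 : |∏ j ∈ s, f j| ≤ 1 := by
      rw [Finset.abs_prod]
      exact Finset.prod_le_one (fun _ _ => abs_nonneg _)
        fun j hj => hf j (Finset.mem_insert_of_mem hj)
    have h3 := hg i (Finset.mem_insert_self _ _)
    have h4 : f i * ∏ j ∈ s, f j - g i * ∏ j ∈ s, g j =
        (f i - g i) * ∏ j ∈ s, f j + g i * (∏ j ∈ s, f j - ∏ j ∈ s, g j) := by ring
    rw [h4]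
    refine (abs_add_le _ _).trans (add_le_add ?_ ?_)
    · rw [abs_mul]
      exact mul_le_of_le_one_right (abs_nonneg _) h2
    · rw [abs_mul]
      exact (mul_le_of_le_one_left (abs_nonneg _) h3).trans h1

theorem sum_testBit_mul_two_pow (B x : ℕ) (hx : x < 2 ^ B) :
    ∑ j ∈ Finset.range B, (if x.testBit j then (2 : ℝ) ^ j else 0) = x := by
  have h : ∀ B, ∑ j ∈ Finset.range B, (if x.testBit j then 2 ^ j else 0) = x % 2 ^ B := by
    intro B
    induction B with
    | zero => simp [Nat.mod_one]
    | succ B ih =>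
      rw [Finset.sum_range_succ, ih, Nat.mod_pow_succ, ← Nat.toNat_testBit]
      cases x.testBit B <;> simp
  have := h B
  rw [Nat.mod_eq_of_lt hx] at this
  exact_mod_cast this

namespace Shape

theorem abs_threshold_sub_exp_le (s : Shape) {j : ℕ} (hj : j < s.bits) :
    |(s.threshold j : ℝ) / 2 ^ s.rand - Real.exp (-(2 ^ j / 2 ^ s.prec))| ≤ 1 / 4 ^ s.prec := by
  have h := squares_div_le s.rand (3 * s.prec) (by unfold rand; omega) (j + 2 * s.prec)
  have h1 : (2 : ℝ) ^ (j + 2 * s.prec) / 2 ^ (3 * s.prec) = 2 ^ j / 2 ^ s.prec := by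
    rw [show 3 * s.prec = s.prec + 2 * s.prec by ring, pow_add, pow_add]
    field_simp
  rw [h1] at h
  rw [threshold, abs_sub_comm, abs_of_nonneg (by linarith [h.1])]
  have h2 : (2 : ℝ) ^ (j + 2 * s.prec) * (1 / 4 ^ (3 * s.prec) + 1 / 2 ^ s.rand) ≤
      1 / 4 ^ s.prec := by
    have e1 : (4 : ℝ) ^ (3 * s.prec) = 2 ^ (6 * s.prec) := by
      rw [show (4 : ℝ) = 2 ^ 2 by norm_num, ← pow_mul]; ring_nf
    have e2 : (4 : ℝ) ^ s.prec = 2 ^ (2 * s.prec) := by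
      rw [show (4 : ℝ) = 2 ^ 2 by norm_num, ← pow_mul]
    have e3 : (2 : ℝ) ^ (j + 2 * s.prec) * 2 ≤ 2 ^ (4 * s.prec) := by
      rw [← pow_succ]
      exact pow_le_pow_right₀ (by norm_num) (by unfold bits at hj; omega)
    have e4 : (2 : ℝ) ^ (6 * s.prec) = 2 ^ (4 * s.prec) * 2 ^ (2 * s.prec) := by
      rw [← pow_add]; ring_nf
    rw [e1, rand, e2]
    calc (2 : ℝ) ^ (j + 2 * s.prec) * (1 / 2 ^ (6 * s.prec) + 1 / 2 ^ (6 * s.prec))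
        = 2 ^ (j + 2 * s.prec) * 2 / 2 ^ (6 * s.prec) := by ring
      _ ≤ 2 ^ (4 * s.prec) / 2 ^ (6 * s.prec) := by gcongr
      _ = 1 / 2 ^ (2 * s.prec) := by rw [e4]; field_simp
  have h3 : (0 : ℝ) ≤ 1 / 2 ^ s.rand := by positivity
  linarith [h.2]

theorem expProb_nonneg (B R : ℕ) (c : ℕ → ℕ) (a : ℕ → Bool) : 0 ≤ expProb B R c a :=
  Finset.prod_nonneg fun j _ => by split_ifs <;> positivity

theorem expProb_le_one {B R : ℕ} {c : ℕ → ℕ} (hc : ∀ j, c j < 2 ^ R) (a : ℕ → Bool) :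
    expProb B R c a ≤ 1 := by
  refine Finset.prod_le_one (fun j _ => by split_ifs <;> positivity) fun j _ => ?_
  split_ifs
  · exact le_rfl
  · rw [div_le_one (by positivity)]
    exact_mod_cast (hc j).le

/-- When the bits are those of a negative integer `n` that approximates `2^prec * r` from below, the
probability approximates `exp r`. The complemented bits are those of `-n - 1`, so that the
factors of the product multiply to `exp ((n + 1) / 2^prec)`. -/
theorem abs_expProb_sub_exp_le (s : Shape) {n : ℤ} (hn : n < 0) (hn' : -2 ^ s.bits ≤ n)
    {r : ℝ} (hr : r ≤ 0) {t : ℝ} (ht : 1 ≤ t) (h1 : (n : ℝ) ≤ r * 2 ^ s.prec)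
    (h2 : r * 2 ^ s.prec ≤ n + t) {a : ℕ → Bool} (ha : ∀ j < s.bits, a j = n.testBit j) :
    |expProb s.bits s.rand s.threshold a - Real.exp r| ≤ (2 + t) / 2 ^ s.prec := by
  obtain ⟨x, rfl⟩ := Int.eq_negSucc_of_lt_zero hn
  have hx : x < 2 ^ s.bits := by
    have : ((x : ℤ)) < 2 ^ s.bits := by rw [Int.negSucc_eq] at hn'; omega
    exact_mod_cast this
  have hp : (0 : ℝ) < 2 ^ s.prec := by positivity
  have e1 : Real.exp (-((x : ℝ) / 2 ^ s.prec)) =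
      ∏ j ∈ Finset.range s.bits, if a j then 1 else Real.exp (-(2 ^ j / 2 ^ s.prec)) := by
    rw [← sum_testBit_mul_two_pow _ x hx, Finset.sum_div, ← Finset.sum_neg_distrib, Real.exp_sum]
    refine Finset.prod_congr rfl fun j hj => ?_
    rw [ha j (Finset.mem_range.1 hj), Int.testBit]
    cases x.testBit j <;> simp
  have h3 : |expProb s.bits s.rand s.threshold a - Real.exp (-((x : ℝ) / 2 ^ s.prec))| ≤
      2 / 2 ^ s.prec := by
    rw [e1, expProb]
    refine (abs_prod_sub_prod_le _ _ _ ?_ ?_).trans ?_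
    · intro j _
      split_ifs
      · simp
      · rw [abs_of_nonneg (by positivity), div_le_one (by positivity)]
        exact_mod_cast (s.threshold_lt j).le
    · intro j _
      split_ifs
      · simp
      · rw [abs_of_pos (Real.exp_pos _), Real.exp_le_one_iff, neg_nonpos]
        positivity
    · calc _ ≤ ∑ _j ∈ Finset.range s.bits, (1 / 4 ^ s.prec : ℝ) := by
            refine Finset.sum_le_sum fun j hj => ?_
            split_ifs
            · simp
            · exact s.abs_threshold_sub_exp_le (Finset.mem_range.1 hj)
        _ = 2 * s.prec / 2 ^ s.prec / 2 ^ s.prec := by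
          rw [Finset.sum_const, Finset.card_range, nsmul_eq_mul, bits]
          push_cast
          rw [show (4 : ℝ) = 2 * 2 by norm_num, mul_pow]
          field_simp
        _ ≤ 2 / 2 ^ s.prec := by
          gcongr
          rw [div_le_iff₀ hp]
          have : (s.prec : ℝ) ≤ 2 ^ s.prec := by exact_mod_cast Nat.lt_two_pow_self.le
          linarith
  rw [Int.negSucc_eq] at h1 h2
  push_cast at h1 h2
  have h4 : |Real.exp (-((x : ℝ) / 2 ^ s.prec)) - Real.exp r| ≤ t / 2 ^ s.prec := by
    refine (abs_exp_sub_exp_le (by rw [neg_nonpos]; positivity) hr).trans ?_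
    have e : -((x : ℝ) / 2 ^ s.prec) - r = (-x - r * 2 ^ s.prec) / 2 ^ s.prec := by field_simp
    rw [e, abs_div, abs_of_pos hp]
    gcongr
    rw [abs_le]
    constructor <;> linarith
  calc _ ≤ _ := abs_sub_le _ (Real.exp (-((x : ℝ) / 2 ^ s.prec))) _
    _ ≤ 2 / 2 ^ s.prec + t / 2 ^ s.prec := add_le_add h3 h4
    _ = _ := by ring

end Shape

/-! ### Distances of product distributions -/

theorem sum_prod_eq_one {m : ℕ} {α : Type*} [Fintype α] [DecidableEq α] {f : Fin m → α → ℝ}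
    (hf : ∀ i, ∑ a, f i a = 1) : ∑ z : Fin m → α, ∏ i, f i (z i) = 1 := by
  rw [← Fintype.prod_sum]
  simp [hf]

/-- The `ℓ¹` distance of product distributions is at most the sum of the distances of the
factors. -/
theorem sum_abs_prod_sub_prod_le {α : Type*} [Fintype α] [DecidableEq α] :
    ∀ {m : ℕ} {f g : Fin m → α → ℝ} (_ : ∀ i a, 0 ≤ f i a) (_ : ∀ i a, 0 ≤ g i a)
      (_ : ∀ i, ∑ a, f i a = 1) (_ : ∀ i, ∑ a, g i a = 1),
      ∑ z : Fin m → α, |∏ i, f i (z i) - ∏ i, g i (z i)| ≤ ∑ i, ∑ a, |f i a - g i a|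
  | 0, f, g, _, _, _, _ => by simp
  | m + 1, f, g, hf0, hg0, hf, hg => by
    have ih := sum_abs_prod_sub_prod_le (m := m) (f := fun i => f i.succ)
      (g := fun i => g i.succ) (fun i => hf0 _) (fun i => hg0 _) (fun i => hf _) (fun i => hg _)
    rw [← (Fin.consEquiv fun _ => α).sum_comp, Fintype.sum_prod_type, Fin.sum_univ_succ]
    simp only [Fin.consEquiv_apply, Fin.prod_univ_succ, Fin.cons_zero, Fin.cons_succ]
    calc _ ≤ ∑ a, ∑ z : Fin m → α, (|f 0 a - g 0 a| * ∏ i : Fin m, f i.succ (z i) +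
          g 0 a * |∏ i : Fin m, f i.succ (z i) - ∏ i : Fin m, g i.succ (z i)|) := by
          refine Finset.sum_le_sum fun a _ => Finset.sum_le_sum fun z _ => ?_
          have h0 : 0 ≤ ∏ i : Fin m, f i.succ (z i) := Finset.prod_nonneg fun i _ => hf0 _ _
          have e : f 0 a * ∏ i : Fin m, f i.succ (z i) - g 0 a * ∏ i : Fin m, g i.succ (z i) =
            (f 0 a - g 0 a) * ∏ i : Fin m, f i.succ (z i) +
              g 0 a * (∏ i : Fin m, f i.succ (z i) - ∏ i : Fin m, g i.succ (z i)) := by ring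
          rw [e]
          refine (abs_add_le _ _).trans (le_of_eq ?_)
          rw [abs_mul, abs_mul, abs_of_nonneg h0, abs_of_nonneg (hg0 _ _)]
      _ = ∑ a, |f 0 a - g 0 a| + ∑ z : Fin m → α,
          |∏ i : Fin m, f i.succ (z i) - ∏ i : Fin m, g i.succ (z i)| := by
        simp only [Finset.sum_add_distrib, ← Finset.mul_sum, ← Finset.sum_mul, hg 0, one_mul,
          sum_prod_eq_one fun i => hf (Fin.succ i), mul_one]
      _ ≤ _ := by gcongr

theorem productDist_nonneg {m : ℕ} {μ : Fin m → ℝ} (hμ : ∀ i, μ i ∈ Set.Icc (0 : ℝ) 1)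
    (z : Fin m → Bool) : 0 ≤ productDist μ z :=
  Finset.prod_nonneg fun i _ => by
    split_ifs
    · exact (hμ i).1
    · linarith [(hμ i).2]

theorem sum_productDist {m : ℕ} (μ : Fin m → ℝ) : ∑ z, productDist μ z = 1 :=
  sum_prod_eq_one (f := fun i b => if b = true then μ i else 1 - μ i) fun i => by simp

theorem sum_abs_productDist_sub_le {m : ℕ} {μ μ' : Fin m → ℝ}
    (hμ : ∀ i, μ i ∈ Set.Icc (0 : ℝ) 1) (hμ' : ∀ i, μ' i ∈ Set.Icc (0 : ℝ) 1) :
    ∑ z, |productDist μ z - productDist μ' z| ≤ ∑ i, 2 * |μ i - μ' i| := by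
  refine (sum_abs_prod_sub_prod_le (f := fun i b => if b = true then μ i else 1 - μ i)
    (g := fun i b => if b = true then μ' i else 1 - μ' i) ?_ ?_ ?_ ?_).trans
    (le_of_eq (Finset.sum_congr rfl fun i _ => ?_))
  · intro i a
    have := hμ i
    cases a <;> simp [this.1, this.2]
  · intro i a
    have := hμ' i
    cases a <;> simp [this.1, this.2]
  · intro i; simp
  · intro i; simp
  · simp only [Fintype.sum_bool, if_true, Bool.false_eq_true, if_false]
    rw [show 1 - μ i - (1 - μ' i) = -(μ i - μ' i) by ring, abs_neg]
    ring

/-! ### The log acceptance probability in two's complement -/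

theorem getLsbD_ofInt_eq_testBit {B j : ℕ} (hj : j < B) (n : ℤ) :
    (BitVec.ofInt B n).getLsbD j = n.testBit j := by
  cases n with
  | ofNat x =>
    rw [Int.ofNat_eq_natCast, BitVec.ofInt_natCast, BitVec.getLsbD_ofNat]
    simp [hj, Int.testBit]
  | negSucc x =>
    rw [BitVec.ofInt_negSucc_eq_not_ofNat, BitVec.getLsbD_not, BitVec.getLsbD_ofNat]
    simp [hj, Int.testBit]

theorem partialSum_ofInt (B nneg : ℕ) (g : ℕ → Bool) (a : ℕ → ℤ) (t : ℕ) :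
    partialSum B nneg g (fun q => BitVec.ofInt B (a q)) t = BitVec.ofInt B
      (∑ q ∈ Finset.range t, if g q then (if nneg ≤ q then -a q - 1 else a q) else 0) := by
  have hnot : ∀ n : ℤ, ~~~BitVec.ofInt B n = BitVec.ofInt B (-n - 1) := by
    intro n
    rw [BitVec.not_eq_neg_add, ← BitVec.ofInt_neg, sub_eq_add_neg (-n), BitVec.ofInt_add,
      BitVec.sub_eq_add_neg, BitVec.ofInt_neg (n := 1)]
    congr 2
  induction t with
  | zero => simp [partialSum]
  | succ t ih =>
    rw [partialSum_succ, ih, Finset.sum_range_succ, BitVec.ofInt_add, addend]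
    congr 1
    split_ifs
    · exact hnot _
    · rfl
    · simp

namespace Shape

/-- The sum of the gated real numbers `r q`, of which those after the parameters of the energy are
taken with a minus sign. -/
def logWeight (s : Shape) (r : ℕ → ℝ) (x y : ℕ → Bool) : ℝ :=
  ∑ q ∈ Finset.range s.terms, if s.gateVal x y q then (if s.params ≤ q then -r q else r q) else 0

theorem gateVal_last (s : Shape) (x y : ℕ → Bool) :
    s.gateVal x y (s.params + (s.2.1 + s.2.1 + 1)) = true := by
  have hp : s.units ≤ s.params := Nat.le_add_right _ _
  simp only [gateVal]
  rw [if_neg (by omega), if_neg (by omega), if_neg (by omega), if_neg (by omega)]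

/-- The accepted sum is an integer below the scaled exact sum. It is strictly below, since
complementing the last summand, which is never gated off, rounds strictly downwards. -/
theorem exists_logAccept_eq (s : Shape) {inp : ℕ → Bool} (r : ℕ → ℝ) (y : ℕ → Bool) :
    ∃ n : ℤ, s.logAccept inp (fun q => BitVec.ofInt s.bits ⌊r q * 2 ^ s.prec⌋) y =
        BitVec.ofInt s.bits n ∧
      (n : ℝ) < s.logWeight r (fun i => inp (s.terms * s.bits + i)) y * 2 ^ s.prec ∧
      s.logWeight r (fun i => inp (s.terms * s.bits + i)) y * 2 ^ s.prec ≤ n + s.terms := by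
  refine ⟨_, partialSum_ofInt _ _ _ _ _, ?_, ?_⟩
  · rw [logWeight, Finset.sum_mul]
    push_cast
    refine Finset.sum_lt_sum (fun q _ => ?_) ⟨s.params + (s.2.1 + s.2.1 + 1), ?_, ?_⟩
    · have h1 := Int.floor_le (r q * 2 ^ s.prec)
      have h2 := Int.lt_floor_add_one (r q * 2 ^ s.prec)
      split_ifs <;> linarith
    · rw [Finset.mem_range, terms]
      omega
    · rw [gateVal_last, if_pos rfl, if_pos (Nat.le_add_right _ _), if_pos rfl,
        if_pos (Nat.le_add_right _ _)]
      have h2 := Int.lt_floor_add_one (r (s.params + (s.2.1 + s.2.1 + 1)) * 2 ^ s.prec)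
      linarith
  · have hT : (s.terms : ℝ) = ∑ _q ∈ Finset.range s.terms, (1 : ℝ) := by simp
    rw [logWeight, Finset.sum_mul, hT]
    push_cast
    rw [← Finset.sum_add_distrib]
    refine Finset.sum_le_sum fun q _ => ?_
    have h1 := Int.floor_le (r q * 2 ^ s.prec)
    have h2 := Int.lt_floor_add_one (r q * 2 ^ s.prec)
    split_ifs <;> linarith

/-- The error of the acceptance probability: every term of the sum is off by at most one unit in the
last place, and the Bernoulli sampler by two more. -/
theorem abs_acceptance_sub_exp_le (s : Shape) {inp : ℕ → Bool} (r : ℕ → ℝ) (y : ℕ → Bool)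
    (h0 : s.logWeight r (fun i => inp (s.terms * s.bits + i)) y ≤ 0)
    (h1 : -2 ^ s.prec + 1 ≤ s.logWeight r (fun i => inp (s.terms * s.bits + i)) y)
    (hT : (s.terms : ℝ) ≤ 2 ^ s.prec) :
    |expProb s.bits s.rand s.threshold (fun j => (s.logAccept inp
        (fun q => BitVec.ofInt s.bits ⌊r q * 2 ^ s.prec⌋) y).getLsbD j) -
      Real.exp (s.logWeight r (fun i => inp (s.terms * s.bits + i)) y)| ≤
        (2 + s.terms) / 2 ^ s.prec := by
  obtain ⟨n, hn, hn1, hn2⟩ := s.exists_logAccept_eq (inp := inp) r y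
  have hp : (0 : ℝ) < 2 ^ s.prec := by positivity
  refine s.abs_expProb_sub_exp_le (n := n) ?_ ?_ h0 ?_ hn1.le hn2 fun j hj => ?_
  · have : (n : ℝ) < 0 := by nlinarith
    exact_mod_cast this
  · have : (-2 ^ s.bits : ℝ) ≤ n := by
      rw [bits, two_mul, pow_add]
      nlinarith
    exact_mod_cast this
  · have : 1 ≤ s.terms := by unfold terms; omega
    exact_mod_cast this
  · rw [hn, getLsbD_ofInt_eq_testBit hj]

theorem abs_unitProb_sub_le (s : Shape) {inp : ℕ → Bool} {r : ℕ → ℝ}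
    (hinp : ∀ q < s.terms, ∀ j < s.bits,
      inp (q * s.bits + j) = Int.testBit ⌊r q * 2 ^ s.prec⌋ j) (i : Fin s.2.1) {μ : ℝ}
    (hμ : r (s.params + i) = Real.log μ) (h0 : 0 < μ) (h1 : μ < 1)
    (hlog : -2 ^ s.prec ≤ Real.log μ) : |s.unitProb inp i - μ| ≤ 3 / 2 ^ s.prec := by
  have hp : (0 : ℝ) < 2 ^ s.prec := by positivity
  have hneg := Real.log_neg h0 h1
  have h := s.abs_expProb_sub_exp_le (n := ⌊Real.log μ * 2 ^ s.prec⌋)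
    (a := fun j => inp ((s.params + i) * s.bits + j)) ?_ ?_ hneg.le le_rfl (Int.floor_le _)
    (Int.lt_floor_add_one _).le fun j hj => ?_
  · rw [Real.exp_log h0] at h
    refine h.trans (le_of_eq ?_)
    norm_num
  · rw [Int.floor_lt]
    push_cast
    nlinarith
  · rw [Int.le_floor, bits, two_mul, pow_add]
    push_cast
    nlinarith
  · have hi := i.2
    rw [hinp _ (by unfold terms; omega) j hj, hμ]

theorem unitProb_mem_Icc (s : Shape) (inp : ℕ → Bool) (i : ℕ) :
    s.unitProb inp i ∈ Set.Icc (0 : ℝ) 1 :=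
  ⟨expProb_nonneg _ _ _ _, expProb_le_one s.threshold_lt _⟩

theorem weight_nonneg (s : Shape) (inp : ℕ → Bool) (X : ℕ → BitVec s.bits)
    (y : Fin s.2.1 → Bool) : 0 ≤ s.weight inp X y :=
  mul_nonneg (productDist_nonneg (fun i => s.unitProb_mem_Icc inp i) y) (expProb_nonneg _ _ _ _)

theorem sum_weight_le_one (s : Shape) (inp : ℕ → Bool) (X : ℕ → BitVec s.bits) :
    ∑ y, s.weight inp X y ≤ 1 := by
  rw [← sum_productDist fun i : Fin s.2.1 => s.unitProb inp i]
  exact Finset.sum_le_sum fun y _ => mul_le_of_le_one_right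
    (productDist_nonneg (fun i => s.unitProb_mem_Icc inp i) y) (expProb_le_one s.threshold_lt _)

/-- The total error of the weights of the sampler. -/
theorem sum_abs_weight_sub_le (s : Shape) {inp : ℕ → Bool} {r : ℕ → ℝ}
    (hinp : ∀ q < s.terms, ∀ j < s.bits,
      inp (q * s.bits + j) = Int.testBit ⌊r q * 2 ^ s.prec⌋ j) {μ : Fin s.2.1 → ℝ}
    (hμ : ∀ i : Fin s.2.1, r (s.params + i) = Real.log (μ i)) (h0 : ∀ i, 0 < μ i)
    (h1 : ∀ i, μ i < 1) (hlog : ∀ i, -2 ^ s.prec ≤ Real.log (μ i))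
    {L : (Fin s.2.1 → Bool) → ℝ}
    (hL : ∀ y, s.logWeight r (fun i => inp (s.terms * s.bits + i)) (extend y) = L y)
    (hL0 : ∀ y, L y ≤ 0) (hL1 : ∀ y, -2 ^ s.prec + 1 ≤ L y)
    (hT : (s.terms : ℝ) ≤ 2 ^ s.prec) :
    ∑ y, |s.weight inp (fun q => BitVec.ofInt s.bits ⌊r q * 2 ^ s.prec⌋) y -
      productDist μ y * Real.exp (L y)| ≤ (6 * s.2.1 + 2 + s.terms) / 2 ^ s.prec := by
  set μ' : Fin s.2.1 → ℝ := fun i => s.unitProb inp i with hμ'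
  have hm' : ∀ i, μ' i ∈ Set.Icc (0 : ℝ) 1 := fun i => s.unitProb_mem_Icc inp i
  have hm : ∀ i, μ i ∈ Set.Icc (0 : ℝ) 1 := fun i => ⟨(h0 i).le, (h1 i).le⟩
  calc _ ≤ ∑ y, (productDist μ' y * ((2 + s.terms) / 2 ^ s.prec) +
        |productDist μ' y - productDist μ y|) := by
        refine Finset.sum_le_sum fun y _ => ?_
        have ha := s.abs_acceptance_sub_exp_le (inp := inp) r (extend y) (by rw [hL]; exact hL0 y)
          (by rw [hL]; exact hL1 y) hT
        rw [hL] at ha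
        have hQ := productDist_nonneg hm' y
        rw [weight]
        set a' := expProb s.bits s.rand s.threshold fun j => (s.logAccept inp
          (fun q => BitVec.ofInt s.bits ⌊r q * 2 ^ s.prec⌋) (extend y)).getLsbD j
        have e : productDist μ' y * a' - productDist μ y * Real.exp (L y) =
          productDist μ' y * (a' - Real.exp (L y)) +
            (productDist μ' y - productDist μ y) * Real.exp (L y) := by ring
        rw [e]
        refine (abs_add_le _ _).trans (add_le_add ?_ ?_)
        · rw [abs_mul, abs_of_nonneg hQ]
          exact mul_le_mul_of_nonneg_left ha hQ
        · rw [abs_mul, abs_of_pos (Real.exp_pos _)]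
          exact mul_le_of_le_one_right (abs_nonneg _) (Real.exp_le_one_iff.2 (hL0 y))
    _ ≤ (2 + s.terms) / 2 ^ s.prec + ∑ _i : Fin s.2.1, 2 * (3 / 2 ^ s.prec) := by
        rw [Finset.sum_add_distrib, ← Finset.sum_mul, sum_productDist, one_mul]
        refine add_le_add le_rfl ((sum_abs_productDist_sub_le hm' hm).trans
          (Finset.sum_le_sum fun i _ => ?_))
        exact mul_le_mul_of_nonneg_left
          (s.abs_unitProb_sub_le hinp i (hμ i) (h0 i) (h1 i) (hlog i)) (by norm_num)
    _ = _ := by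
        rw [Finset.sum_const, Finset.card_univ, Fintype.card_fin, nsmul_eq_mul]
        ring

end Shape

/-! ### Mean-field facts -/

section MeanField

variable {m : ℕ} {H : (Fin m → Bool) → ℝ} {μ : Fin m → ℝ} {κ : ℝ}

theorem partitionFn_pos (H : (Fin m → Bool) → ℝ) : 0 < partitionFn H :=
  Finset.sum_pos (fun _ _ => Real.exp_pos _) Finset.univ_nonempty

theorem gibbs_pos (H : (Fin m → Bool) → ℝ) (z : Fin m → Bool) : 0 < gibbs H z :=
  div_pos (Real.exp_pos _) (partitionFn_pos H)

theorem sum_gibbs (H : (Fin m → Bool) → ℝ) : ∑ z, gibbs H z = 1 := by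
  simp only [gibbs, ← Finset.sum_div]
  exact div_self (partitionFn_pos H).ne'

theorem IsKappa.productDist_pos (hκ : IsKappa H μ κ) (z : Fin m → Bool) : 0 < productDist μ z := by
  have h1 : 0 < Real.exp (-H z) / Real.exp (logZQ H μ) := by positivity
  exact pos_of_mul_pos_right (h1.trans_le (hκ.2 z)) hκ.1.le

/-- A finite `κ` forces the marginals away from `0` and `1`, so that their logarithms make sense. -/
theorem IsKappa.pos (hκ : IsKappa H μ κ) (hμ : ∀ i, μ i ∈ Set.Icc (0 : ℝ) 1) (i : Fin m) :
    0 < μ i ∧ μ i < 1 := by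
  constructor
  · refine lt_of_le_of_ne (hμ i).1 fun h => ?_
    refine (hκ.productDist_pos fun _ => true).ne' (Finset.prod_eq_zero (Finset.mem_univ i) ?_)
    simp [← h]
  · refine lt_of_le_of_ne (hμ i).2 fun h => ?_
    refine (hκ.productDist_pos fun _ => false).ne' (Finset.prod_eq_zero (Finset.mem_univ i) ?_)
    simp [h]

/-- Gibbs' inequality: the variational partition function is a lower bound. -/
theorem IsKappa.logZQ_le (hκ : IsKappa H μ κ) : logZQ H μ ≤ Real.log (partitionFn H) := by
  have hZ := partitionFn_pos H
  have h1 : ∀ z, productDist μ z * Real.log (Real.exp (-H z) / productDist μ z) ≤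
      productDist μ z * Real.log (partitionFn H) + (gibbs H z - productDist μ z) := by
    intro z
    have hQ := hκ.productDist_pos z
    have hg := gibbs_pos H z
    have h2 := Real.log_le_sub_one_of_pos (div_pos hg hQ)
    have h3 : Real.log (Real.exp (-H z) / productDist μ z) =
        Real.log (partitionFn H) + Real.log (gibbs H z / productDist μ z) := by
      rw [← Real.log_mul hZ.ne' (div_pos hg hQ).ne', gibbs]
      congr 1
      field_simp
    rw [h3, mul_add]
    gcongr
    calc _ ≤ productDist μ z * (gibbs H z / productDist μ z - 1) := by gcongr
      _ = _ := by field_simp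
  calc logZQ H μ ≤ _ := Finset.sum_le_sum fun z _ => h1 z
    _ = _ := by
      rw [Finset.sum_add_distrib, Finset.sum_sub_distrib, ← Finset.sum_mul, sum_productDist,
        sum_gibbs]
      ring

theorem log_partitionFn_le {M : ℝ} (hM : ∀ z, |H z| ≤ M) :
    Real.log (partitionFn H) ≤ m + M := by
  rw [Real.log_le_iff_le_exp (partitionFn_pos H)]
  calc partitionFn H ≤ ∑ _z : Fin m → Bool, Real.exp M :=
        Finset.sum_le_sum fun z _ => Real.exp_le_exp.2 (by have := (abs_le.1 (hM z)).1; linarith)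
    _ = 2 ^ m * Real.exp M := by simp
    _ ≤ Real.exp m * Real.exp M := by
        gcongr
        have h2 : (2 : ℝ) ≤ Real.exp 1 := by have := Real.add_one_le_exp (1 : ℝ); linarith
        calc (2 : ℝ) ^ m ≤ Real.exp 1 ^ m := by gcongr
          _ = Real.exp m := by rw [← Real.exp_nat_mul, mul_one]
    _ = _ := by rw [Real.exp_add]

/-- The logarithm of the acceptance probability of `z` in the rejection sampler that proposes `z`
with the mean-field probability `Q z`. -/
def logRatio (H : (Fin m → Bool) → ℝ) (μ : Fin m → ℝ) (κ : ℝ) (z : Fin m → Bool) : ℝ :=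
  -H z - logZQ H μ - Real.log κ - Real.log (productDist μ z)

theorem IsKappa.logRatio_nonpos (hκ : IsKappa H μ κ) (z : Fin m → Bool) : logRatio H μ κ z ≤ 0 := by
  have h := Real.log_le_log (by positivity) (hκ.2 z)
  rw [← Real.exp_sub, Real.log_exp, Real.log_mul hκ.1.ne' (hκ.productDist_pos z).ne'] at h
  rw [logRatio]
  linarith

theorem IsKappa.productDist_mul_exp_logRatio (hκ : IsKappa H μ κ) (z : Fin m → Bool) :
    productDist μ z * Real.exp (logRatio H μ κ z) =
      gibbs H z * (partitionFn H / (Real.exp (logZQ H μ) * κ)) := by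
  have hQ := hκ.productDist_pos z
  rw [logRatio, Real.exp_sub, Real.exp_sub, Real.exp_sub, Real.exp_log hκ.1, Real.exp_log hQ, gibbs]
  have := partitionFn_pos H
  have := hκ.1
  field_simp

theorem productDist_le_one (hμ : ∀ i, μ i ∈ Set.Icc (0 : ℝ) 1) (z : Fin m → Bool) :
    productDist μ z ≤ 1 :=
  Finset.prod_le_one (fun i _ => by split_ifs <;> linarith [(hμ i).1, (hμ i).2])
    fun i _ => by split_ifs <;> linarith [(hμ i).1, (hμ i).2]

/-- A lower bound that keeps the log acceptance probability within the range of the fixed-point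
numbers. -/
theorem IsKappa.le_logRatio (hκ : IsKappa H μ κ) (hμ : ∀ i, μ i ∈ Set.Icc (0 : ℝ) 1) {M : ℝ}
    (hM : ∀ z, |H z| ≤ M) (z : Fin m → Bool) : -(2 * M + m + Real.log κ) ≤ logRatio H μ κ z := by
  have h1 := hκ.logZQ_le.trans (log_partitionFn_le hM)
  have h2 := Real.log_nonpos (hκ.productDist_pos z).le (productDist_le_one hμ z)
  have h3 := (abs_le.1 (hM z)).2
  rw [logRatio]
  linarith

/-- The log marginals are within the range of the fixed-point numbers: `μ_i` is at least the
probability `Q z` of the word `z` that is `true` everywhere, and the property of `κ` bounds `Q z`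
from below. -/
theorem IsKappa.le_log_marginal (hκ : IsKappa H μ κ) (hμ : ∀ i, μ i ∈ Set.Icc (0 : ℝ) 1) {M : ℝ}
    (hM : ∀ z, |H z| ≤ M) (i : Fin m) : -(2 * M + m + Real.log κ) ≤ Real.log (μ i) := by
  have h1 := hκ.logZQ_le.trans (log_partitionFn_le hM)
  have h0 := hκ.logRatio_nonpos fun _ => true
  have h3 := (abs_le.1 (hM fun _ => true)).2
  have hQ := hκ.productDist_pos fun _ => true
  have h4 : Real.log (productDist μ fun _ => true) ≤ Real.log (μ i) := by
    refine Real.log_le_log hQ ?_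
    simp only [productDist, if_true]
    rw [← Finset.mul_prod_erase _ _ (Finset.mem_univ i)]
    exact mul_le_of_le_one_right (hμ i).1 (Finset.prod_le_one (fun j _ => (hμ j).1)
      fun j _ => (hμ j).2)
  rw [logRatio] at h0
  linarith

/-- The acceptance probability of the exact rejection sampler. -/
theorem IsKappa.acceptance_mem (hκ : IsKappa H μ κ) :
    1 / κ ≤ partitionFn H / (Real.exp (logZQ H μ) * κ) ∧
      partitionFn H / (Real.exp (logZQ H μ) * κ) ≤ 1 := by
  constructor
  · have h := Real.exp_le_exp.2 hκ.logZQ_le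
    rw [Real.exp_log (partitionFn_pos H)] at h
    rw [← div_div]
    exact div_le_div_of_nonneg_right ((one_le_div (Real.exp_pos _)).2 h) hκ.1.le
  · calc _ = ∑ z, productDist μ z * Real.exp (logRatio H μ κ z) := by
          simp only [hκ.productDist_mul_exp_logRatio, ← Finset.sum_mul, sum_gibbs, one_mul]
      _ ≤ ∑ z, productDist μ z := Finset.sum_le_sum fun z _ => mul_le_of_le_one_right
          (hκ.productDist_pos z).le (Real.exp_le_one_iff.2 (hκ.logRatio_nonpos z))
      _ = 1 := sum_productDist μ

theorem IsKappa.one_le (hκ : IsKappa H μ κ) : 1 ≤ κ := by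
  have h := hκ.acceptance_mem.1.trans hκ.acceptance_mem.2
  rwa [div_le_one hκ.1] at h

end MeanField

/-- Normalizing a perturbed multiple of a probability distribution. -/
theorem sum_abs_normalize_sub_le {ι : Type*} [Fintype ι] {w g : ι → ℝ} (hw : ∀ i, 0 ≤ w i)
    (hg : ∑ i, g i = 1) {A δ : ℝ} (hA : 0 < A) (h : ∑ i, |w i - g i * A| ≤ δ) (hδ : δ < A) :
    ∑ i, |w i / (∑ j, w j) - g i| ≤ 2 * δ / A ∧ A - δ ≤ ∑ i, w i := by
  have hsum : |∑ i, w i - A| ≤ δ := by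
    have e : ∑ i, w i - A = ∑ i, (w i - g i * A) := by
      rw [Finset.sum_sub_distrib, ← Finset.sum_mul, hg, one_mul]
    rw [e]
    exact (Finset.abs_sum_le_sum_abs _ _).trans h
  have hp : A - δ ≤ ∑ i, w i := by linarith [(abs_le.1 hsum).1]
  have hp0 : 0 < ∑ i, w i := by linarith
  refine ⟨?_, hp⟩
  set p := ∑ i, w i with hpdef
  calc _ ≤ ∑ i, (|w i - g i * A| / A + w i * (|p - A| / (p * A))) := by
        refine Finset.sum_le_sum fun i _ => ?_
        have e : w i / p - g i = (w i - g i * A) / A + -(w i * ((p - A) / (p * A))) := by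
          field_simp
          ring
        rw [e]
        refine (abs_add_le _ _).trans (le_of_eq ?_)
        rw [abs_neg, abs_mul, abs_div, abs_div, abs_of_pos hA, abs_of_nonneg (hw i),
          abs_of_pos (mul_pos hp0 hA)]
    _ = (∑ i, |w i - g i * A|) / A + |p - A| / A := by
        rw [Finset.sum_add_distrib, ← Finset.sum_div, ← Finset.sum_mul, ← hpdef, mul_div,
          mul_div_mul_left _ _ hp0.ne']
    _ ≤ δ / A + δ / A := by gcongr
    _ = _ := by ring

/-! ### The size of the circuits -/

theorem length_cells_le {base T c : ℕ} {body : ℕ → List (ℕ × ℕ)} (h : ∀ i, (body i).length ≤ c) :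
    (cells base T body).length ≤ T * c := by
  rw [cells, List.length_flatMap]
  refine (List.sum_le_card_nsmul _ c ?_).trans (by simp)
  intro x hx
  obtain ⟨i, -, rfl⟩ := List.mem_map.1 hx
  simpa [addParity] using h i

theorem length_samplerBody_le (wz one base abase astride ubase B R : ℕ) (c : ℕ → ℕ) (i : ℕ) :
    (samplerBody wz one base abase astride ubase B R c i).length ≤ 3 := by
  simp only [samplerBody]
  split_ifs <;> simp

theorem length_adderBody_le (wz gbase base B nneg i : ℕ) :
    (adderBody wz gbase base B nneg i).length ≤ 3 := by
  simp only [adderBody]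
  split_ifs <;> simp

namespace Shape

theorem length_gateBody_le (s : Shape) (q : ℕ) : (s.gateBody q).length ≤ 2 := by
  simp only [gateBody]
  split_ifs <;> simp

theorem length_acceptCircuit_le (s : Shape) : s.acceptCircuit.length ≤
    3 * ((s.2.1 + 1) * s.bits * (s.rand + 2)) + 9 * (s.terms * s.bits) + 2 * s.terms +
      (s.2.1 + 1) := by
  have h1 := length_cells_le (base := s.unitBase) (T := s.2.1 * s.bits * (s.rand + 2))
    (length_samplerBody_le s.zeroWire s.oneWire s.unitBase (s.params * s.bits) 1 s.searchBase
      s.bits s.rand s.threshold)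
  have h2 := length_cells_le (base := s.gateBase) (T := s.terms) s.length_gateBody_le
  have h3 := length_cells_le (base := s.adderBase) (T := s.terms * s.bits * 3)
    (length_adderBody_le s.zeroWire s.gateBase s.adderBase s.bits s.params)
  have h4 := length_cells_le (base := s.acceptBase) (T := s.bits * (s.rand + 2))
    (length_samplerBody_le s.zeroWire s.oneWire s.acceptBase
      (s.adderBase + ((s.terms - 1) * s.bits * 3 + 1)) 3
      (s.searchBase + s.2.1 * s.bits * s.rand) s.bits s.rand s.threshold)
  have h5 : (copies s.inputLen (s.2.1 + 1)
      fun i => if i = 0 then s.acceptWire else s.sampleWire (i - 1)).length = s.2.1 + 1 := by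
    simp [copies, addParity]
  have h6 : (s.2.1 + 1) * s.bits * (s.rand + 2) =
    s.2.1 * s.bits * (s.rand + 2) + s.bits * (s.rand + 2) := by ring
  rw [acceptCircuit]
  simp only [List.length_append, h5]
  omega

theorem length_round_le (s : Shape) (k : ℕ) : (s.round k).length ≤
    (2 * s.acceptCircuit.length + 5 * s.searchSize + 5) * 3 ^ k := by
  have h1 : s.anyCircuit.length ≤ s.searchSize * 3 :=
    length_cells_le fun i => by simp [anyBody]
  have h2 : s.searchQubits.length = s.searchSize := by simp [searchQubits]
  have h3 : 2 * ((3 ^ k - 1) / 2) + 1 ≤ 3 ^ k := by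
    have : 0 < 3 ^ k := by positivity
    omega
  have h4 : (s.round k).length = 1 + s.searchSize + ((3 ^ k - 1) / 2) *
      (2 * s.acceptCircuit.length + 2 * s.searchSize + 2 * s.anyCircuit.length + 8) +
      s.acceptCircuit.length := by
    simp only [round, groverCircuit, groverIteration, phaseOracle, hadamards, toffolis,
      List.length_append, List.length_cons, List.length_map, List.length_reverse,
      List.length_replicate, List.length_flatMap, List.map_const', List.sum_replicate,
      List.length_range, smul_eq_mul, h2]
    ring
  rw [h4]
  set K := (3 ^ k - 1) / 2
  calc _ ≤ 1 + s.searchSize + K * (2 * s.acceptCircuit.length + 8 * s.searchSize + 8) +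
        s.acceptCircuit.length := by
        have := Nat.mul_le_mul_left K (show 2 * s.acceptCircuit.length + 2 * s.searchSize +
          2 * s.anyCircuit.length + 8 ≤ 2 * s.acceptCircuit.length + 8 * s.searchSize + 8 by omega)
        omega
    _ ≤ (2 * s.acceptCircuit.length + 5 * s.searchSize + 5) * (2 * K + 1) := by nlinarith
    _ ≤ _ := by gcongr

/-- The cost of a round is the number of summands times the square of the size parameter, for each
application of the acceptance circuit. -/
theorem cost_round_le (s : Shape) (hl : 0 < s.2.2.2) (k : ℕ) :
    s.inputLen + (s.round k).length + (1 + s.2.1) ≤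
      60000 * s.terms * s.2.2.2 ^ 2 * 3 ^ k := by
  have h1 := s.length_round_le k
  have h2 := s.length_acceptCircuit_le
  have hT : s.2.1 + 1 ≤ s.terms := by unfold terms; omega
  have hT' : s.1 + (1 + s.2.1) ≤ s.terms := by unfold terms params units; omega
  have hR : s.rand + 2 ≤ 122 * s.2.2.2 := by unfold rand prec; omega
  have hB : s.bits = 40 * s.2.2.2 := by unfold bits prec; omega
  have hk : 1 ≤ 3 ^ k := Nat.one_le_pow _ _ (by norm_num)
  set l := s.2.2.2
  set T := s.terms
  have hll : l ≤ l ^ 2 := by nlinarith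
  have hTl : T ≤ T * l ^ 2 := Nat.le_mul_of_pos_right _ (by positivity)
  have hTl' : T * l ≤ T * l ^ 2 := Nat.mul_le_mul_left _ hll
  have h3 : (s.2.1 + 1) * s.bits * (s.rand + 2) ≤ 4880 * (T * l ^ 2) := by
    calc _ ≤ T * (40 * l) * (122 * l) := by rw [hB]; gcongr
      _ = _ := by ring
  have h4 : s.searchSize ≤ 4880 * (T * l ^ 2) := by
    refine le_trans ?_ h3
    rw [searchSize]
    gcongr
    omega
  have h5 : T * s.bits = 40 * (T * l) := by rw [hB]; ring
  have h6 : s.inputLen + (1 + s.2.1) ≤ 41 * (T * l ^ 2) := by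
    rw [inputLen, h5]
    omega
  have h7 : 2 * s.acceptCircuit.length + 5 * s.searchSize + 5 ≤ 59000 * (T * l ^ 2) := by
    have : 1 ≤ T := by omega
    omega
  calc s.inputLen + (s.round k).length + (1 + s.2.1)
      = s.inputLen + (1 + s.2.1) + (s.round k).length := by ring
    _ ≤ 41 * (T * l ^ 2) * 3 ^ k + 59000 * (T * l ^ 2) * 3 ^ k := by
        refine Nat.add_le_add (h6.trans (Nat.le_mul_of_pos_right _ (by omega))) (h1.trans ?_)
        gcongr
    _ ≤ _ := by
        rw [← Nat.add_mul]
        gcongr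
        rw [Nat.mul_assoc]
        omega

/-! ### A single run -/

/-- The law of a run is close to the Gibbs distribution of `H`, and the run is short. -/
theorem run_spec (s : Shape) (hl : 0 < s.2.2.2) (hT : (s.terms : ℝ) ≤ 2 ^ (s.2.2.2 + 4))
    (hedges : ∀ e ∈ s.2.2.1, e.1 < s.units ∧ e.2 < s.units) {input : List Bool}
    (hlen : input.length = s.inputLen) {r : ℕ → ℝ}
    (hinp : ∀ q < s.terms, ∀ j < s.bits,
      input.getD (q * s.bits + j) false = Int.testBit ⌊r q * 2 ^ s.prec⌋ j)
    {H : (Fin s.2.1 → Bool) → ℝ} {μ : Fin s.2.1 → ℝ} {κ : ℝ} (hκ : IsKappa H μ κ)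
    (hμ : ∀ i, μ i ∈ Set.Icc (0 : ℝ) 1)
    (hr : ∀ i : Fin s.2.1, r (s.params + i) = Real.log (μ i))
    (hL : ∀ y, s.logWeight r (fun i => input.getD (s.terms * s.bits + i) false) (extend y) =
      logRatio H μ κ y)
    (hκl : κ ≤ 2 ^ s.2.2.2) {M : ℝ} (hM : ∀ z, |H z| ≤ M)
    (hrange : 2 * M + s.2.1 + Real.log κ ≤ 2 ^ s.prec - 1) :
    (∀ y, 0 ≤ outputLaw s.run input s.2.1 y) ∧ ∑ y, outputLaw s.run input s.2.1 y = 1 ∧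
    ∑ y, |outputLaw s.run input s.2.1 y - gibbs H y| ≤ (1 / 2) ^ (11 * s.2.2.2) ∧
    expectedOps s.run input s.2.1 ≤ ENNReal.ofReal
      (60000 * s.terms * s.2.2.2 ^ 2 * (19 * (s.2.2.2 + 2) * (3 * Real.sqrt κ))) := by
  set inp : ℕ → Bool := fun w => input.getD w false with hinpdef
  set X : ℕ → BitVec s.bits := fun q => BitVec.ofInt s.bits ⌊r q * 2 ^ s.prec⌋ with hX
  set l := s.2.2.2 with hldef
  have hp : s.prec = 20 * l := rfl
  have hκ1 := hκ.one_le
  have hκ0 := hκ.1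
  have hlog0 := Real.log_nonneg hκ1
  have hpos := hκ.pos hμ
  have hT2 : (s.terms : ℝ) ≤ 2 ^ s.prec :=
    hT.trans (pow_le_pow_right₀ (by norm_num) (by omega))
  -- the error of the weights
  have herr : ∑ y, |s.weight inp X y - gibbs H y *
      (partitionFn H / (Real.exp (logZQ H μ) * κ))| ≤ (1 / 2) ^ (12 * l) / 2 := by
    have h := s.sum_abs_weight_sub_le (inp := inp) (r := r) hinp hr (fun i => (hpos i).1)
      (fun i => (hpos i).2) (fun i => by linarith [hκ.le_log_marginal hμ hM i]) hL
      hκ.logRatio_nonpos (fun y => by linarith [hκ.le_logRatio hμ hM y]) hT2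
    simp only [hκ.productDist_mul_exp_logRatio] at h
    refine h.trans ?_
    have h3 : (6 * s.2.1 + 2 + s.terms : ℝ) ≤ 3 * s.terms := by
      have : 6 * s.2.1 + 2 + s.terms ≤ 3 * s.terms := by
        unfold terms params units
        omega
      exact_mod_cast this
    -- of the `20 l` fractional bits, fewer than `8 l` are lost to the number of terms
    have e : (1 / 2 : ℝ) ^ (12 * l) / 2 = 2 ^ (8 * l - 1) / 2 ^ s.prec := by
      rw [hp, one_div_pow, div_div, ← pow_succ, div_eq_div_iff (by positivity) (by positivity),
        one_mul, ← pow_add]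
      congr 1
      omega
    rw [e]
    gcongr
    calc _ ≤ 3 * (s.terms : ℝ) := h3
      _ ≤ 2 ^ 2 * 2 ^ (l + 4) := by linarith
      _ = 2 ^ (l + 6) := by rw [← pow_add]; ring_nf
      _ ≤ _ := pow_le_pow_right₀ (by norm_num) (by omega)
  obtain ⟨hA1, hA2⟩ := hκ.acceptance_mem
  set A := partitionFn H / (Real.exp (logZQ H μ) * κ) with hA
  have hκinv : (1 / 2 : ℝ) ^ l ≤ 1 / κ := by
    rw [one_div_pow]
    exact one_div_le_one_div_of_le hκ0 hκl
  have hδ : (1 / 2 : ℝ) ^ (12 * l) / 2 ≤ 1 / κ / 2 := by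
    have : (1 / 2 : ℝ) ^ (12 * l) ≤ (1 / 2) ^ l :=
      pow_le_pow_of_le_one (by norm_num) (by norm_num) (by omega)
    linarith
  have hA0 : 0 < A := lt_of_lt_of_le (by positivity) hA1
  have hκi0 : 0 < 1 / κ := by positivity
  obtain ⟨hdist, hp'⟩ := sum_abs_normalize_sub_le (fun y => s.weight_nonneg inp X y)
    (sum_gibbs H) hA0 herr (by linarith)
  set p := ∑ y, s.weight inp X y with hpdef
  have hp2 : 1 / κ / 2 ≤ p := by linarith
  have hp0 : 0 < p := by linarith
  -- the number of iterations needed, with the perturbed acceptance probability `p ≥ 1 / (2 κ)`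
  have hsqrt : Real.pi / 2 / Real.sqrt p ≤ 3 * Real.sqrt κ := by
    rw [div_le_iff₀ (Real.sqrt_pos.2 hp0), mul_assoc, ← Real.sqrt_mul hκ0.le]
    have h1 : Real.sqrt (1 / 2) ≤ Real.sqrt (κ * p) := by
      refine Real.sqrt_le_sqrt ?_
      calc (1 / 2 : ℝ) = κ * (1 / κ / 2) := by field_simp
        _ ≤ κ * p := by gcongr
    have h2 : (2 / 3 : ℝ) ≤ Real.sqrt (1 / 2) := Real.le_sqrt_of_sq_le (by norm_num)
    have h3 := Real.pi_lt_d2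
    linarith
  -- blocks of length `l + 2` are long enough to contain the good exponent, as `κ ≤ 2^l`
  have hW : Real.pi / 2 / Real.sqrt p < 3 ^ (l + 2) := by
    refine hsqrt.trans_lt ?_
    have h1 : Real.sqrt κ ≤ κ := by
      rw [Real.sqrt_le_left (by linarith)]
      nlinarith
    have h2 : (2 : ℝ) ^ l ≤ 3 ^ l := by gcongr; norm_num
    have h3 : (0 : ℝ) < 3 ^ l := by positivity
    rw [pow_add]
    linarith
  obtain ⟨hlaw, hops⟩ := outputLaw_and_expectedOps_of_acceptProb (C := s.run) (input := input)
    (m := s.2.1) (W := l + 2) (w := fun y => s.weight inp X y / p)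
    (by rw [← Finset.sum_div]; exact div_self hp0.ne') hp0 (s.sum_weight_le_one inp X) hW
    (fun θ hθ τ y => s.acceptProb_round hl input hlen hedges X
      (fun q hq j hj => by rw [hX, getLsbD_ofInt_eq_testBit hj, hinp q hq j hj]) θ hθ
      (fun h => hp0.ne' (by rw [← hθ, h]; norm_num)) (exponent (l + 2) τ) y)
    (L := 60000 * s.terms * l ^ 2) (fun τ => by rw [hlen]; exact s.cost_round_le hl _)
  simp only [hlaw]
  refine ⟨fun y => div_nonneg (s.weight_nonneg inp X y) hp0.le, ?_, hdist.trans ?_, hops.trans ?_⟩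
  · rw [← Finset.sum_div]
    exact div_self hp0.ne'
  · -- normalization costs a factor `1 / A ≤ κ ≤ 2^l`
    rw [div_le_iff₀ hA0]
    calc 2 * ((1 / 2 : ℝ) ^ (12 * l) / 2) = (1 / 2) ^ (12 * l) := by ring
      _ ≤ (1 / 2) ^ (11 * l + l) := pow_le_pow_of_le_one (by norm_num) (by norm_num) (by omega)
      _ = (1 / 2) ^ (11 * l) * (1 / 2) ^ l := pow_add _ _ _
      _ ≤ _ := by gcongr; exact hκinv.trans hA1
  · refine ENNReal.ofReal_le_ofReal ?_
    push_cast
    gcongr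

end Shape

/-! ### The inputs of the runs -/

theorem getD_flatMap_of_length {α β : Type*} {f : α → List β} {B : ℕ}
    (hf : ∀ a, (f a).length = B) (d : β) (d' : α) :
    ∀ (L L' : List α) (M : List β) {q j : ℕ}, L' = L → q < L.length → j < B →
      (L.flatMap f ++ M).getD (q * B + j) d = (f (L.getD q d')).getD j d
  | [], _, _, q, _, _, hq, _ => absurd hq (by simp)
  | a :: L, _, M, 0, j, _, _, hj => by
    rw [List.flatMap_cons, List.append_assoc, Nat.zero_mul, Nat.zero_add,
      List.getD_append _ _ _ _ (by rw [hf]; exact hj), List.getD_cons_zero]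
  | a :: L, _, M, q + 1, j, _, hq, hj => by
    have e : (q + 1) * B + j = (f a).length + (q * B + j) := by rw [hf]; ring
    rw [List.flatMap_cons, List.append_assoc, List.getD_append_right _ _ _ _ (by omega), e,
      Nat.add_sub_cancel_left, List.getD_cons_succ]
    exact getD_flatMap_of_length hf d d' L L M rfl (by simpa using hq) hj

theorem length_flatMap_of_length {α β : Type*} {f : α → List β} {B : ℕ}
    (hf : ∀ a, (f a).length = B) (L : List α) : (L.flatMap f).length = L.length * B := by
  simp [List.length_flatMap, hf]

theorem getD_ofFn_append_left {α : Type*} {n : ℕ} (a : Fin n → α) (L : List α) (d : α)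
    (i : Fin n) : (List.ofFn a ++ L).getD i d = a i := by
  rw [List.getD_append _ _ _ _ (by simp), List.getD_eq_getElem _ _ (by simp)]
  simp

theorem getD_ofFn_append_right {α : Type*} {n : ℕ} (a : Fin n → α) (L : List α) (d : α) (q : ℕ) :
    (List.ofFn a ++ L).getD (n + q) d = L.getD q d := by
  rw [List.getD_append_right _ _ _ _ (by simp)]
  simp

theorem length_encodeReal (p : ℕ) (r : ℝ) : (encodeReal p r).length = 2 * p := by
  simp [encodeReal]

theorem getD_encodeReal {p j : ℕ} (hj : j < 2 * p) (r : ℝ) :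
    (encodeReal p r).getD j false = Int.testBit ⌊r * 2 ^ p⌋ j := by
  rw [List.getD_eq_getElem _ _ (by rw [length_encodeReal]; exact hj)]
  simp [encodeReal]

namespace BMGraph

variable (G : BMGraph)

/-- The real numbers in the input of a run. -/
def inputNumbers (θ : G.Params) {m : ℕ} (μ : Fin m → ℝ) (logZ κ : ℝ) : List ℝ :=
  List.ofFn (fun i => θ (Sum.inl i)) ++ (List.ofFn (fun e => θ (Sum.inr e)) ++
    (List.ofFn (fun i => Real.log (μ i)) ++ (List.ofFn (fun i => Real.log (1 - μ i)) ++
      [logZ, Real.log κ])))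

theorem encodeInput_eq (p : ℕ) (θ : G.Params) {m : ℕ} (μ : Fin m → ℝ) (logZ κ : ℝ) :
    G.encodeInput p θ μ logZ κ = (G.inputNumbers θ μ logZ κ).flatMap (encodeReal p) := by
  simp [encodeInput, inputNumbers, encodeVec, List.flatMap_append]

theorem length_inputNumbers (θ : G.Params) {m : ℕ} (μ : Fin m → ℝ) (logZ κ : ℝ) :
    (G.inputNumbers θ μ logZ κ).length = G.nv + G.nh + G.numEdges + (m + m + 2) := by
  simp [inputNumbers]
  ring

/-- The shape of the graph when `h` of the units are sampled and `v` are clamped. -/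
def sampleShape (v h ℓ : ℕ) : Shape := (v, h, (G.shape ℓ).2.2.1, ℓ)

theorem units_sampleShape (v h ℓ : ℕ) : (G.sampleShape v h ℓ).units = v + h := rfl

theorem params_sampleShape (v h ℓ : ℕ) : (G.sampleShape v h ℓ).params = v + h + G.numEdges := by
  simp [Shape.params, Shape.units, sampleShape, shape]

theorem terms_sampleShape (v h ℓ : ℕ) :
    (G.sampleShape v h ℓ).terms = v + h + G.numEdges + (h + h + 2) := by
  rw [Shape.terms, params_sampleShape]
  rfl

theorem extend_val {h : ℕ} (y : Fin h → Bool) (i : Fin h) : Shape.extend y i = y i := by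
  simp [Shape.extend]

/-- The sum that the circuit computes is the log acceptance probability. -/
theorem logWeight_sampleShape {v h ℓ : ℕ} (hvh : v + h = G.nv + G.nh) (x : ℕ → Bool)
    (y : Fin h → Bool) (z : G.Config)
    (hz : ∀ i : Fin (G.nv + G.nh),
      (if (i : ℕ) < v then x i else Shape.extend y (i - v)) = z i)
    (θ : G.Params) (μ : Fin h → ℝ) (logZ κ : ℝ) :
    (G.sampleShape v h ℓ).logWeight (fun q => (G.inputNumbers θ μ logZ κ).getD q 0) x
        (Shape.extend y) =
      -G.energy θ z - logZ - Real.log κ -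
        ∑ i, (if y i then Real.log (μ i) else Real.log (1 - μ i)) := by
  have hT : (G.sampleShape v h ℓ).terms =
      (G.nv + G.nh) + (G.numEdges + (h + (h + 2))) := by
    rw [terms_sampleShape, hvh]
    ring
  have hP : (G.sampleShape v h ℓ).params = (G.nv + G.nh) + G.numEdges := by
    rw [params_sampleShape, hvh]
  have hU : (G.sampleShape v h ℓ).units = G.nv + G.nh := by rw [units_sampleShape, hvh]
  have h21 : (G.sampleShape v h ℓ).2.1 = h := rfl
  have h1 : (G.sampleShape v h ℓ).1 = v := rfl
  have hE : ∀ e : Fin G.numEdges, (G.sampleShape v h ℓ).2.2.1.getD e (0, 0) =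
      (((G.ends e).1 : ℕ), ((G.ends e).2 : ℕ)) := by
    intro e
    simp [sampleShape, shape, List.getD_eq_getElem?_getD]
  -- the five groups of summands
  have a1 : ∀ i : Fin (G.nv + G.nh),
      (G.sampleShape v h ℓ).gateVal x (Shape.extend y) i = z i := by
    intro i
    simp only [Shape.gateVal, hU, h1]
    rw [if_pos i.2, hz]
  have a2 : ∀ e : Fin G.numEdges, (G.sampleShape v h ℓ).gateVal x (Shape.extend y)
      (G.nv + G.nh + e) = (z (G.ends e).1 && z (G.ends e).2) := by
    intro e
    simp only [Shape.gateVal, hU, h1, hP]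
    rw [if_neg (by omega), if_pos (by omega), Nat.add_sub_cancel_left, hE, hz, hz]
  have a3 : ∀ i : Fin h, (G.sampleShape v h ℓ).gateVal x (Shape.extend y)
      (G.nv + G.nh + (G.numEdges + i)) = y i := by
    intro i
    simp only [Shape.gateVal, hU, h1, hP, h21]
    rw [if_neg (by omega), if_neg (by omega), if_pos (by omega), ← Nat.add_assoc,
      Nat.add_sub_cancel_left, extend_val]
  have a4 : ∀ i : Fin h, (G.sampleShape v h ℓ).gateVal x (Shape.extend y)
      (G.nv + G.nh + (G.numEdges + (h + i))) = !y i := by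
    intro i
    simp only [Shape.gateVal, hU, h1, hP, h21]
    rw [if_neg (by omega), if_neg (by omega), if_neg (by omega), if_pos (by omega),
      ← Nat.add_assoc, Nat.add_sub_cancel_left, Nat.add_sub_cancel_left, extend_val]
  have a5 : ∀ i : ℕ, (G.sampleShape v h ℓ).gateVal x (Shape.extend y)
      (G.nv + G.nh + (G.numEdges + (h + (h + i)))) = true := by
    intro i
    simp only [Shape.gateVal, hU, h1, hP, h21]
    rw [if_neg (by omega), if_neg (by omega), if_neg (by omega), if_neg (by omega)]
  have b1 : ∀ i : Fin (G.nv + G.nh),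
      ¬ (G.nv + G.nh + G.numEdges ≤ i) := fun i => by have := i.2; omega
  have b2 : ∀ e : Fin G.numEdges,
      ¬ (G.nv + G.nh + G.numEdges ≤ G.nv + G.nh + e) := fun e => by have := e.2; omega
  have b3 : ∀ i, G.nv + G.nh + G.numEdges ≤ G.nv + G.nh + (G.numEdges + i) := fun i => by omega
  rw [Shape.logWeight, hT, Finset.sum_range_add _ (G.nv + G.nh), Finset.sum_range_add _ G.numEdges,
    Finset.sum_range_add _ h (h + 2), Finset.sum_range_add _ h 2]
  simp only [Finset.sum_range, hP, a1, a2, a3, a4, a5, b1, b2, b3, if_true, if_false, inputNumbers,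
    getD_ofFn_append_left, getD_ofFn_append_right]
  rw [Fin.sum_univ_two, energy, neg_sub, sub_neg_eq_add]
  have c1 : ∑ i, (if y i then Real.log (μ i) else Real.log (1 - μ i)) =
      -(∑ i, (if y i = true then -Real.log (μ i) else 0) +
        ∑ i, (if (!y i) = true then -Real.log (1 - μ i) else 0)) := by
    rw [← Finset.sum_add_distrib, ← Finset.sum_neg_distrib]
    refine Finset.sum_congr rfl fun i _ => ?_
    cases y i <;> simp
  have c2 : ∀ i, (if z i = true then θ (Sum.inl i) else 0) =
      θ (Sum.inl i) * G.statistic z (Sum.inl i) := by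
    intro i
    cases h : z i <;> simp [statistic, h]
  have c3 : ∀ e, (if (z (G.ends e).1 && z (G.ends e).2) = true then θ (Sum.inr e) else 0) =
      θ (Sum.inr e) * G.statistic z (Sum.inr e) := by
    intro e
    cases h : z (G.ends e).1 <;> cases h' : z (G.ends e).2 <;> simp [statistic, h, h']
  simp only [c1, c2, c3, Fin.val_zero, Fin.val_one, List.getD_cons_zero, List.getD_cons_succ]
  ring

theorem log_productDist {m : ℕ} {μ : Fin m → ℝ} (h0 : ∀ i, 0 < μ i) (h1 : ∀ i, μ i < 1)
    (y : Fin m → Bool) :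
    Real.log (productDist μ y) = ∑ i, (if y i then Real.log (μ i) else Real.log (1 - μ i)) := by
  rw [productDist, Real.log_prod]
  · exact Finset.sum_congr rfl fun i _ => by split_ifs <;> rfl
  · intro i _
    split_ifs
    · exact (h0 i).ne'
    · linarith [h1 i]

theorem statistic_mem_Icc (z : G.Config) (c : Fin (G.nv + G.nh) ⊕ Fin G.numEdges) :
    G.statistic z c ∈ Set.Icc (0 : ℝ) 1 := by
  rcases c with i | e
  · simp only [statistic]
    split_ifs <;> simp
  · simp only [statistic]
    split_ifs <;> simp

theorem abs_energy_le {θ : G.Params} {b : ℝ} (hθ : ∀ c, |θ c| ≤ b) (z : G.Config) :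
    |G.energy θ z| ≤ (G.nv + G.nh + G.numEdges) * b := by
  have h : ∀ c, |θ c * G.statistic z c| ≤ b := by
    intro c
    have hs := G.statistic_mem_Icc z c
    rw [abs_mul, abs_of_nonneg hs.1]
    exact (mul_le_of_le_one_right (abs_nonneg _) hs.2).trans (hθ c)
  have e : -G.energy θ z = ∑ c, θ c * G.statistic z c := by
    rw [energy, Fintype.sum_sum_type]
    ring
  rw [← abs_neg, e]
  refine (Finset.abs_sum_le_sum_abs _ _).trans ((Finset.sum_le_sum fun c _ => h c).trans ?_)
  simp

/-- Connectedness bounds the number of units by the number of edges, so that the size of the circuit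
is linear in the latter. -/
theorem units_le_of_connected (hG : G.graph.Connected) : G.nv + G.nh ≤ G.numEdges + 1 := by
  have h := hG.card_vert_le_card_edgeSet_add_one
  have hsub : G.graph.edgeSet ⊆ Set.range fun e => s((G.ends e).1, (G.ends e).2) := by
    intro e
    induction e using Sym2.ind with
    | _ a b =>
      rw [SimpleGraph.mem_edgeSet, graph, SimpleGraph.fromRel_adj]
      rintro ⟨-, ⟨e, he⟩ | ⟨e, he⟩⟩
      · exact ⟨e, by simp [he]⟩
      · exact ⟨e, by simp [he, Sym2.eq_swap]⟩
  have hcard : Nat.card G.graph.edgeSet ≤ G.numEdges := by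
    rw [Nat.card_coe_set_eq]
    refine (Set.ncard_le_ncard hsub (Set.finite_range _)).trans ?_
    rw [← Set.image_univ]
    refine (Set.ncard_image_le Set.finite_univ).trans ?_
    simp [Set.ncard_univ]
  rw [Nat.card_eq_fintype_card (α := Fin _), Fintype.card_fin] at h
  omega

/-- A run that samples `h` of the units, with the values of the others given by the bits `xs`. -/
theorem sampleShape_run_spec (hG : G.graph.Connected) (hE : 1 ≤ G.numEdges) {ℓ : ℕ} (hl : 1 ≤ ℓ)
    (hEl : (G.numEdges : ℝ) ≤ 2 ^ ℓ) {θ : G.Params} (hθ : ∀ c, |θ c| ≤ 2 ^ ℓ) {v h : ℕ}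
    (hvh : v + h = G.nv + G.nh) {xs : List Bool} (hxs : xs.length = v)
    {z : (Fin h → Bool) → G.Config}
    (hz : ∀ y, ∀ i : Fin (G.nv + G.nh),
      (if (i : ℕ) < v then xs.getD i false else Shape.extend y (i - v)) = z y i)
    {μ : Fin h → ℝ} {κ : ℝ} (hμ : ∀ i, μ i ∈ Set.Icc (0 : ℝ) 1)
    (hκ : IsKappa (fun y => G.energy θ (z y)) μ κ) (hκl : κ ≤ 2 ^ ℓ) {input : List Bool}
    (hinput : input =
      G.encodeInput (20 * ℓ) θ μ (logZQ (fun y => G.energy θ (z y)) μ) κ ++ xs)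
    {law : (Fin h → Bool) → ℝ}
    (hlaw : law = outputLaw (G.sampleShape v h ℓ).run input h) :
    (∀ y, 0 ≤ law y) ∧ ∑ y, law y = 1 ∧
    ∑ y, |law y - gibbs (fun y => G.energy θ (z y)) y| ≤ (1 / 2) ^ (11 * ℓ) ∧
    expectedOps (G.sampleShape v h ℓ).run input h ≤ ENNReal.ofReal
      (10 ^ 8 * G.numEdges * Real.sqrt κ * ℓ ^ 3) := by
  set s := G.sampleShape v h ℓ with hs
  set H : (Fin h → Bool) → ℝ := fun y => G.energy θ (z y) with hH
  have hn := G.units_le_of_connected hG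
  have hterms : s.terms ≤ 9 * G.numEdges := by
    rw [hs, terms_sampleShape]
    omega
  have hterms' : (s.terms : ℝ) ≤ 9 * G.numEdges := by exact_mod_cast hterms
  have hl2 : (2 : ℝ) ≤ 2 ^ ℓ := le_self_pow₀ (by norm_num) (by omega)
  have hpos := hκ.pos hμ
  have hnum : (G.inputNumbers θ μ (logZQ H μ) κ).length = s.terms := by
    rw [length_inputNumbers, hs, terms_sampleShape, hvh]
  have hbits : s.bits = 2 * (20 * ℓ) := rfl
  have hinput' : input = (G.inputNumbers θ μ (logZQ H μ) κ).flatMap (encodeReal (20 * ℓ)) ++ xs := by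
    rw [hinput, encodeInput_eq]
  have hflat := length_flatMap_of_length (length_encodeReal (20 * ℓ))
    (G.inputNumbers θ μ (logZQ H μ) κ)
  have hspec := s.run_spec (H := H) (M := (G.nv + G.nh + G.numEdges) * 2 ^ ℓ) (input := input)
    (r := fun q => (G.inputNumbers θ μ (logZQ H μ) κ).getD q 0) hl ?_ ?_ ?_ ?_ hκ hμ ?_ ?_ hκl ?_ ?_
  · rw [hlaw]
    obtain ⟨p1, p2, p3, p4⟩ := hspec
    refine ⟨p1, p2, p3, p4.trans (ENNReal.ofReal_le_ofReal ?_)⟩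
    have hl1 : (1 : ℝ) ≤ ℓ := by exact_mod_cast hl
    calc (60000 * s.terms * (ℓ : ℝ) ^ 2 * (19 * (ℓ + 2) * (3 * Real.sqrt κ)) : ℝ)
        ≤ 60000 * (9 * G.numEdges) * (ℓ : ℝ) ^ 2 * (19 * (3 * ℓ) * (3 * Real.sqrt κ)) := by
          gcongr
          linarith
      _ = 92340000 * (G.numEdges * Real.sqrt κ * ℓ ^ 3) := by ring
      _ ≤ 10 ^ 8 * (G.numEdges * Real.sqrt κ * ℓ ^ 3) := by gcongr; norm_num
      _ = _ := by ring
  · calc (s.terms : ℝ) ≤ 9 * G.numEdges := hterms'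
      _ ≤ 2 ^ ℓ * 2 ^ 4 := by linarith
      _ = _ := (pow_add _ _ _).symm
  · intro e he
    rw [hs, units_sampleShape, hvh]
    obtain ⟨e, rfl⟩ := (List.mem_ofFn' _ _).1 he
    exact ⟨(G.ends e).1.2, (G.ends e).2.2⟩
  · rw [hinput', List.length_append, hflat, hnum, hxs]
    rfl
  · intro q hq j hj
    rw [hinput', hbits, getD_flatMap_of_length (length_encodeReal (20 * ℓ)) false 0 _ _ xs rfl
      (by rw [hnum]; exact hq) hj]
    exact getD_encodeReal (p := 20 * ℓ) hj _
  · have hP : s.params = G.nv + G.nh + G.numEdges := by rw [hs, params_sampleShape, hvh]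
    intro (i : Fin h)
    simp only [hP, inputNumbers, Nat.add_assoc (G.nv + G.nh)]
    rw [getD_ofFn_append_right, getD_ofFn_append_right, getD_ofFn_append_left]
  · intro (y : Fin h → Bool)
    have e : logRatio H μ κ y = -H y - logZQ H μ - Real.log κ -
        ∑ i, (if y i then Real.log (μ i) else Real.log (1 - μ i)) := by
      rw [logRatio, log_productDist (fun i => (hpos i).1) fun i => (hpos i).2]
    refine Eq.trans ?_ e.symm
    refine G.logWeight_sampleShape hvh _ y (z y) (fun i => ?_) θ μ _ κ
    rw [← hz y i]
    congr 1
    rw [hinput', List.getD_append_right _ _ _ _ (by rw [hflat, hnum, hbits]; omega), hflat, hnum,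
      hbits, Nat.add_sub_cancel_left]
  · exact fun y => G.abs_energy_le hθ _
  · have h1 : ((G.nv + G.nh : ℕ) : ℝ) ≤ 2 * 2 ^ ℓ := by
      have : ((G.nv + G.nh : ℕ) : ℝ) ≤ G.numEdges + 1 := by exact_mod_cast hn
      linarith
    have h2 : (h : ℝ) ≤ 2 * 2 ^ ℓ := le_trans (by exact_mod_cast (by omega)) h1
    have h3 : Real.log κ ≤ 2 ^ ℓ := (Real.log_le_self hκ.1.le).trans hκl
    push_cast at h1
    have h4 : (2 : ℝ) ^ (20 * ℓ) = (2 ^ ℓ) ^ 20 := by rw [← pow_mul]; ring_nf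
    change 2 * (((G.nv : ℝ) + G.nh + G.numEdges) * 2 ^ ℓ) + (h : ℝ) + Real.log κ ≤
      2 ^ (20 * ℓ) - 1
    rw [h4]
    generalize (2 : ℝ) ^ ℓ = t at *
    have h5 : (2 : ℝ) ^ 18 ≤ t ^ 18 := by gcongr
    have h6 : t ^ 20 = t ^ 18 * t ^ 2 := by ring
    have h7 : ((G.nv : ℝ) + G.nh + G.numEdges) * t ≤ (3 * t) * t := by gcongr; linarith
    rw [h6]
    nlinarith

end BMGraph

/-! ### Moments under product distributions -/

section Moments

variable {α : Type*} [Fintype α]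

/-- The mean of a sum of independent centered variables vanishes. -/
theorem sum_prod_mul_sum_eq_zero : ∀ {m : ℕ} {f u : Fin m → α → ℝ} (_ : ∀ i, ∑ a, f i a = 1)
    (_ : ∀ i, ∑ a, f i a * u i a = 0),
    ∑ z : Fin m → α, (∏ i, f i (z i)) * ∑ i, u i (z i) = 0
  | 0, f, u, _, _ => by simp
  | m + 1, f, u, hf, hu => by
    have ih := sum_prod_mul_sum_eq_zero (m := m) (f := fun i => f i.succ)
      (u := fun i => u i.succ) (fun i => hf _) (fun i => hu _)
    rw [← (Fin.consEquiv fun _ => α).sum_comp, Fintype.sum_prod_type]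
    simp only [Fin.consEquiv_apply, Fin.prod_univ_succ, Fin.sum_univ_succ, Fin.cons_zero,
      Fin.cons_succ]
    have e : ∀ a (z : Fin m → α), f 0 a * (∏ i : Fin m, f i.succ (z i)) *
        (u 0 a + ∑ i : Fin m, u i.succ (z i)) =
        (f 0 a * u 0 a) * (∏ i : Fin m, f i.succ (z i)) +
          f 0 a * ((∏ i : Fin m, f i.succ (z i)) * ∑ i : Fin m, u i.succ (z i)) := by
      intro a z
      ring
    simp only [e, Finset.sum_add_distrib, ← Finset.mul_sum, ih, mul_zero, ← Finset.sum_mul, hu 0, zero_mul, add_zero]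

/-- The second moment of a sum of independent centered variables. -/
theorem sum_prod_mul_sum_sq [DecidableEq α] : ∀ {m : ℕ} {f u : Fin m → α → ℝ} (_ : ∀ i, ∑ a, f i a = 1)
    (_ : ∀ i, ∑ a, f i a * u i a = 0),
    ∑ z : Fin m → α, (∏ i, f i (z i)) * (∑ i, u i (z i)) ^ 2 = ∑ i, ∑ a, f i a * u i a ^ 2
  | 0, f, u, _, _ => by simp
  | m + 1, f, u, hf, hu => by
    have ih := sum_prod_mul_sum_sq (m := m) (f := fun i => f i.succ)
      (u := fun i => u i.succ) (fun i => hf _) (fun i => hu _)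
    rw [← (Fin.consEquiv fun _ => α).sum_comp, Fintype.sum_prod_type, Fin.sum_univ_succ]
    simp only [Fin.consEquiv_apply, Fin.prod_univ_succ, Fin.sum_univ_succ, Fin.cons_zero,
      Fin.cons_succ]
    have e : ∀ a (z : Fin m → α), f 0 a * (∏ i : Fin m, f i.succ (z i)) *
        (u 0 a + ∑ i : Fin m, u i.succ (z i)) ^ 2 =
        (f 0 a * u 0 a ^ 2) * (∏ i : Fin m, f i.succ (z i)) + (f 0 a * u 0 a) *
          (2 * ((∏ i : Fin m, f i.succ (z i)) * ∑ i : Fin m, u i.succ (z i))) +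
          f 0 a * ((∏ i : Fin m, f i.succ (z i)) * (∑ i : Fin m, u i.succ (z i)) ^ 2) := by
      intro a z
      ring
    simp only [e, Finset.sum_add_distrib, ← Finset.mul_sum, ih, ← Finset.sum_mul, hu 0, zero_mul,
      add_zero, hf 0, one_mul, sum_prod_eq_one fun i => hf (Fin.succ i), mul_one]

end Moments

/-- A variable with values in `[0, 1]` has variance at most `1 / 4`. -/
theorem sum_mul_sub_sq_le {α : Type*} [Fintype α] {f X : α → ℝ} (hf0 : ∀ a, 0 ≤ f a)
    (hf : ∑ a, f a = 1) (hX : ∀ a, X a ∈ Set.Icc (0 : ℝ) 1) :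
    ∑ a, f a * (X a - ∑ b, f b * X b) ^ 2 ≤ 1 / 4 := by
  set m := ∑ b, f b * X b with hm
  calc ∑ a, f a * (X a - m) ^ 2 ≤ ∑ a, (f a * X a - 2 * m * (f a * X a) + f a * m ^ 2) := by
        refine Finset.sum_le_sum fun a _ => ?_
        have h : X a ^ 2 ≤ X a := by nlinarith [(hX a).1, (hX a).2]
        nlinarith [mul_le_mul_of_nonneg_left h (hf0 a)]
    _ = m - m ^ 2 := by
        rw [Finset.sum_add_distrib, Finset.sum_sub_distrib, ← Finset.mul_sum, ← Finset.sum_mul, hf,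
          ← hm]
        ring
    _ ≤ 1 / 4 := by nlinarith [sq_nonneg (m - 1 / 2)]

theorem sum_mul_sub_mean {α : Type*} [Fintype α] {f X : α → ℝ} (hf : ∑ a, f a = 1) :
    ∑ a, f a * (X a - ∑ b, f b * X b) = 0 := by
  simp only [mul_sub, Finset.sum_sub_distrib, ← Finset.sum_mul, hf, one_mul, sub_self]

theorem mean_mem_Icc {α : Type*} [Fintype α] {f X : α → ℝ} (hf0 : ∀ a, 0 ≤ f a)
    (hf : ∑ a, f a = 1) (hX : ∀ a, X a ∈ Set.Icc (0 : ℝ) 1) :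
    ∑ b, f b * X b ∈ Set.Icc (0 : ℝ) 1 := by
  refine ⟨Finset.sum_nonneg fun a _ => mul_nonneg (hf0 a) (hX a).1, ?_⟩
  rw [← hf]
  exact Finset.sum_le_sum fun a _ => mul_le_of_le_one_right (hf0 a) (hX a).2

/-! ### The joint law of the samples -/

theorem sum_sum_eq_sum_pairs {N : ℕ} {A B : Type*} [Fintype A] [Fintype B] [DecidableEq A]
    [DecidableEq B] (F : (Fin N → A) → (Fin N → B) → ℝ) :
    ∑ s, ∑ t, F s t = ∑ z : Fin N → A × B, F (fun k => (z k).1) fun k => (z k).2 := by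
  rw [← Fintype.sum_prod_type',
    ← (Equiv.arrowProdEquivProdArrow (Fin N) (fun _ => A) fun _ => B).sum_comp]
  rfl

theorem sum_mul_eq_one {A B : Type*} [Fintype A] [Fintype B] {P : A → ℝ} {R : B → ℝ}
    (hP : ∑ a, P a = 1) (hR : ∑ b, R b = 1) : ∑ c : A × B, P c.1 * R c.2 = 1 := by
  rw [Fintype.sum_prod_type]
  simp only [← Finset.mul_sum, hR, mul_one, hP]

theorem sum_abs_mul_sub_mul_le {A B : Type*} [Fintype A] [Fintype B] {P P' : A → ℝ} {R R' : B → ℝ}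
    (hP' : ∑ a, P' a = 1) (hP0 : ∀ a, 0 ≤ P' a) (hR : ∑ b, R b = 1) (hR0 : ∀ b, 0 ≤ R b) :
    ∑ c : A × B, |P c.1 * R c.2 - P' c.1 * R' c.2| ≤ ∑ a, |P a - P' a| + ∑ b, |R b - R' b| := by
  calc _ ≤ ∑ c : A × B, (|P c.1 - P' c.1| * R c.2 + P' c.1 * |R c.2 - R' c.2|) := by
        refine Finset.sum_le_sum fun c _ => ?_
        have e : P c.1 * R c.2 - P' c.1 * R' c.2 =
          (P c.1 - P' c.1) * R c.2 + P' c.1 * (R c.2 - R' c.2) := by ring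
        rw [e]
        refine (abs_add_le _ _).trans (le_of_eq ?_)
        rw [abs_mul, abs_mul, abs_of_nonneg (hR0 _), abs_of_nonneg (hP0 _)]
    _ = _ := by
        rw [Fintype.sum_prod_type]
        simp only [Finset.sum_add_distrib, ← Finset.mul_sum, ← Finset.sum_mul, hR, hP', mul_one,
          one_mul]

namespace BMGraph

variable (G : BMGraph) {N : ℕ}

theorem sum_jointLaw {P : G.Config → ℝ} {R : Fin N → G.Hidden → ℝ} (hP : ∑ z, P z = 1)
    (hR : ∀ k, ∑ h, R k h = 1) : ∑ s, ∑ t, G.jointLaw P R s t = 1 := by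
  rw [sum_sum_eq_sum_pairs]
  exact sum_prod_eq_one (f := fun k (c : G.Config × G.Hidden) => P c.1 * R k c.2)
    fun k => sum_mul_eq_one hP (hR k)

/-- Telescoping over the `N` pairs of samples. -/
theorem sum_abs_jointLaw_sub_le {P P' : G.Config → ℝ} {R R' : Fin N → G.Hidden → ℝ}
    (hP0 : ∀ z, 0 ≤ P z) (hP : ∑ z, P z = 1) (hP0' : ∀ z, 0 ≤ P' z) (hP' : ∑ z, P' z = 1)
    (hR0 : ∀ k h, 0 ≤ R k h) (hR : ∀ k, ∑ h, R k h = 1) (hR0' : ∀ k h, 0 ≤ R' k h)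
    (hR' : ∀ k, ∑ h, R' k h = 1) {ε : ℝ} (hPε : ∑ z, |P z - P' z| ≤ ε)
    (hRε : ∀ k, ∑ h, |R k h - R' k h| ≤ ε) :
    ∑ s, ∑ t, |G.jointLaw P R s t - G.jointLaw P' R' s t| ≤ N * (2 * ε) := by
  rw [sum_sum_eq_sum_pairs]
  refine (sum_abs_prod_sub_prod_le (f := fun k (c : G.Config × G.Hidden) => P c.1 * R k c.2)
    (g := fun k (c : G.Config × G.Hidden) => P' c.1 * R' k c.2)
    (fun k c => mul_nonneg (hP0 _) (hR0 _ _)) (fun k c => mul_nonneg (hP0' _) (hR0' _ _))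
    (fun k => sum_mul_eq_one hP (hR k)) fun k => sum_mul_eq_one hP' (hR' k)).trans ?_
  calc _ ≤ ∑ _k : Fin N, 2 * ε := Finset.sum_le_sum fun k _ =>
        (sum_abs_mul_sub_mul_le hP' hP0' (hR k) (hR0 k)).trans (by linarith [hRε k])
    _ = _ := by simp

/-- The mean of the estimate under exact samples. -/
def exactMean (x : Fin N → G.Visible) (lam : ℝ) (θ : G.Params) (P : G.Config → ℝ)
    (R : Fin N → G.Hidden → ℝ) (c : Fin (G.nv + G.nh) ⊕ Fin G.numEdges) : ℝ :=
  (1 / (N : ℝ)) * ∑ k, (∑ h, R k h * G.statistic (G.join (x k) h) c - ∑ z, P z * G.statistic z c)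
    - lam * G.regularized θ c

section Estimate

variable {x : Fin N → G.Visible} {lam : ℝ} {θ : G.Params} {P : G.Config → ℝ}
  {R : Fin N → G.Hidden → ℝ} {c : Fin (G.nv + G.nh) ⊕ Fin G.numEdges}

/-- The deviation of the pair `(s k, t k)` of samples from its mean. -/
def deviation (x : Fin N → G.Visible) (P : G.Config → ℝ) (R : Fin N → G.Hidden → ℝ)
    (c : Fin (G.nv + G.nh) ⊕ Fin G.numEdges) (k : Fin N) (a : G.Config × G.Hidden) : ℝ :=
  (G.statistic (G.join (x k) a.2) c - ∑ h, R k h * G.statistic (G.join (x k) h) c) -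
    (G.statistic a.1 c - ∑ z, P z * G.statistic z c)

theorem estimate_sub_exactMean (s : Fin N → G.Config) (t : Fin N → G.Hidden) :
    G.estimate x lam θ s t c - G.exactMean x lam θ P R c =
      (1 / (N : ℝ)) * ∑ k, G.deviation x P R c k (s k, t k) := by
  simp only [estimate, exactMean, deviation, Finset.sum_sub_distrib]
  ring

variable (hP0 : ∀ z, 0 ≤ P z) (hP : ∑ z, P z = 1) (hR0 : ∀ k h, 0 ≤ R k h)
  (hR : ∀ k, ∑ h, R k h = 1)
include hP hR

theorem sum_mul_deviation (k : Fin N) :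
    ∑ a : G.Config × G.Hidden, P a.1 * R k a.2 * G.deviation x P R c k a = 0 := by
  have e : ∀ a b, P a * R k b * G.deviation x P R c k (a, b) =
      P a * (R k b * (G.statistic (G.join (x k) b) c -
        ∑ h, R k h * G.statistic (G.join (x k) h) c)) -
      P a * (G.statistic a c - ∑ z, P z * G.statistic z c) * R k b := by
    intro a b
    rw [deviation]
    ring
  rw [Fintype.sum_prod_type]
  simp only [e, Finset.sum_sub_distrib, ← Finset.mul_sum, sum_mul_sub_mean (hR k), mul_zero,
    Finset.sum_const_zero, hR k, mul_one, sum_mul_sub_mean hP, sub_zero]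

include hP0 hR0

/-- The cross term vanishes by independence, and each of the two variances is at most `1 / 4`. -/
theorem sum_mul_deviation_sq_le (k : Fin N) :
    ∑ a : G.Config × G.Hidden, P a.1 * R k a.2 * G.deviation x P R c k a ^ 2 ≤ 1 / 2 := by
  set p := fun b => G.statistic (G.join (x k) b) c -
    ∑ h, R k h * G.statistic (G.join (x k) h) c with hp
  set q := fun a => G.statistic a c - ∑ z, P z * G.statistic z c with hq
  have e : ∀ a b, P a * R k b * G.deviation x P R c k (a, b) ^ 2 =
      P a * (R k b * p b ^ 2) - 2 * (P a * q a) * (R k b * p b) + P a * q a ^ 2 * R k b := by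
    intro a b
    rw [deviation]
    ring
  have h1 : ∑ b, R k b * p b = 0 := sum_mul_sub_mean (hR k)
  have h2 := sum_mul_sub_sq_le (hR0 k) (hR k)
    (fun h => G.statistic_mem_Icc (G.join (x k) h) c)
  have h3 := sum_mul_sub_sq_le hP0 hP (fun z => G.statistic_mem_Icc z c)
  rw [Fintype.sum_prod_type]
  simp only [e, Finset.sum_add_distrib, Finset.sum_sub_distrib, ← Finset.mul_sum, h1, mul_zero, hR k, mul_one, ← Finset.sum_mul, hP, one_mul, sub_zero]
  linarith

theorem abs_deviation_le (k : Fin N) (a : G.Config × G.Hidden) :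
    |G.deviation x P R c k a| ≤ 2 := by
  have h1 := G.statistic_mem_Icc (G.join (x k) a.2) c
  have h2 := G.statistic_mem_Icc a.1 c
  have h3 := mean_mem_Icc (hR0 k) (hR k) fun h => G.statistic_mem_Icc (G.join (x k) h) c
  have h4 := mean_mem_Icc hP0 hP fun z => G.statistic_mem_Icc z c
  rw [deviation, abs_le]
  constructor <;> linarith [h1.1, h1.2, h2.1, h2.2, h3.1, h3.2, h4.1, h4.2]

theorem abs_estimate_sub_exactMean_le (hN : 1 ≤ N) (s : Fin N → G.Config) (t : Fin N → G.Hidden) :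
    |G.estimate x lam θ s t c - G.exactMean x lam θ P R c| ≤ 2 := by
  have hN0 : (0 : ℝ) < N := by exact_mod_cast hN
  rw [estimate_sub_exactMean, abs_mul, abs_of_pos (by positivity), one_div, inv_mul_le_iff₀ hN0]
  refine (Finset.abs_sum_le_sum_abs _ _).trans ?_
  calc _ ≤ ∑ _k : Fin N, (2 : ℝ) :=
        Finset.sum_le_sum fun k _ => G.abs_deviation_le hP0 hP hR0 hR k _
    _ = _ := by simp

/-- With exact samples the estimate is unbiased and has variance at most `1 / (2 N)`. -/
theorem moments_estimate (hN : 1 ≤ N) :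
    ∑ s, ∑ t, G.jointLaw P R s t * (G.estimate x lam θ s t c - G.exactMean x lam θ P R c) = 0 ∧
    ∑ s, ∑ t, G.jointLaw P R s t *
      (G.estimate x lam θ s t c - G.exactMean x lam θ P R c) ^ 2 ≤ 1 / (2 * N) := by
  have hN0 : (0 : ℝ) < N := by exact_mod_cast hN
  have hf := fun k => sum_mul_eq_one hP (hR k)
  have hu := fun k => G.sum_mul_deviation (x := x) (c := c) hP hR k
  constructor
  · rw [sum_sum_eq_sum_pairs]
    simp only [estimate_sub_exactMean, jointLaw, mul_left_comm _ (1 / (N : ℝ)),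
      ← Finset.mul_sum]
    have h := sum_prod_mul_sum_eq_zero (f := fun k (a : G.Config × G.Hidden) => P a.1 * R k a.2)
      (u := G.deviation x P R c) hf hu
    rw [mul_eq_zero]
    exact Or.inr h
  · rw [sum_sum_eq_sum_pairs]
    simp only [estimate_sub_exactMean, jointLaw, mul_pow, mul_left_comm _ ((1 / (N : ℝ)) ^ 2),
      ← Finset.mul_sum]
    have h := sum_prod_mul_sum_sq (f := fun k (a : G.Config × G.Hidden) => P a.1 * R k a.2)
      (u := G.deviation x P R c) hf hu
    have h2 : ∑ k : Fin N, ∑ a : G.Config × G.Hidden,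
        P a.1 * R k a.2 * G.deviation x P R c k a ^ 2 ≤ N * (1 / 2) := by
      calc _ ≤ ∑ _k : Fin N, (1 / 2 : ℝ) :=
            Finset.sum_le_sum fun k _ => G.sum_mul_deviation_sq_le hP0 hP hR0 hR k
        _ = _ := by simp
    calc _ ≤ (1 / (N : ℝ)) ^ 2 * (N * (1 / 2)) := by
          refine mul_le_mul_of_nonneg_left ?_ (by positivity)
          exact h.trans_le h2
      _ = _ := by field_simp

end Estimate

/-- Replacing the exact samples by samples whose joint law is `ε`-close in `ℓ¹` changes the mean of
the estimate by at most `2 ε` and its second moment by at most `4 ε`. -/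
theorem moments_estimate_of_close {x : Fin N → G.Visible} {lam : ℝ} {θ : G.Params}
    {P : G.Config → ℝ} {R : Fin N → G.Hidden → ℝ} {c : Fin (G.nv + G.nh) ⊕ Fin G.numEdges}
    (hP0 : ∀ z, 0 ≤ P z) (hP : ∑ z, P z = 1) (hR0 : ∀ k h, 0 ≤ R k h) (hR : ∀ k, ∑ h, R k h = 1)
    (hN : 1 ≤ N) {law : (Fin N → G.Config) → (Fin N → G.Hidden) → ℝ}
    (hlaw : ∑ s, ∑ t, law s t = 1) {ε : ℝ}
    (hε : ∑ s, ∑ t, |law s t - G.jointLaw P R s t| ≤ ε) :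
    |(∑ s, ∑ t, law s t * G.estimate x lam θ s t c) - G.exactMean x lam θ P R c| ≤ 2 * ε ∧
    ∑ s, ∑ t, law s t * (G.estimate x lam θ s t c - G.exactMean x lam θ P R c) ^ 2 ≤
      1 / (2 * N) + 4 * ε := by
  obtain ⟨h1, h2⟩ := G.moments_estimate (x := x) (lam := lam) (θ := θ) (c := c) hP0 hP hR0 hR hN
  have hD := G.abs_estimate_sub_exactMean_le (x := x) (lam := lam) (θ := θ) (c := c) hP0 hP hR0 hR hN
  set m := G.exactMean x lam θ P R c
  rw [sum_sum_eq_sum_pairs] at hlaw hε h1 h2 ⊢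
  rw [sum_sum_eq_sum_pairs]
  set F := fun z : Fin N → G.Config × G.Hidden => law (fun k => (z k).1) fun k => (z k).2
  set J := fun z : Fin N → G.Config × G.Hidden =>
    G.jointLaw P R (fun k => (z k).1) fun k => (z k).2
  set D := fun z : Fin N → G.Config × G.Hidden =>
    G.estimate x lam θ (fun k => (z k).1) (fun k => (z k).2) c - m with hDdef
  change ∑ z, F z = 1 at hlaw
  change ∑ z, |F z - J z| ≤ ε at hε
  change ∑ z, J z * D z = 0 at h1
  change ∑ z, J z * D z ^ 2 ≤ _ at h2
  have hD' : ∀ z, |D z| ≤ 2 := fun z => hD _ _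
  have key : ∀ (g : (Fin N → G.Config × G.Hidden) → ℝ) (b : ℝ), (∀ z, |g z| ≤ b) → 0 ≤ b →
      |∑ z, F z * g z - ∑ z, J z * g z| ≤ b * ε := by
    intro g b hg hb
    rw [← Finset.sum_sub_distrib]
    refine (Finset.abs_sum_le_sum_abs _ _).trans ?_
    calc _ ≤ ∑ z, b * |F z - J z| := by
          refine Finset.sum_le_sum fun z _ => ?_
          rw [← sub_mul, abs_mul, mul_comm]
          exact mul_le_mul_of_nonneg_right (hg z) (abs_nonneg _)
      _ ≤ b * ε := by
          rw [← Finset.mul_sum]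
          exact mul_le_mul_of_nonneg_left hε hb
  constructor
  · have e : (∑ z : Fin N → G.Config × G.Hidden, law (fun k => (z k).1) (fun k => (z k).2) *
        G.estimate x lam θ (fun k => (z k).1) (fun k => (z k).2) c) - m = ∑ z, F z * D z := by
      simp only [hDdef, mul_sub, Finset.sum_sub_distrib, ← Finset.sum_mul, hlaw, one_mul]
      rfl
    rw [e]
    have h := key D 2 hD' (by norm_num)
    rwa [h1, sub_zero] at h
  · have h := key (fun z => D z ^ 2) 4 (fun z => by
      rw [abs_pow]
      calc |D z| ^ 2 ≤ 2 ^ 2 := by gcongr; exact hD' z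
        _ = 4 := by norm_num) (by norm_num)
    have h3 := (abs_le.1 h).2
    change ∑ z, F z * D z ^ 2 ≤ _
    linarith

/-! ### The gradient of the objective -/

theorem neg_energy_eq (θ : G.Params) (z : G.Config) :
    -G.energy θ z = innerSL ℝ (WithLp.toLp 2 (G.statistic z)) θ := by
  rw [energy, innerSL_apply_apply, PiLp.inner_apply, Fintype.sum_sum_type]
  simp only [RCLike.inner_apply, conj_trivial]
  ring

/-- The derivative of the log partition function of a family of configurations is the mean of the
statistics. -/
theorem hasFDerivAt_log_partitionFn {m : ℕ} (z : (Fin m → Bool) → G.Config) (θ : G.Params) :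
    HasFDerivAt (fun θ : G.Params => Real.log (partitionFn fun y => G.energy θ (z y)))
      ((partitionFn fun y => G.energy θ (z y))⁻¹ • ∑ y, Real.exp (-G.energy θ (z y)) •
        innerSL ℝ (WithLp.toLp 2 (G.statistic (z y)))) θ := by
  refine HasFDerivAt.log ?_ (partitionFn_pos _).ne'
  refine HasFDerivAt.fun_sum fun y _ => ?_
  refine HasFDerivAt.exp ?_
  simp only [neg_energy_eq]
  exact ContinuousLinearMap.hasFDerivAt _

theorem gradient_apply_of_hasFDerivAt {ι : Type*} [Fintype ι] [DecidableEq ι]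
    {f : EuclideanSpace ℝ ι → ℝ} {L : EuclideanSpace ℝ ι →L[ℝ] ℝ} {θ : EuclideanSpace ℝ ι}
    (h : HasFDerivAt f L θ) (c : ι) : gradient f θ c = L (EuclideanSpace.single c 1) := by
  have h1 : inner ℝ (gradient f θ) (EuclideanSpace.single c 1) = L (EuclideanSpace.single c 1) := by
    rw [gradient, InnerProductSpace.toDual_symm_apply, h.fderiv]
  rw [← h1, EuclideanSpace.inner_single_right]
  simp

/-- The log-likelihood of a training vector is the difference of the clamped and the free log
partition function. -/
theorem log_sum_gibbs_join (θ : G.Params) (x : G.Visible) :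
    Real.log (∑ h, gibbs (G.energy θ) (G.join x h)) =
      Real.log (partitionFn fun h => G.energy θ (G.join x h)) -
        Real.log (partitionFn fun z => G.energy θ z) := by
  rw [← Real.log_div (partitionFn_pos _).ne' (partitionFn_pos _).ne']
  simp only [gibbs, ← Finset.sum_div]
  rfl

/-- The gradient of the objective is the mean of the estimate under exact samples. -/
theorem gradient_objective (x : Fin N → G.Visible) (lam : ℝ) (θ : G.Params) :
    DifferentiableAt ℝ (G.objective x lam) θ ∧ ∀ c, gradient (G.objective x lam) θ c =
      G.exactMean x lam θ (gibbs (G.energy θ)) (fun k => gibbs (G.clampedEnergy θ (x k))) c := by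
  have h1 : HasFDerivAt (fun θ : G.Params => ∑ e : Fin G.numEdges, θ (Sum.inr e) ^ 2)
      (∑ e : Fin G.numEdges, (2 * θ (Sum.inr e)) •
        (EuclideanSpace.proj (Sum.inr e) : G.Params →L[ℝ] ℝ)) θ := by
    refine HasFDerivAt.fun_sum fun e _ => ?_
    have h := ((EuclideanSpace.proj (Sum.inr e) : G.Params →L[ℝ] ℝ).hasFDerivAt (x := θ)).pow 2
    simpa using h
  have h2 : HasFDerivAt (G.objective x lam) _ θ :=
    ((HasFDerivAt.fun_sum (u := Finset.univ) fun k _ =>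
      (G.hasFDerivAt_log_partitionFn (G.join (x k)) θ).sub
        (G.hasFDerivAt_log_partitionFn (fun z => z) θ)).const_mul (1 / (N : ℝ))).sub
      (h1.const_mul (lam / 2)) |>.congr_of_eventuallyEq (Filter.Eventually.of_forall fun θ => by
        simp only [objective, log_sum_gibbs_join, Pi.sub_apply])
  refine ⟨h2.differentiableAt, fun c => ?_⟩
  have hs : ∀ z, innerSL ℝ (WithLp.toLp 2 (G.statistic z)) (EuclideanSpace.single c (1 : ℝ)) =
      G.statistic z c := by
    intro z
    rw [innerSL_apply_apply, EuclideanSpace.inner_single_right]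
    simp
  have hr : ∑ e : Fin G.numEdges, 2 * θ (Sum.inr e) *
      (EuclideanSpace.proj (Sum.inr e) : G.Params →L[ℝ] ℝ) (EuclideanSpace.single c (1 : ℝ)) =
        2 * G.regularized θ c := by
    change ∑ e : Fin G.numEdges, 2 * θ (Sum.inr e) *
      (EuclideanSpace.single c (1 : ℝ) : G.Params) (Sum.inr e) = 2 * G.regularized θ c
    rcases c with i | e <;> simp [regularized]
  have hm : ∀ {m : ℕ} (z : (Fin m → Bool) → G.Config),
      (partitionFn fun y => G.energy θ (z y))⁻¹ *
        ∑ y, Real.exp (-G.energy θ (z y)) * G.statistic (z y) c =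
      ∑ y, gibbs (fun y => G.energy θ (z y)) y * G.statistic (z y) c := by
    intro m z
    rw [Finset.mul_sum]
    refine Finset.sum_congr rfl fun y _ => ?_
    rw [gibbs]
    ring
  rw [gradient_apply_of_hasFDerivAt h2]
  simp only [sub_apply, smul_apply, sum_apply, smul_eq_mul, hs, hr, hm]
  rw [show lam / 2 * (2 * G.regularized θ c) = lam * G.regularized θ c by ring]
  rfl

end BMGraph

/-! ### The two kinds of runs -/

namespace BMGraph

variable (G : BMGraph)

/-- The run for the model samples all units. -/
theorem modelLaw_spec (hG : G.graph.Connected) (hE : 1 ≤ G.numEdges) {ℓ : ℕ} (hl : 1 ≤ ℓ)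
    (hEl : (G.numEdges : ℝ) ≤ 2 ^ ℓ) {θ : G.Params} (hθ : ∀ c, |θ c| ≤ 2 ^ ℓ)
    {μ : Fin (G.nv + G.nh) → ℝ} {κ : ℝ} (hμ : ∀ i, μ i ∈ Set.Icc (0 : ℝ) 1)
    (hκ : IsKappa (G.energy θ) μ κ) (hκl : κ ≤ 2 ^ ℓ) {law : G.Config → ℝ}
    (hlaw : law = boltzmannSampler.modelLaw G ℓ θ μ κ) :
    (∀ y, 0 ≤ law y) ∧ ∑ y, law y = 1 ∧
    ∑ y, |law y - gibbs (G.energy θ) y| ≤ (1 / 2) ^ (11 * ℓ) ∧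
    expectedOps (boltzmannSampler.model (G.shape ℓ))
      (G.modelInput (boltzmannSampler.prec * ℓ) θ μ κ) (G.nv + G.nh) ≤ ENNReal.ofReal
      (10 ^ 8 * G.numEdges * Real.sqrt κ * ℓ ^ 3) :=
  G.sampleShape_run_spec hG hE hl hEl hθ (v := 0) (h := G.nv + G.nh) (xs := []) (z := fun y => y)
    (Nat.zero_add _) rfl (fun y i => by
      rw [if_neg (Nat.not_lt_zero _), Nat.sub_zero, extend_val]) hμ hκ hκl
    (input := G.modelInput (20 * ℓ) θ μ κ) (List.append_nil _).symm hlaw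

/-- The run for a training vector samples the hidden units, with the visible units clamped. -/
theorem dataLaw_spec (hG : G.graph.Connected) (hE : 1 ≤ G.numEdges) {ℓ : ℕ} (hl : 1 ≤ ℓ)
    (hEl : (G.numEdges : ℝ) ≤ 2 ^ ℓ) {θ : G.Params} (hθ : ∀ c, |θ c| ≤ 2 ^ ℓ) (x : G.Visible)
    {ν : Fin G.nh → ℝ} {κ : ℝ} (hν : ∀ i, ν i ∈ Set.Icc (0 : ℝ) 1)
    (hκ : IsKappa (G.clampedEnergy θ x) ν κ) (hκl : κ ≤ 2 ^ ℓ) {law : G.Hidden → ℝ}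
    (hlaw : law = boltzmannSampler.dataLaw G ℓ θ x ν κ) :
    (∀ y, 0 ≤ law y) ∧ ∑ y, law y = 1 ∧
    ∑ y, |law y - gibbs (G.clampedEnergy θ x) y| ≤ (1 / 2) ^ (11 * ℓ) ∧
    expectedOps (boltzmannSampler.data (G.shape ℓ))
      (G.dataInput (boltzmannSampler.prec * ℓ) θ x ν κ) G.nh ≤ ENNReal.ofReal
      (10 ^ 8 * G.numEdges * Real.sqrt κ * ℓ ^ 3) :=
  G.sampleShape_run_spec hG hE hl hEl hθ (v := G.nv) (h := G.nh) (xs := List.ofFn x)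
    (z := G.join x) rfl (List.length_ofFn) (fun y i => by
      rw [join]
      induction i using Fin.addCases with
      | left i =>
        rw [Fin.append_left, Fin.val_castAdd, if_pos i.2, List.getD_eq_getElem _ _ (by simp)]
        simp
      | right i =>
        rw [Fin.append_right, Fin.val_natAdd, if_neg (by omega), Nat.add_sub_cancel_left,
          extend_val]) hν hκ hκl
    (input := G.dataInput (20 * ℓ) θ x ν κ) rfl hlaw

end BMGraph

end

theorem mainTheorem1 :
    ∃ (A : SamplingAlgorithm) (C : ℝ) (a : ℕ),
      ∀ (G : BMGraph), G.graph.Connected → 1 ≤ G.numEdges →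
      ∀ (N : ℕ), 1 ≤ N →
      ∀ (x : Fin N → G.Visible) (lam : ℝ) (θ : G.Params)
        (μ : Fin (G.nv + G.nh) → ℝ) (κ : ℝ) (ν : Fin N → Fin G.nh → ℝ) (κx : Fin N → ℝ),
      IsMeanField (G.energy θ) μ → IsKappa (G.energy θ) μ κ →
      (∀ k, IsMeanField (G.clampedEnergy θ (x k)) (ν k)) →
      (∀ k, IsKappa (G.clampedEnergy θ (x k)) (ν k) (κx k)) →
      ∀ (ℓ : ℕ), 1 ≤ ℓ → (N : ℝ) ≤ 2 ^ ℓ → (G.numEdges : ℝ) ≤ 2 ^ ℓ → κ ≤ 2 ^ ℓ →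
      (∀ k, κx k ≤ 2 ^ ℓ) → (∀ c, |θ c| ≤ 2 ^ ℓ) →
      ∀ law : (Fin N → G.Config) → (Fin N → G.Hidden) → ℝ,
      law = G.jointLaw (A.modelLaw G ℓ θ μ κ) (fun k => A.dataLaw G ℓ θ (x k) (ν k) (κx k)) →
      A.totalExpectedOps G ℓ θ x μ κ ν κx ≤
          ENNReal.ofReal (C * N * G.numEdges * (Real.sqrt κ + Real.sqrt (⨆ k, κx k)) * ℓ ^ a) ∧
      (∑ s, ∑ t, |law s t - G.jointLaw (gibbs (G.energy θ))
          (fun k => gibbs (G.clampedEnergy θ (x k))) s t|) ≤ (1 / 2) ^ ℓ ∧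
      DifferentiableAt ℝ (G.objective x lam) θ ∧
      ∀ c,
        |(∑ s, ∑ t, law s t * G.estimate x lam θ s t c)
            - gradient (G.objective x lam) θ c| ≤ (1 / 2) ^ ℓ ∧
        (∑ s, ∑ t, law s t *
            (G.estimate x lam θ s t c - gradient (G.objective x lam) θ c) ^ 2)
          ≤ 1 / (2 * N) + (1 / 2) ^ ℓ := by
  refine ⟨boltzmannSampler, 10 ^ 8, 3, ?_⟩
  intro G hG hE N hN x lam θ μ κ ν κx hμ hκ hν hκx ℓ hl hNl hEl hκl hκxl hθ law hlaw
  obtain ⟨p1, p2, p3, p4⟩ := G.modelLaw_spec hG hE hl hEl hθ hμ.1 hκ hκl rfl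
  have hq := fun k => G.dataLaw_spec hG hE hl hEl hθ (x k) (hν k).1 (hκx k) (hκxl k) rfl
  have g1 := fun z => (gibbs_pos (G.energy θ) z).le
  have g2 := sum_gibbs (G.energy θ)
  have g3 := fun k h => (gibbs_pos (G.clampedEnergy θ (x k)) h).le
  have g4 := fun k => sum_gibbs (G.clampedEnergy θ (x k))
  -- the distance of the joint laws
  have hε : ∑ s, ∑ t, |law s t - G.jointLaw (gibbs (G.energy θ))
      (fun k => gibbs (G.clampedEnergy θ (x k))) s t| ≤ (1 / 2) ^ ℓ / 4 := by
    rw [hlaw]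
    refine (G.sum_abs_jointLaw_sub_le p1 p2 g1 g2 (fun k => (hq k).1) (fun k => (hq k).2.1) g3 g4
      p3 fun k => (hq k).2.2.1).trans ?_
    have e : (1 / 2 : ℝ) ^ (11 * ℓ) = (1 / 2) ^ ℓ * ((1 / 2) ^ ℓ * (1 / 2) ^ (9 * ℓ)) := by
      rw [← pow_add, ← pow_add]
      ring_nf
    have h1 : (2 : ℝ) ^ ℓ * (1 / 2) ^ ℓ = 1 := by rw [← mul_pow]; norm_num
    have h2 : (1 / 2 : ℝ) ^ (9 * ℓ) ≤ (1 / 2) ^ 9 :=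
      pow_le_pow_of_le_one (by norm_num) (by norm_num) (by omega)
    calc (N : ℝ) * (2 * (1 / 2) ^ (11 * ℓ)) ≤ 2 ^ ℓ * (2 * (1 / 2) ^ (11 * ℓ)) := by gcongr
      _ = 2 * (1 / 2) ^ ℓ * (2 ^ ℓ * (1 / 2) ^ ℓ) * (1 / 2) ^ (9 * ℓ) := by rw [e]; ring
      _ ≤ 2 * (1 / 2) ^ ℓ * 1 * (1 / 2) ^ 9 := by rw [h1]; gcongr
      _ ≤ (1 / 2) ^ ℓ / 4 := by
        have : (0 : ℝ) < (1 / 2) ^ ℓ := by positivity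
        linarith
  have hpow : (0 : ℝ) < (1 / 2) ^ ℓ := by positivity
  have hsum : ∑ s, ∑ t, law s t = 1 := by
    rw [hlaw]
    exact G.sum_jointLaw p2 fun k => (hq k).2.1
  obtain ⟨hdiff, hgrad⟩ := G.gradient_objective x lam θ
  refine ⟨?_, hε.trans (by linarith), hdiff, fun c => ?_⟩
  · have hsup : ∀ k, κx k ≤ ⨆ k, κx k := fun k => le_ciSup (Set.finite_range κx).bddAbove k
    set S := ⨆ k, κx k
    rw [SamplingAlgorithm.totalExpectedOps]
    calc _ ≤ (N : ENNReal) * ENNReal.ofReal (10 ^ 8 * G.numEdges * Real.sqrt κ * ℓ ^ 3) +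
          ∑ _k : Fin N, ENNReal.ofReal (10 ^ 8 * G.numEdges * Real.sqrt S * ℓ ^ 3) := by
          refine add_le_add (mul_le_mul_right p4 _) (Finset.sum_le_sum fun k _ => ?_)
          refine (hq k).2.2.2.trans (ENNReal.ofReal_le_ofReal ?_)
          have := Real.sqrt_le_sqrt (hsup k)
          gcongr
      _ = ENNReal.ofReal (N * (10 ^ 8 * G.numEdges * Real.sqrt κ * ℓ ^ 3) +
          N * (10 ^ 8 * G.numEdges * Real.sqrt S * ℓ ^ 3)) := by
          rw [ENNReal.ofReal_add (by positivity) (by positivity),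
            ENNReal.ofReal_mul (p := (N : ℝ)) (by positivity),
            ENNReal.ofReal_mul (p := (N : ℝ)) (by positivity), ENNReal.ofReal_natCast,
            Finset.sum_const, Finset.card_univ, Fintype.card_fin, nsmul_eq_mul]
      _ = _ := by
          congr 1
          ring
  · obtain ⟨h1, h2⟩ := G.moments_estimate_of_close (x := x) (lam := lam) (θ := θ) (c := c)
      g1 g2 g3 g4 hN hsum hε
    rw [hgrad c]
    exact ⟨h1.trans (by linarith), h2.trans (by linarith)⟩
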